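/- Let $\mathbb S^1=\mathbb R/\mathbb Z$, let $d(x,y)=\min_{k\in\mathbb Z}|x-y-k|$, and write $H^k=H^k(\mathbb S^1;\mathbb R^2)$ with norm $\|u\|_{H^k}^2=\sum_{j=0}^k\|\partial_x^ju\|_{L^2}^2$. For a continuous $\gamma:\mathbb S^1\to\mathbb R^2$ let $|\gamma|_*=\inf_{x\ne y}|\gamma(x)-\gamma(y)|/d(x,y)$, and let $V=\{\gamma\in H^2:\ |\gamma|_*>0\}$ (with $\gamma$ identified with its continuous representative). For $\gamma\in V$ put $$\tau(\gamma)=\frac{\partial_x\gamma}{|\partial_x\gamma|},\qquad \nu(\gamma)=\begin{pmatrix}0&1\\-1&0\end{pmatrix}\tau(\gamma),\qquad \kappa(\gamma)=-\frac{\nu(\gamma)\cdot\partial_x^2\gamma}{|\partial_x\gamma|},\qquad \Delta\gamma(x,y)=\gamma(y)-\gamma(x),$$ $$K(\gamma)(x,y)=\frac{(\nu(\gamma)(x)\cdot\Delta\gamma(x,y))\,(\nu(\gamma)(y)\cdot\Delta\gamma(x,y))}{|\Delta\gamma(x,y)|^3},\qquad F(\gamma)(x)=-\frac1{2\pi}\int_{\mathbb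 S^1}K(\gamma)(x,y)\,\kappa(\gamma)(y)\,dy,$$ $$A(\gamma)=\frac{1}{\pi|\partial_x\gamma|^2}\,\partial_x^2,\qquad f(\gamma)=F(\gamma)\,\nu(\gamma).$$ For $T>0$ let $\mathbb E(0,T)=H^1(0,T;H^1)\cap L^2(0,T;H^3)$ with norm $\|\eta\|_{\mathbb E(0,T)}^2=\|\eta\|_{L^2(0,T;H^1)}^2+\|\partial_t\eta\|_{L^2(0,T;H^1)}^2+\|\eta\|_{L^2(0,T;H^3)}^2$, and for $\gamma_0\in H^2$ let $B_\varepsilon(\gamma_0)=\{\eta\in H^2:\|\eta-\gamma_0\|_{H^2}<\varepsilon\}$. **Theorem.** Let $\gamma_0\in V$. Then there exist $T=T(\gamma_0)>0$ and $\varepsilon=\varepsilon(\gamma_0)>0$ such that $B_\varepsilon(\gamma_0)\subset V$ and, for every $\gamma_1\in B_\varepsilon(\gamma_0)$, the problem $$\partial_t\gamma=A(\gamma)\gamma+f(\gamma)\ \text{ on }\mathbb S^1\times(0,T)\ (\text{for almost every } t \text{ and } x),\qquad \gamma(0)=\gamma_1,$$ has a unique solution $\gamma(\cdot;\gamma_1)\in\mathbb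 E(0,T)\cap C([0,T];V)$, where $V$ carries the topology of $H^2$. Furthermore, there is a constant $C=C(\gamma_0)>0$ such that $$\|\gamma(\cdot;\gamma_1)-\gamma(\cdot;\gamma_2)\|_{\mathbb E(0,T)}\le C\,\|\gamma_1-\gamma_2\|_{H^2}\qquad\text{for all }\gamma_1,\gamma_2\in B_\varepsilon(\gamma_0).$$ -/

import Mathlib

open MeasureTheory Set
open scoped ContDiff

noncomputable section

namespace Langmuir

/-- The target plane `ℝ²` with its Euclidean norm. -/
abbrev Plane : Type := EuclideanSpace ℝ (Fin 2)

/-- The circle `𝕊¹ = ℝ/ℤ`; its distance is the geodesic distance `min_k |x - y - k|`, its volume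
is the Lebesgue measure (of total mass one). -/
abbrev Circ : Type := UnitAddCircle

/-- `L²(𝕊¹; ℝ²)`. -/
abbrev L2 : Type := Lp Plane 2 (volume : Measure Circ)

/-- Integration against a fixed bounded measurable weight is a continuous linear map on a vector
valued `L²` space over a finite measure. -/
theorem exists_weightedIntegral {α : Type*} [MeasurableSpace α] {μ : Measure α}
    [IsFiniteMeasure μ] {X : Type*} [NormedAddCommGroup X] [NormedSpace ℝ X] (g : α → ℝ) (C : ℝ)
    (hg : AEStronglyMeasurable g μ) (hC : ∀ x, ‖g x‖ ≤ C) :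
    ∃ L : Lp X 2 μ →L[ℝ] X, ∀ u : Lp X 2 μ, L u = ∫ x, g x • u x ∂μ := by
  have hint : ∀ u : Lp X 2 μ, Integrable (fun x => u x) μ := fun u =>
    (Lp.memLp u).integrable (by norm_num)
  have hgi : ∀ u : Lp X 2 μ, Integrable (fun x => g x • u x) μ := fun u =>
    (hint u).bdd_smul C hg (Filter.Eventually.of_forall hC)
  let M : Lp X 2 μ →ₗ[ℝ] X :=
    { toFun := fun u => ∫ x, g x • u x ∂μ
      map_add' := by
        intro u v
        rw [← integral_add (hgi u) (hgi v)]
        refine integral_congr_ae ?_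
        filter_upwards [Lp.coeFn_add u v] with x hx
        rw [hx, Pi.add_apply, smul_add]
      map_smul' := by
        intro c u
        rw [RingHom.id_apply, ← integral_smul]
        refine integral_congr_ae ?_
        filter_upwards [Lp.coeFn_smul c u] with x hx
        rw [hx, Pi.smul_apply, smul_comm] }
  refine ⟨M.mkContinuous (|C| * (μ univ ^ (1 / (1 : ENNReal).toReal -
    1 / (2 : ENNReal).toReal)).toReal) ?_, fun u => rfl⟩
  intro u
  have h1 : eLpNorm u 1 μ ≤ eLpNorm u 2 μ * μ univ ^ (1 / (1 : ENNReal).toReal -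
      1 / (2 : ENNReal).toReal) :=
    eLpNorm_le_eLpNorm_mul_rpow_measure_univ (by norm_num) (Lp.aestronglyMeasurable u)
  have h2 : ∫ x, ‖u x‖ ∂μ = (eLpNorm u 1 μ).toReal := by
    rw [eLpNorm_one_eq_lintegral_enorm, integral_norm_eq_lintegral_enorm
      (Lp.aestronglyMeasurable u)]
  have hfin : μ univ ^ (1 / (1 : ENNReal).toReal - 1 / (2 : ENNReal).toReal) ≠ ⊤ :=
    ENNReal.rpow_ne_top_of_nonneg (by norm_num) (measure_ne_top μ univ)
  have h3 : ∫ x, ‖u x‖ ∂μ ≤ ‖u‖ * (μ univ ^ (1 / (1 : ENNReal).toReal -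
      1 / (2 : ENNReal).toReal)).toReal := by
    rw [h2, Lp.norm_def, ← ENNReal.toReal_mul]
    exact ENNReal.toReal_mono (ENNReal.mul_ne_top (Lp.eLpNorm_ne_top u) hfin) h1
  calc ‖∫ x, g x • u x ∂μ‖ ≤ ∫ x, |C| * ‖u x‖ ∂μ := by
        refine norm_integral_le_of_norm_le ((hint u).norm.const_mul _)
          (Filter.Eventually.of_forall fun x => ?_)
        rw [norm_smul]
        exact mul_le_mul_of_nonneg_right ((hC x).trans (le_abs_self C)) (norm_nonneg _)
    _ = |C| * ∫ x, ‖u x‖ ∂μ := integral_const_mul _ _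
    _ ≤ |C| * (‖u‖ * (μ univ ^ (1 / (1 : ENNReal).toReal -
          1 / (2 : ENNReal).toReal)).toReal) := mul_le_mul_of_nonneg_left h3 (abs_nonneg C)
    _ = _ := by ring

/-! ### Sobolev spaces on the circle -/

/-- `v` is the weak derivative of `u` on the circle: `∫ φ' u = - ∫ φ v` for every smooth real
function `φ` on the circle (with derivative `φ'`). -/
def HasWeakDeriv (u v : L2) : Prop :=
  ∀ φ φ' : C(Circ, ℝ), ContDiff ℝ ∞ (fun s : ℝ => φ (s : Circ)) →
    (∀ s : ℝ, HasDerivAt (fun r : ℝ => φ (r : Circ)) (φ' (s : Circ)) s) →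
      ∫ x, φ' x • u x = -∫ x, φ x • v x

theorem exists_circlePairing (φ : C(Circ, ℝ)) :
    ∃ L : L2 →L[ℝ] Plane, ∀ u : L2, L u = ∫ x, φ x • u x :=
  exists_weightedIntegral (fun x => φ x) ‖φ‖ φ.continuous.aestronglyMeasurable
    (fun x => φ.norm_coe_le_norm x)

/-- The Sobolev space `H^k(𝕊¹; ℝ²)`: an element is the tuple `(u, ∂ₓu, …, ∂ₓᵏu)` of a function
`u ∈ L²` and its weak derivatives up to order `k`, all in `L²`. The norm is
`(∑_{j ≤ k} ‖∂ₓʲu‖²_{L²})^{1/2}`. -/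
def sobolev (k : ℕ) : Submodule ℝ (PiLp 2 (fun _ : Fin (k + 1) => L2)) where
  carrier := {u | ∀ j : Fin k, HasWeakDeriv (u j.castSucc) (u j.succ)}
  zero_mem' := by
    intro j φ φ' _ _
    obtain ⟨L, hL⟩ := exists_circlePairing φ
    obtain ⟨L', hL'⟩ := exists_circlePairing φ'
    rw [← hL, ← hL']
    simp
  add_mem' := by
    intro u v hu hv j φ φ' h h'
    have h1 := hu j φ φ' h h'
    have h2 := hv j φ φ' h h'
    obtain ⟨L, hL⟩ := exists_circlePairing φ
    obtain ⟨L', hL'⟩ := exists_circlePairing φ'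
    rw [← hL, ← hL'] at h1 h2 ⊢
    simp only [PiLp.add_apply, map_add, h1, h2]
    abel
  smul_mem' := by
    intro c u hu j φ φ' h h'
    have h1 := hu j φ φ' h h'
    obtain ⟨L, hL⟩ := exists_circlePairing φ
    obtain ⟨L', hL'⟩ := exists_circlePairing φ'
    rw [← hL, ← hL'] at h1 ⊢
    simp only [PiLp.smul_apply, map_smul, h1, smul_neg]

/-- `H^k = H^k(𝕊¹; ℝ²)` as a type. -/
abbrev H (k : ℕ) : Type := sobolev k

/-- The `j`-th weak derivative `∂ₓʲu ∈ L²` of `u ∈ H^k`, `0 ≤ j ≤ k`; for `j = 0` it is `u`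
itself. -/
def H.der {k : ℕ} (u : H k) (j : Fin (k + 1)) : L2 := (u : PiLp 2 (fun _ : Fin (k + 1) => L2)) j

/-- The element of `L²` underlying `u ∈ H^k`. Elements of different Sobolev spaces are the same
function iff their images here agree. -/
def H.toL2 {k : ℕ} (u : H k) : L2 := u.der 0

theorem isClosed_sobolev (k : ℕ) :
    IsClosed (sobolev k : Set (PiLp 2 (fun _ : Fin (k + 1) => L2))) := by
  have : (sobolev k : Set (PiLp 2 (fun _ : Fin (k + 1) => L2))) =
      {u | ∀ j : Fin k, HasWeakDeriv (u j.castSucc) (u j.succ)} := rfl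
  rw [this]
  simp only [HasWeakDeriv, ofPred_forall]
  refine isClosed_iInter fun j => isClosed_iInter fun φ => isClosed_iInter fun φ' =>
    isClosed_iInter fun _ => isClosed_iInter fun _ => ?_
  obtain ⟨L, hL⟩ := exists_circlePairing φ
  obtain ⟨L', hL'⟩ := exists_circlePairing φ'
  simp only [← hL, ← hL']
  exact isClosed_eq (L'.continuous.comp (PiLp.continuous_apply 2 _ _))
    (L.continuous.comp (PiLp.continuous_apply 2 _ _)).neg

/-- `H^k` is a Hilbert space. -/
instance instCompleteSpaceH (k : ℕ) : CompleteSpace (H k) :=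
  (isClosed_sobolev k).completeSpace_coe

/-! ### The admissible set -/

/-- The chord-arc constant `inf_{x ≠ y} |g(x) - g(y)| / d(x, y)` of a continuous closed curve. -/
def chordArc (g : C(Circ, Plane)) : ℝ :=
  ⨅ p : {p : Circ × Circ // p.1 ≠ p.2}, ‖g p.1.1 - g p.1.2‖ / dist p.1.1 p.1.2

/-- The admissible set `V`: the curves in `H²` whose (unique) continuous representative has a
positive chord-arc constant. -/
def V : Set (H 2) :=
  {γ | ∃ g : C(Circ, Plane), (∀ᵐ x, γ.toL2 x = g x) ∧ 0 < chordArc g}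

/-! ### The operators of the evolution equation

All functions of `x ∈ 𝕊¹` below are determined up to null sets. -/

/-- Rotation by the matrix `(0, 1; -1, 0)`. -/
def rot (v : Plane) : Plane := !₂[v 1, -v 0]

/-- Unit tangent `τ(γ) = ∂ₓγ / |∂ₓγ|`. -/
def tangent (γ : H 2) (x : Circ) : Plane := ‖γ.der 1 x‖⁻¹ • γ.der 1 x

/-- Unit normal `ν(γ)`, the rotated unit tangent. -/
def normal (γ : H 2) (x : Circ) : Plane := rot (tangent γ x)

/-- Curvature density `κ(γ) = - ν(γ) · ∂ₓ²γ / |∂ₓγ|`. -/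
def curvature (γ : H 2) (x : Circ) : ℝ :=
  -(inner ℝ (normal γ x) (γ.der 2 x) / ‖γ.der 1 x‖)

/-- The chord `Δγ(x, y) = γ(y) - γ(x)`. -/
def chord (γ : H 2) (x y : Circ) : Plane := γ.toL2 y - γ.toL2 x

/-- The kernel `K(γ)(x, y) = (ν(γ)(x) · Δγ) (ν(γ)(y) · Δγ) / |Δγ|³`. -/
def kernelK (γ : H 2) (x y : Circ) : ℝ :=
  inner ℝ (normal γ x) (chord γ x y) * inner ℝ (normal γ y) (chord γ x y) / ‖chord γ x y‖ ^ 3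

/-- The nonlocal forcing `F(γ)(x) = - (2π)⁻¹ ∫ K(γ)(x, y) κ(γ)(y) dy`. -/
def forcing (γ : H 2) (x : Circ) : ℝ :=
  -(1 / (2 * Real.pi)) * ∫ y, kernelK γ x y * curvature γ y

/-- The lower order term `f(γ) = F(γ) ν(γ)`. -/
def lowerOrder (γ : H 2) (x : Circ) : Plane := forcing γ x • normal γ x

/-- The operator `A(γ)η = (π |∂ₓγ|²)⁻¹ ∂ₓ²η`. -/
def opA (γ : H 2) (η : H 3) (x : Circ) : Plane := (Real.pi * ‖γ.der 1 x‖ ^ 2)⁻¹ • η.der 2 x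

/-! ### The solution space -/

/-- Lebesgue measure on the time interval `(0, T)`. -/
abbrev timeMeasure (T : ℝ) : Measure ℝ := volume.restrict (Ioo 0 T)

/-- `L²(0, T; H^k)`. -/
abbrev LTime (T : ℝ) (k : ℕ) : Type := Lp (H k) 2 (timeMeasure T)

/-- `w` is the weak time derivative of `v` on `(0, T)`: `∫ φ'(t) v(t) dt = - ∫ φ(t) w(t) dt` in
`H^k` for every `φ ∈ C_c^∞((0, T))`. -/
def HasWeakTimeDeriv {T : ℝ} {k : ℕ} (v w : LTime T k) : Prop :=
  ∀ φ : ℝ → ℝ, ContDiff ℝ ∞ φ → HasCompactSupport φ → tsupport φ ⊆ Ioo 0 T →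
    ∫ t in Ioo 0 T, deriv φ t • v t = -∫ t in Ioo 0 T, φ t • w t

theorem exists_timePairing {T : ℝ} {k : ℕ} (φ : ℝ → ℝ) (h : Continuous φ)
    (h' : HasCompactSupport φ) :
    ∃ L : LTime T k →L[ℝ] H k, ∀ v : LTime T k, L v = ∫ t in Ioo 0 T, φ t • v t := by
  obtain ⟨C, hC⟩ := h'.exists_bound_of_continuous h
  exact exists_weightedIntegral φ C h.aestronglyMeasurable hC

/-- The ambient Hilbert space `L²(0, T; H³) ⊕ L²(0, T; H¹) ⊕ L²(0, T; H¹)`, with the sum of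
the inner products. -/
abbrev Ambient (T : ℝ) : Type :=
  WithLp 2 (LTime T 3 × WithLp 2 (LTime T 1 × LTime T 1))

/-- The space `𝔼(0, T) = H¹(0, T; H¹) ∩ L²(0, T; H³)`: an element is the triple `(η, η, ∂ₜη)`
formed by a function `η`, seen in `L²(0, T; H³)` and in `L²(0, T; H¹)`, and its weak time
derivative in `L²(0, T; H¹)`. Hence the norm is
`‖η‖² = ‖η‖²_{L²(0,T;H³)} + (‖η‖²_{L²(0,T;H¹)} + ‖∂ₜη‖²_{L²(0,T;H¹)})`. -/
def solSpace (T : ℝ) : Submodule ℝ (Ambient T) where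
  carrier := {p | (∀ᵐ t ∂timeMeasure T, (p.fst t).toL2 = (p.snd.fst t).toL2) ∧
    HasWeakTimeDeriv p.snd.fst p.snd.snd}
  zero_mem' := by
    refine ⟨?_, ?_⟩
    · filter_upwards [Lp.coeFn_zero (H 3) 2 (timeMeasure T),
        Lp.coeFn_zero (H 1) 2 (timeMeasure T)] with t h3 h1
      change ((0 : LTime T 3) t).toL2 = ((0 : LTime T 1) t).toL2
      rw [h3, h1]
      rfl
    · intro φ h h' _
      obtain ⟨L, hL⟩ := exists_timePairing (T := T) (k := 1) φ h.continuous h'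
      obtain ⟨L', hL'⟩ := exists_timePairing (T := T) (k := 1) (deriv φ)
        (h.continuous_deriv (by simp)) h'.deriv
      rw [← hL, ← hL']
      simp
  add_mem' := by
    intro p q hp hq
    refine ⟨?_, ?_⟩
    · filter_upwards [hp.1, hq.1, Lp.coeFn_add p.fst q.fst,
        Lp.coeFn_add p.snd.fst q.snd.fst] with t h1 h2 h3 h4
      change ((p.fst + q.fst : LTime T 3) t).toL2 = ((p.snd.fst + q.snd.fst : LTime T 1) t).toL2
      rw [h3, h4]
      change (p.fst t).toL2 + (q.fst t).toL2 = (p.snd.fst t).toL2 + (q.snd.fst t).toL2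
      rw [h1, h2]
    · intro φ h h' hs
      have h1 := hp.2 φ h h' hs
      have h2 := hq.2 φ h h' hs
      obtain ⟨L, hL⟩ := exists_timePairing (T := T) (k := 1) φ h.continuous h'
      obtain ⟨L', hL'⟩ := exists_timePairing (T := T) (k := 1) (deriv φ)
        (h.continuous_deriv (by simp)) h'.deriv
      rw [← hL, ← hL'] at h1 h2 ⊢
      simp only [WithLp.add_fst, WithLp.add_snd, map_add, h1, h2]
      abel
  smul_mem' := by
    intro c p hp
    refine ⟨?_, ?_⟩
    · filter_upwards [hp.1, Lp.coeFn_smul c p.fst, Lp.coeFn_smul c p.snd.fst] with t h1 h3 h4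
      change ((c • p.fst : LTime T 3) t).toL2 = ((c • p.snd.fst : LTime T 1) t).toL2
      rw [h3, h4]
      change c • (p.fst t).toL2 = c • (p.snd.fst t).toL2
      rw [h1]
    · intro φ h h' hs
      have h1 := hp.2 φ h h' hs
      obtain ⟨L, hL⟩ := exists_timePairing (T := T) (k := 1) φ h.continuous h'
      obtain ⟨L', hL'⟩ := exists_timePairing (T := T) (k := 1) (deriv φ)
        (h.continuous_deriv (by simp)) h'.deriv
      rw [← hL, ← hL'] at h1 ⊢
      simp only [WithLp.smul_fst, WithLp.smul_snd, map_smul, h1, smul_neg]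

/-- `𝔼(0, T)` as a type. -/
abbrev E (T : ℝ) : Type := solSpace T

/-- The value `u(t) ∈ H³`, for almost every `t`. -/
def E.val {T : ℝ} (u : E T) : LTime T 3 := (u : Ambient T).fst

/-- The weak time derivative `∂ₜu ∈ L²(0, T; H¹)`. -/
def E.dt {T : ℝ} (u : E T) : LTime T 1 := (u : Ambient T).snd.snd

/-- `u ∈ 𝔼(0, T) ∩ C([0, T]; V)` solves `∂ₜu = A(u)u + f(u)` on `(0, T)` with `u(0) = γ₁`.
Here `c` is the representative of `u` in `C([0, T]; V)`. The equation holds for almost every `t`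
and almost every `x`. -/
def IsSolution (T : ℝ) (γ₁ : H 2) (u : E T) : Prop :=
  ∃ c : ℝ → H 2, ContinuousOn c (Icc 0 T) ∧ (∀ t ∈ Icc 0 T, c t ∈ V) ∧
    (∀ᵐ t ∂timeMeasure T, (u.val t).toL2 = (c t).toL2) ∧
    c 0 = γ₁ ∧
    ∀ᵐ t ∂timeMeasure T, ∀ᵐ x : Circ,
      (u.dt t).toL2 x = opA (c t) (u.val t) x + lowerOrder (c t) x

end Langmuir

end

open Filter Topology
open scoped ENNReal

set_option linter.unusedSectionVars false

namespace Langmuir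

noncomputable section

/-! ### Absolutely continuous functions -/

section AbsolutelyContinuous

variable {Y Z : Type*} [NormedAddCommGroup Y] [NormedAddCommGroup Z]

/-! The problem is quasilinear parabolic in the scale `H³ ⊂ H² ⊂ H¹` and is treated as a
perturbation of the equation frozen at `γ₀`. With `a = (π|∂ₓγ₀|²)⁻¹` and `B = 1 - a ∂ₓ²` it reads
`∂ₜu + B u = u + (A(u) - A(γ₀)) u + f(u)`.

Linear part. The operator `B` is symmetric for the inner product `b(u,v) = ∫ u'v' + ∫ a⁻¹uv` on
`H¹`, and its form `Q` is equivalent to the `H²` inner product (`WeightPair.Q_eq`). Squaring `∂ₜu +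
B u = g` in `b` gives the identity `∫ b(∂ₜu,∂ₜu) + ∫ b(Bu,Bu) + Q(u(t),u(t)) = Q(u₀,u₀) + ∫ b(g,g)`,
which is maximal regularity with a constant independent of `T` (`smooth_energy`). Existence follows
by density: the operator `B⁻¹` plus time integration is strictly positive and therefore has dense
range (`exists_solves_aux`).

Nonlinear part. Once `A : H² → L(H³, H¹)` and `f : H² → H¹` are known to be Lipschitz near `γ₀`, the
right-hand side is a contraction in `g ∈ L²(0,T;H¹)`: terms without top-order derivatives gain `√T`,
and top-order terms gain the small distance to `γ₀` or the small `L²(0,T;H³)` norm of a solution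
(`normUpTo_rhs_sub_le`, `exists_isSol`). A first-exit-time argument shows that every solution stays
near `γ₀`, so uniqueness needs no smallness assumption (`IsSol.eq_of_close`).

Lipschitz bounds. The coefficient is harmless because `H¹` of the circle is an algebra. The nonlocal
term needs one derivative in `x`, and the kernel is singular on the diagonal. Let `h` be the signed
arc from `x` to `y`, let `G` dominate `|∂ₓ²γ|`, and let `m` be the mean of `G` over that arc.
Normals are orthogonal to tangents, so `N(x)·Δγ` and `N(y)·Δγ` only see the Taylor remainder, of
size `h² m`. Hence the `x`-derivative of the kernel is bounded by `G(x) m + m²`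
(`CurvePair.lip_kern`). Hardy's inequality bounds `m` in `L²` of either variable by `‖G‖`, so
integration against `G(y)` gives a function in `L²` (`lintegral_sq_lintegral_singWeight_le`).
Differences of two curves are handled in the same computation, since `LipPair` and `H1Pair` carry a
size bound and a distance bound together. -/

theorem absolutelyContinuousOnInterval_of_dist_le {f : ℝ → Y} {g : ℝ → Z} {a b K : ℝ}
    (hg : AbsolutelyContinuousOnInterval g a b)
    (h : ∀ x ∈ uIcc a b, ∀ y ∈ uIcc a b, dist (f x) (f y) ≤ K * dist (g x) (g y)) :
    AbsolutelyContinuousOnInterval f a b := by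
  rw [absolutelyContinuousOnInterval_iff] at hg ⊢
  intro ε hε
  have hK : 0 < |K| + 1 := by positivity
  obtain ⟨δ, hδ, H⟩ := hg (ε / (|K| + 1)) (by positivity)
  refine ⟨δ, hδ, fun E hE hlen => ?_⟩
  have h1 := H E hE hlen
  rw [lt_div_iff₀ hK] at h1
  refine lt_of_le_of_lt ?_ h1
  rw [Finset.sum_mul]
  refine Finset.sum_le_sum fun i hi => ?_
  have hm := hE.1 i hi
  calc dist (f (E.2 i).1) (f (E.2 i).2) ≤ K * dist (g (E.2 i).1) (g (E.2 i).2) :=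
        h _ hm.1 _ hm.2
    _ ≤ dist (g (E.2 i).1) (g (E.2 i).2) * (|K| + 1) := by
        nlinarith [le_abs_self K, dist_nonneg (x := g (E.2 i).1) (y := g (E.2 i).2)]

variable [NormedSpace ℝ Y]

/-- Increments of the primitive are dominated by those of the real primitive of `‖f‖`, so the scalar
result carries over to vector values. -/
theorem absolutelyContinuousOnInterval_integral {f : ℝ → Y} {a b c : ℝ}
    (hf : ∀ x y, IntervalIntegrable f volume x y) :
    AbsolutelyContinuousOnInterval (fun x => ∫ s in c..x, f s) a b := by
  have h1 : AbsolutelyContinuousOnInterval (fun x => ∫ s in a..x, ‖f s‖) a b :=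
    ((hf a b).norm).absolutelyContinuousOnInterval_intervalIntegral (by simp)
  refine absolutelyContinuousOnInterval_of_dist_le (K := 1) h1 fun x _ y _ => ?_
  rw [dist_eq_norm, dist_eq_norm, one_mul, intervalIntegral.integral_interval_sub_left (hf _ _)
    (hf _ _), intervalIntegral.integral_interval_sub_left (hf _ _).norm (hf _ _).norm,
    Real.norm_eq_abs]
  exact intervalIntegral.norm_integral_le_abs_integral_norm

/-- Subtracting the primitive of `f'` leaves an absolutely continuous function with zero derivative
almost everywhere, which is constant. The energy identity and the product and chain rules for square
integrable derivatives rest on this. -/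
theorem integral_eq_sub_of_absolutelyContinuous [CompleteSpace Y] {f f' : ℝ → Y} {a b : ℝ}
    (hf : AbsolutelyContinuousOnInterval f a b)
    (hf' : ∀ x y, IntervalIntegrable f' volume x y)
    (hd : ∀ᵐ x, x ∈ uIcc a b → HasDerivAt f (f' x) x) :
    ∫ x in a..b, f' x = f b - f a := by
  have h1 := hf.sub (absolutelyContinuousOnInterval_integral (c := a) hf' (a := a) (b := b))
  obtain ⟨C, hC⟩ := h1.const_of_ae_hasDerivAt_zero (by
    filter_upwards [hd, (hf' a b).ae_hasDerivAt_integral] with x hx hx' hxm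
    have := (hx hxm).sub (hx' hxm a (by simp))
    rwa [sub_self] at this)
  have ha := hC a (by simp)
  have hb := hC b (by simp)
  simp only [Pi.sub_apply, intervalIntegral.integral_same, sub_zero] at ha hb
  rw [ha, ← hb]
  abel

end AbsolutelyContinuous

/-! ### Square integrable functions of time -/

section Time

variable {X Y : Type*} [NormedAddCommGroup X] [NormedSpace ℝ X]
  [NormedAddCommGroup Y] [NormedSpace ℝ Y]

/-- `L²(0, T; X)`. -/
abbrev TimeL2 (T : ℝ) (X : Type*) [NormedAddCommGroup X] : Type _ := Lp X 2 (timeMeasure T)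

variable {T : ℝ}

theorem TimeL2.integrable (v : TimeL2 T X) : Integrable v (timeMeasure T) :=
  (Lp.memLp v).integrable (by norm_num)

theorem setIntegral_timeMeasure (f : ℝ → X) {t : ℝ} (ht : t ∈ Icc 0 T) :
    ∫ s in Iic t, f s ∂timeMeasure T = ∫ s in 0..t, f s := by
  rw [intervalIntegral.integral_of_le ht.1, Measure.restrict_restrict measurableSet_Iic]
  refine setIntegral_congr_set ?_
  have h : (Iic t ∩ Ioo 0 T : Set ℝ) =ᵐ[volume] (Iic t ∩ Ioc 0 T : Set ℝ) :=
    (ae_eq_refl _).inter Ioo_ae_eq_Ioc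
  refine h.trans (Eq.eventuallyEq ?_)
  ext s
  exact ⟨fun h => ⟨h.2.1, h.1⟩, fun h => ⟨h.2, h.1, h.2.trans ht.2⟩⟩

/-- The primitive `∫₀ᵗ v` of a square integrable function of time. -/
def prim (v : TimeL2 T X) (t : ℝ) : X := ∫ s in Iic t, v s ∂timeMeasure T

theorem prim_zero_time (v : TimeL2 T X) (hT : 0 ≤ T) : prim v 0 = 0 := by
  rw [prim, setIntegral_timeMeasure _ ⟨le_rfl, hT⟩, intervalIntegral.integral_same]

theorem prim_add (v w : TimeL2 T X) (t : ℝ) : prim (v + w) t = prim v t + prim w t := by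
  rw [prim, prim, prim, ← integral_add v.integrable.integrableOn w.integrable.integrableOn]
  refine integral_congr_ae (ae_restrict_of_ae ?_)
  filter_upwards [Lp.coeFn_add v w] with s hs
  rw [hs, Pi.add_apply]

theorem prim_smul (r : ℝ) (v : TimeL2 T X) (t : ℝ) : prim (r • v) t = r • prim v t := by
  rw [prim, prim, ← integral_smul]
  refine integral_congr_ae (ae_restrict_of_ae ?_)
  filter_upwards [Lp.coeFn_smul r v] with s hs
  rw [hs, Pi.smul_apply]

theorem prim_compLp [CompleteSpace X] [CompleteSpace Y] (A : X →L[ℝ] Y) (v : TimeL2 T X) (t : ℝ) :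
    prim (A.compLp v) t = A (prim v t) := by
  rw [prim, prim, ← A.integral_comp_comm v.integrable.integrableOn]
  refine integral_congr_ae (ae_restrict_of_ae ?_)
  filter_upwards [A.coeFn_compLp v] with s hs
  rw [hs]

theorem integral_norm_sq_eq (v : TimeL2 T X) : ∫ s, ‖v s‖ ^ 2 ∂timeMeasure T = ‖v‖ ^ 2 := by
  have h := (Lp.memLp v).eLpNorm_eq_integral_rpow_norm (by norm_num) (by norm_num)
  have h2 : ‖v‖ = (∫ s, ‖v s‖ ^ 2 ∂timeMeasure T) ^ (2⁻¹ : ℝ) := by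
    rw [Lp.norm_def, h, ENNReal.toReal_ofReal (by positivity)]
    simp
  rw [h2, ← Real.rpow_natCast, ← Real.rpow_mul (by positivity)]
  norm_num

theorem TimeL2.integrable_norm_sq (v : TimeL2 T X) :
    Integrable (fun s => ‖v s‖ ^ 2) (timeMeasure T) :=
  (Lp.memLp v).integrable_norm_pow (by norm_num)

theorem integral_norm_le (hT : 0 ≤ T) (v : TimeL2 T X) :
    ∫ s, ‖v s‖ ∂timeMeasure T ≤ √T * ‖v‖ := by
  have h1 : ∫ s, (‖v s‖ * 1) ∂timeMeasure T ≤ _ :=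
    integral_mul_le_Lp_mul_Lq_of_nonneg (μ := timeMeasure T) (f := fun s => ‖v s‖)
      (g := fun _ => (1 : ℝ)) Real.HolderConjugate.two_two
      (ae_of_all _ fun _ => norm_nonneg _) (ae_of_all _ fun _ => zero_le_one)
      (by simpa using (Lp.memLp v).norm) (by simpa using memLp_const (1 : ℝ))
  simp only [mul_one, Real.one_rpow, integral_const, smul_eq_mul] at h1
  refine h1.trans (le_of_eq ?_)
  have h2 : (timeMeasure T).real univ = T := by simp [hT]
  have h3 : (∫ s, ‖v s‖ ^ (2 : ℝ) ∂timeMeasure T) = ‖v‖ ^ 2 := by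
    rw [← integral_norm_sq_eq]
    simp
  rw [h2, h3, ← Real.sqrt_eq_rpow, ← Real.sqrt_eq_rpow, Real.sqrt_sq (norm_nonneg _), mul_comm]

theorem norm_prim_le (hT : 0 ≤ T) (v : TimeL2 T X) (t : ℝ) : ‖prim v t‖ ≤ √T * ‖v‖ :=
  (norm_integral_le_integral_norm _).trans
    ((setIntegral_le_integral v.integrable.norm (ae_of_all _ fun _ => norm_nonneg _)).trans
      (integral_norm_le hT v))

/-- `v ↦ ∫₀ᵗ v` as a continuous linear map. -/
def primL (hT : 0 ≤ T) (X : Type*) [NormedAddCommGroup X] [NormedSpace ℝ X] (t : ℝ) :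
    TimeL2 T X →L[ℝ] X :=
  LinearMap.mkContinuous
    { toFun := fun v => prim v t
      map_add' := fun v w => prim_add v w t
      map_smul' := fun r v => prim_smul r v t } (√T) (fun v => norm_prim_le hT v t)

@[simp] theorem primL_apply (hT : 0 ≤ T) (t : ℝ) (v : TimeL2 T X) : primL hT X t v = prim v t :=
  rfl

theorem continuous_prim (v : TimeL2 T X) : Continuous (prim v) := by
  refine continuous_iff_continuousAt.2 fun t => ?_
  have := IntegrableOn.continuousOn_Iic_primitive_Iic (μ := timeMeasure T) (f := v)
    (a₀ := t + 1) v.integrable.integrableOn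
  exact this.continuousAt (Iic_mem_nhds (by linarith))

theorem memLp_prim (v : TimeL2 T X) : MemLp (prim v) 2 (timeMeasure T) := by
  refine MemLp.of_bound (continuous_prim v).aestronglyMeasurable
    (∫ s, ‖v s‖ ∂timeMeasure T) (ae_of_all _ fun t => ?_)
  exact (norm_integral_le_integral_norm _).trans
    (setIntegral_le_integral v.integrable.norm (ae_of_all _ fun _ => norm_nonneg _))

theorem norm_toLp_le_of_bound (hT : 0 ≤ T) {f : ℝ → X} (hf : MemLp f 2 (timeMeasure T)) {C : ℝ}
    (hC : ∀ᵐ t ∂timeMeasure T, ‖f t‖ ≤ C) (hC0 : 0 ≤ C) : ‖hf.toLp f‖ ≤ √T * C := by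
  have h1 : eLpNorm f 2 (timeMeasure T) ≤ ENNReal.ofReal (√T * C) := by
    refine (eLpNorm_le_of_ae_bound hC).trans (le_of_eq ?_)
    rw [ENNReal.ofReal_mul (by positivity), Real.sqrt_eq_rpow,
      ← ENNReal.ofReal_rpow_of_nonneg hT (by norm_num)]
    simp
  rw [Lp.norm_toLp]
  exact ENNReal.toReal_le_of_le_ofReal (by positivity) h1

/-- The Volterra operator `v ↦ ∫₀ᵗ v` on `L²(0, T; X)`. -/
def volterra (hT : 0 ≤ T) (X : Type*) [NormedAddCommGroup X] [NormedSpace ℝ X] :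
    TimeL2 T X →L[ℝ] TimeL2 T X :=
  LinearMap.mkContinuous
    { toFun := fun v => (memLp_prim v).toLp
      map_add' := by
        intro v w
        rw [← MemLp.toLp_add]
        exact MemLp.toLp_congr _ _ (ae_of_all _ fun t => prim_add v w t)
      map_smul' := by
        intro r v
        rw [RingHom.id_apply, ← MemLp.toLp_const_smul]
        exact MemLp.toLp_congr _ _ (ae_of_all _ fun t => prim_smul r v t) }
    (√T * √T) (fun v => by
      rw [mul_assoc]
      exact norm_toLp_le_of_bound hT (memLp_prim v) (ae_of_all _ fun t => norm_prim_le hT v t) (by positivity))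

theorem coeFn_volterra (hT : 0 ≤ T) (v : TimeL2 T X) :
    volterra hT X v =ᵐ[timeMeasure T] prim v := (memLp_prim v).coeFn_toLp

/-- The norm of `L²(0, t; X)` on `L²(0, T; X)`. -/
def normUpTo (t : ℝ) (v : TimeL2 T X) : ℝ :=
  ‖LpToLpRestrictCLM ℝ X ℝ (timeMeasure T) 2 (Iic t) v‖

theorem normUpTo_nonneg (t : ℝ) (v : TimeL2 T X) : 0 ≤ normUpTo t v := norm_nonneg _

theorem continuous_normUpTo (t : ℝ) : Continuous (normUpTo t : TimeL2 T X → ℝ) :=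
  (ContinuousLinearMap.continuous _).norm

theorem normUpTo_le (t : ℝ) (v : TimeL2 T X) : normUpTo t v ≤ ‖v‖ :=
  norm_Lp_toLp_restrict_le _ _

theorem normUpTo_sq (t : ℝ) (v : TimeL2 T X) :
    normUpTo t v ^ 2 = ∫ s in Iic t, ‖v s‖ ^ 2 ∂timeMeasure T := by
  have hm : MemLp v 2 ((timeMeasure T).restrict (Iic t)) := (Lp.memLp v).restrict _
  have h := hm.eLpNorm_eq_integral_rpow_norm (by norm_num) (by norm_num)
  have h2 : normUpTo t v = (∫ s in Iic t, ‖v s‖ ^ 2 ∂timeMeasure T) ^ (2⁻¹ : ℝ) := by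
    have : normUpTo t v = ‖hm.toLp v‖ := rfl
    rw [this, Lp.norm_toLp, h, ENNReal.toReal_ofReal (by positivity)]
    simp
  rw [h2, ← Real.rpow_natCast, ← Real.rpow_mul (by positivity)]
  norm_num

theorem normUpTo_of_le {t : ℝ} (ht : T ≤ t) (v : TimeL2 T X) : normUpTo t v = ‖v‖ := by
  have h : (timeMeasure T).restrict (Iic t) = timeMeasure T := by
    rw [Measure.restrict_restrict measurableSet_Iic, inter_eq_right.2]
    exact fun s hs => hs.2.le.trans ht
  have := normUpTo_sq t v
  rw [h, integral_norm_sq_eq] at this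
  exact (pow_left_inj₀ (normUpTo_nonneg _ _) (norm_nonneg _) two_ne_zero).1 this

/-- The energy identity `½ d/dt q(z, z) = q(z', z)`. -/
theorem two_mul_integral_bilin [CompleteSpace X] (q : X →L[ℝ] X →L[ℝ] ℝ)
    (hq : ∀ x y, q x y = q y x) (v : TimeL2 T X) (z : X) {t : ℝ} (ht : t ∈ Icc 0 T) :
    2 * ∫ s in Iic t, q (v s) (z + prim v s) ∂timeMeasure T =
      q (z + prim v t) (z + prim v t) - q z z := by
  -- Extension by zero makes `v` integrable on the whole line, and `prim v` becomes an ordinary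
  -- interval integral on `[0, T]`.
  set w : ℝ → X := (Ioo 0 T).indicator v with hw
  have hwi : Integrable w volume := (integrable_indicator_iff measurableSet_Ioo).2 v.integrable
  have hwii : ∀ x y, IntervalIntegrable w volume x y := fun x y => hwi.intervalIntegrable
  have hprim : ∀ s ∈ Icc 0 T, prim v s = ∫ r in 0..s, w r := by
    intro s hs
    rw [← setIntegral_timeMeasure w hs]
    refine integral_congr_ae (ae_restrict_of_ae ?_)
    filter_upwards [ae_restrict_mem measurableSet_Ioo] with r hr
    rw [hw, indicator_of_mem hr]
  set ζ : ℝ → X := fun s => z + ∫ r in 0..s, w r with hζ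
  have hζac : AbsolutelyContinuousOnInterval ζ 0 t := by
    refine absolutelyContinuousOnInterval_of_dist_le (K := 1)
      (absolutelyContinuousOnInterval_integral (c := 0) (a := 0) (b := t) hwii) fun x _ y _ => ?_
    simp [hζ]
  have hζc : Continuous ζ := continuous_const.add (intervalIntegral.continuous_primitive hwii 0)
  obtain ⟨M, hM⟩ := hζac.exists_bound
  -- A bounded bilinear form is Lipschitz along the bounded curve `ζ`, so absolute continuity is
  -- inherited.
  have hac : AbsolutelyContinuousOnInterval (fun s => q (ζ s) (ζ s)) 0 t := by
    refine absolutelyContinuousOnInterval_of_dist_le (K := 2 * ‖q‖ * M) hζac fun x hx y hy => ?_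
    have e : q (ζ x) (ζ x) - q (ζ y) (ζ y) = q (ζ x - ζ y) (ζ x) + q (ζ y) (ζ x - ζ y) := by
      simp only [map_sub, sub_apply]
      ring
    rw [dist_eq_norm, dist_eq_norm, e]
    refine (norm_add_le _ _).trans ?_
    have h1 := q.le_opNorm₂ (ζ x - ζ y) (ζ x)
    have h2 := q.le_opNorm₂ (ζ y) (ζ x - ζ y)
    have h3 : ‖q‖ * ‖ζ x - ζ y‖ * ‖ζ x‖ ≤ ‖q‖ * ‖ζ x - ζ y‖ * M := by gcongr; exact hM x hx
    have h4 : ‖q‖ * ‖ζ y‖ * ‖ζ x - ζ y‖ ≤ ‖q‖ * M * ‖ζ x - ζ y‖ := by gcongr; exact hM y hy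
    linarith
  have hint : ∀ x y, IntervalIntegrable (fun s => 2 * q (w s) (ζ s)) volume x y := by
    intro x y
    refine IntervalIntegrable.const_mul ?_ 2
    rw [intervalIntegrable_iff]
    obtain ⟨C, hC⟩ := (isCompact_uIcc (a := x) (b := y)).exists_bound_of_continuousOn
      hζc.continuousOn
    refine Integrable.mono' ((hwi.norm.const_mul (‖q‖ * C)).integrableOn) ?_ ?_
    · exact (q.aestronglyMeasurable_comp₂ hwi.aestronglyMeasurable
        hζc.aestronglyMeasurable).restrict
    · filter_upwards [ae_restrict_mem measurableSet_uIoc] with s hs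
      calc ‖q (w s) (ζ s)‖ ≤ ‖q‖ * ‖w s‖ * ‖ζ s‖ := q.le_opNorm₂ _ _
        _ ≤ ‖q‖ * ‖w s‖ * C := by gcongr; exact hC s (uIoc_subset_uIcc hs)
        _ = ‖q‖ * C * ‖w s‖ := by ring
  have key := integral_eq_sub_of_absolutelyContinuous hac hint (by
    filter_upwards [(hwii 0 t).ae_hasDerivAt_integral] with s hs hsm
    have h1 : HasDerivAt ζ (w s) s := (hs hsm 0 (by simp)).const_add z
    have h2 := q.hasFDerivAt_of_bilinear h1.hasFDerivAt h1.hasFDerivAt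
    have h3 := h2.hasDerivAt
    convert h3 using 1
    simp [hq (ζ s) (w s), two_mul])
  rw [intervalIntegral.integral_const_mul] at key
  have e1 : ∫ s in Iic t, q (v s) (z + prim v s) ∂timeMeasure T = ∫ s in 0..t, q (w s) (ζ s) := by
    rw [← setIntegral_timeMeasure _ ht]
    refine integral_congr_ae (ae_restrict_of_ae ?_)
    filter_upwards [ae_restrict_mem measurableSet_Ioo] with r hr
    rw [hw, indicator_of_mem hr, hprim r (Ioo_subset_Icc_self hr)]
  rw [e1, key, hprim t ht]
  simp [hζ]

end Time

/-! ### Maximal regularity for self-adjoint operators -/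

/-- By Lax–Milgram every vector orthogonal to the range is the Riesz image of some `w'`, and
orthogonality then says that `q` annihilates `w'` against the range. Density is thus reduced to
injectivity-type statements. -/
theorem denseRange_of_coercive {V W : Type*} [NormedAddCommGroup V] [NormedSpace ℝ V]
    [NormedAddCommGroup W] [InnerProductSpace ℝ W] [CompleteSpace W] (q : W →L[ℝ] W →L[ℝ] ℝ)
    (hq : ∀ x y, q x y = q y x) (hc : IsCoercive q) (A : V →L[ℝ] W)
    (h : ∀ w, (∀ x, q (A x) w = 0) → w = 0) : DenseRange A := by
  have hK : A.range.topologicalClosure = ⊤ := by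
    rw [Submodule.topologicalClosure_eq_top_iff, Submodule.eq_bot_iff]
    intro w hw
    obtain ⟨w', rfl⟩ := hc.continuousLinearEquivOfBilin.surjective w
    rw [h w' fun x => ?_, map_zero]
    rw [hq, ← hc.continuousLinearEquivOfBilin_apply w' (A x), real_inner_comm]
    exact (Submodule.mem_orthogonal _ _).1 hw _ ⟨x, rfl⟩
  have := Submodule.dense_iff_topologicalClosure_eq_top.2 hK
  exact this

theorem exists_timeForm {X : Type*} [NormedAddCommGroup X] [InnerProductSpace ℝ X]
    [CompleteSpace X] (b : X →L[ℝ] X →L[ℝ] ℝ) (T : ℝ) :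
    ∃ q : TimeL2 T X →L[ℝ] TimeL2 T X →L[ℝ] ℝ,
      ∀ u v, q u v = ∫ t, b (u t) (v t) ∂timeMeasure T := by
  refine ⟨(innerSL ℝ).comp
    ((InnerProductSpace.continuousLinearMapOfBilin b).compLpL 2 (timeMeasure T)), fun u v => ?_⟩
  rw [ContinuousLinearMap.comp_apply, innerSL_apply_apply, L2.inner_def]
  refine integral_congr_ae ?_
  filter_upwards [ContinuousLinearMap.coeFn_compLpL (μ := timeMeasure T) (p := 2)
    (InnerProductSpace.continuousLinearMapOfBilin b) u] with t ht
  rw [ht, InnerProductSpace.continuousLinearMapOfBilin_apply]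

theorem integrable_bilin {X Y : Type*} [NormedAddCommGroup X] [NormedSpace ℝ X]
    [NormedAddCommGroup Y] [NormedSpace ℝ Y]
    (b : X →L[ℝ] Y →L[ℝ] ℝ) {α : Type*} [MeasurableSpace α] {μ : Measure α} {u : α → X}
    {v : α → Y} (hu : MemLp u 2 μ) (hv : MemLp v 2 μ) : Integrable (fun t => b (u t) (v t)) μ := by
  refine Integrable.mono' ((hu.norm.integrable_mul hv.norm).const_mul ‖b‖)
    (b.aestronglyMeasurable_comp₂ hu.1 hv.1) (ae_of_all _ fun t => ?_)
  calc ‖b (u t) (v t)‖ ≤ ‖b‖ * ‖u t‖ * ‖v t‖ := b.le_opNorm₂ _ _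
    _ = _ := by simp [mul_assoc]

/-- The data of a self-adjoint parabolic problem `∂ₜu + B u = g` in a scale `X₃ ⊂ X₂ ⊂ X₁` of
Hilbert spaces: `B : X₃ → X₁` is symmetric for the inner product `b` of `X₁`, and its form extends
to the inner product `Q` of `X₂`. -/
structure ParabolicData (X₁ X₂ X₃ : Type*) [NormedAddCommGroup X₁] [InnerProductSpace ℝ X₁]
    [NormedAddCommGroup X₂] [InnerProductSpace ℝ X₂] [NormedAddCommGroup X₃]
    [NormedSpace ℝ X₃] where
  b : X₁ →L[ℝ] X₁ →L[ℝ] ℝ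
  b_symm : ∀ x y, b x y = b y x
  Q : X₂ →L[ℝ] X₂ →L[ℝ] ℝ
  Q_symm : ∀ x y, Q x y = Q y x
  β : ℝ
  β_pos : 0 < β
  b_coercive : ∀ x, β * ‖x‖ ^ 2 ≤ b x x
  Q_coercive : ∀ y, β * ‖y‖ ^ 2 ≤ Q y y
  ι₂ : X₂ →L[ℝ] X₁
  ι₂_injective : Function.Injective ι₂
  ι₃ : X₃ →L[ℝ] X₂
  ι₃_injective : Function.Injective ι₃
  B : X₃ ≃L[ℝ] X₁
  Q_eq : ∀ ξ y, Q (ι₃ ξ) y = b (B ξ) (ι₂ y)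

namespace ParabolicData

variable {X₁ X₂ X₃ : Type*} [NormedAddCommGroup X₁] [InnerProductSpace ℝ X₁] [CompleteSpace X₁]
  [NormedAddCommGroup X₂] [InnerProductSpace ℝ X₂] [CompleteSpace X₂]
  [NormedAddCommGroup X₃] [NormedSpace ℝ X₃] [CompleteSpace X₃] (D : ParabolicData X₁ X₂ X₃)
  {T : ℝ}

/-- `B⁻¹` as an operator from `X₁` to `X₂`. -/
def r : X₁ →L[ℝ] X₂ := D.ι₃.comp (D.B.symm : X₁ →L[ℝ] X₃)

/-- `B⁻¹` as an operator in `X₁`. -/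
def R : X₁ →L[ℝ] X₁ := D.ι₂.comp D.r

theorem r_injective : Function.Injective D.r :=
  D.ι₃_injective.comp D.B.symm.injective

/-- The map `r` is the adjoint of `ι₂` for the pair `b`, `Q`. Symmetry and strict positivity of `R =
B⁻¹` follow, because `b x (R x) = Q (r x) (r x)`. -/
theorem Q_r (x : X₁) (y : X₂) : D.Q (D.r x) y = D.b x (D.ι₂ y) := by
  simp [r, D.Q_eq]

theorem b_R (x y : X₁) : D.b x (D.R y) = D.Q (D.r x) (D.r y) := by
  rw [Q_r]; rfl

theorem b_R_symm (x y : X₁) : D.b x (D.R y) = D.b y (D.R x) := by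
  rw [b_R, b_R, Q_symm]

theorem b_isCoercive : IsCoercive D.b :=
  ⟨D.β, D.β_pos, fun x => by have := D.b_coercive x; rwa [pow_two, ← mul_assoc] at this⟩

theorem Q_isCoercive : IsCoercive D.Q :=
  ⟨D.β, D.β_pos, fun x => by have := D.Q_coercive x; rwa [pow_two, ← mul_assoc] at this⟩

/-- If `y` is `Q`-orthogonal to the range, then `b x (ι₂ y) = 0` for all `x`, and `x = ι₂ y` forces
`y = 0`. Besides its role in the linear theory, this lets `γ₀ ∈ X₂` be approximated by elements of
`X₃`. -/
theorem denseRange_r : DenseRange D.r := by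
  refine denseRange_of_coercive D.Q D.Q_symm D.Q_isCoercive _ fun y hy => ?_
  simp only [Q_r] at hy
  have h1 := D.b_coercive (D.ι₂ y)
  rw [hy] at h1
  have h2 : ‖D.ι₂ y‖ ^ 2 = 0 :=
    le_antisymm (by have := D.β_pos; by_contra hh; push Not at hh; nlinarith) (by positivity)
  have h3 : D.ι₂ y = D.ι₂ 0 := by simpa using h2
  exact D.ι₂_injective h3

theorem denseRange_R : DenseRange D.R := by
  refine denseRange_of_coercive D.b D.b_symm D.b_isCoercive _ fun y hy => ?_
  have h1 := hy y
  rw [D.b_symm, b_R] at h1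
  have h2 := D.Q_coercive (D.r y)
  rw [h1] at h2
  have h2 : ‖D.r y‖ ^ 2 = 0 :=
    le_antisymm (by have := D.β_pos; by_contra hh; push Not at hh; nlinarith) (by positivity)
  have h3 : D.r y = D.r 0 := by simpa using h2
  exact D.r_injective h3

/-- The integral is `½ b (prim w T) (prim w T)` by the energy identity: integration in time is a
monotone operator. -/
theorem integral_prim_nonneg (hT : 0 ≤ T) (w : TimeL2 T X₁) :
    0 ≤ ∫ t, D.b (w t) (prim w t) ∂timeMeasure T := by
  have h := two_mul_integral_bilin D.b D.b_symm w 0 (t := T) ⟨hT, le_rfl⟩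
  have e : (timeMeasure T).restrict (Iic T) = timeMeasure T := by
    rw [Measure.restrict_restrict measurableSet_Iic, inter_eq_right.2]
    exact fun s hs => hs.2.le
  simp only [zero_add, map_zero, sub_zero, e] at h
  have h2 := D.b_coercive (prim w T)
  have h3 : 0 ≤ D.β * ‖prim w T‖ ^ 2 := by have := D.β_pos; positivity
  linarith

/-- The operator `R` is strictly positive and time integration is nonnegative, so their sum has no
null vector. Both uniqueness for the linear problem and density of the range of `R + J` come from
this. -/
theorem eq_zero_of_form_eq_zero (hT : 0 ≤ T) (w : TimeL2 T X₁)
    (h : ∫ t, D.b (w t) (D.R (w t) + prim w t) ∂timeMeasure T = 0) : w = 0 := by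
  have hR : MemLp (fun t => D.R (w t)) 2 (timeMeasure T) :=
    D.R.comp_memLp' (Lp.memLp w)
  simp only [map_add] at h
  rw [integral_add (integrable_bilin D.b (Lp.memLp w) hR)
    (integrable_bilin D.b (Lp.memLp w) (memLp_prim w))] at h
  have h1 := D.integral_prim_nonneg hT w
  have hpos : ∀ t, 0 ≤ D.b (w t) (D.R (w t)) := fun t => by
    rw [b_R]
    refine le_trans ?_ (D.Q_coercive _)
    have := D.β_pos
    positivity
  have h2 : 0 ≤ ∫ t, D.b (w t) (D.R (w t)) ∂timeMeasure T := integral_nonneg hpos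
  have h3 : ∫ t, D.b (w t) (D.R (w t)) ∂timeMeasure T = 0 := by linarith
  rw [integral_eq_zero_iff_of_nonneg hpos (integrable_bilin D.b (Lp.memLp w) hR)] at h3
  refine (Lp.eq_zero_iff_ae_eq_zero).2 ?_
  filter_upwards [h3] with t ht
  simp only [Pi.zero_apply, b_R] at ht
  have h2 := D.Q_coercive (D.r (w t))
  rw [ht] at h2
  have h2 : ‖D.r (w t)‖ ^ 2 = 0 :=
    le_antisymm (by have := D.β_pos; by_contra hh; push Not at hh; nlinarith) (by positivity)
  have h3 : D.r (w t) = D.r 0 := by simpa using h2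
  exact D.r_injective h3

/-- The operator `R + J`, `J` the Volterra operator. -/
def resolventVolterra (hT : 0 ≤ T) : TimeL2 T X₁ →L[ℝ] TimeL2 T X₁ :=
  D.R.compLpL 2 (timeMeasure T) + volterra hT X₁

theorem coeFn_resolventVolterra (hT : 0 ≤ T) (w : TimeL2 T X₁) :
    D.resolventVolterra hT w =ᵐ[timeMeasure T] fun t => D.R (w t) + prim w t := by
  have : D.resolventVolterra hT w = D.R.compLp w + volterra hT X₁ w := rfl
  rw [this]
  filter_upwards [Lp.coeFn_add (D.R.compLp w) (volterra hT X₁ w), D.R.coeFn_compLp w,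
    coeFn_volterra hT w] with t h1 h2 h3
  rw [h1, Pi.add_apply, h2, h3]

theorem denseRange_resolventVolterra (hT : 0 ≤ T) :
    DenseRange (D.resolventVolterra (T := T) hT) := by
  obtain ⟨q, hq⟩ := exists_timeForm D.b T
  have hs : ∀ u v, q u v = q v u := fun u v => by
    rw [hq, hq]; exact integral_congr_ae (ae_of_all _ fun t => D.b_symm _ _)
  refine denseRange_of_coercive q hs ⟨D.β, D.β_pos, fun u => ?_⟩ _ fun w hw => ?_
  · rw [hq, mul_assoc, ← pow_two, ← integral_norm_sq_eq, ← integral_const_mul]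
    exact integral_mono (u.integrable_norm_sq.const_mul _)
      (integrable_bilin D.b (Lp.memLp u) (Lp.memLp u)) fun t => D.b_coercive _
  · refine D.eq_zero_of_form_eq_zero hT w ?_
    rw [← hw w, hs, hq]
    refine integral_congr_ae ?_
    filter_upwards [D.coeFn_resolventVolterra hT w] with t ht
    rw [ht]

/-- `(w, y) ↦ (g, u₀)`: the data of the smooth solution with `∂ₜu = R w`, `u₀ = R² y`. -/
def smoothData (hT : 0 ≤ T) : TimeL2 T X₁ × X₁ →L[ℝ] TimeL2 T X₁ × X₂ :=
  ((D.resolventVolterra hT).comp (.fst ℝ _ _) +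
    ((Lp.constL 2 (timeMeasure T) ℝ).comp D.R).comp (.snd ℝ _ _)).prod
    ((D.r.comp D.R).comp (.snd ℝ _ _))

theorem coeFn_smoothData (hT : 0 ≤ T) (x : TimeL2 T X₁ × X₁) :
    (D.smoothData hT x).1 =ᵐ[timeMeasure T] fun t => D.R (x.1 t) + (D.R x.2 + prim x.1 t) := by
  have : (D.smoothData hT x).1 =
    D.resolventVolterra hT x.1 + Lp.const 2 (timeMeasure T) (D.R x.2) := rfl
  rw [this]
  filter_upwards [Lp.coeFn_add (D.resolventVolterra hT x.1)
    (Lp.const 2 (timeMeasure T) (D.R x.2)), D.coeFn_resolventVolterra hT x.1,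
    Lp.coeFn_const 2 (timeMeasure T) (D.R x.2)] with t h1 h2 h3
  rw [h1, Pi.add_apply, h2, h3, Function.const_apply]
  abel

/-- `(w, y) ↦ ∂ₜu`. -/
def smoothDt (T : ℝ) : TimeL2 T X₁ × X₁ →L[ℝ] TimeL2 T X₁ :=
  (D.R.compLpL 2 (timeMeasure T)).comp (.fst ℝ _ _)

/-- `(w, y) ↦ u(t)`. -/
def smoothVal (hT : 0 ≤ T) (t : ℝ) : TimeL2 T X₁ × X₁ →L[ℝ] X₂ :=
  D.r.comp (D.R.comp (.snd ℝ _ _) + (primL hT X₁ t).comp (.fst ℝ _ _))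

theorem smoothVal_apply (hT : 0 ≤ T) (t : ℝ) (x : TimeL2 T X₁ × X₁) :
    D.smoothVal hT t x = D.r (D.R x.2 + prim x.1 t) := rfl

/-- The vector `y` is chosen first to match the initial value; `w` then corrects the forcing, to
which `y` contributes only the constant `R y`. -/
theorem denseRange_smoothData (hT : 0 ≤ T) : DenseRange (D.smoothData (T := T) hT) := by
  rw [Metric.denseRange_iff]
  rintro ⟨g, u⟩ ε hε
  obtain ⟨y, hy⟩ := Metric.denseRange_iff.1
    (D.denseRange_r.comp D.denseRange_R D.r.continuous) u ε hε
  obtain ⟨w, hw⟩ := Metric.denseRange_iff.1 (D.denseRange_resolventVolterra hT)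
    (g - Lp.constL 2 (timeMeasure T) ℝ (D.R y)) ε hε
  refine ⟨(w, y), ?_⟩
  rw [Prod.dist_eq, max_lt_iff]
  refine ⟨?_, hy⟩
  have e : (D.smoothData hT (w, y)).1 =
    D.resolventVolterra hT w + Lp.constL 2 (timeMeasure T) ℝ (D.R y) := rfl
  rw [e, dist_eq_norm]
  rwa [dist_eq_norm, sub_sub, add_comm] at hw

theorem sq_add_sq_le_of_form (c : ℝ) (t : ℝ) (v g : TimeL2 T X₁) (x y : X₂)
    (h : ∫ s in Iic t, D.b (v s) (v s) ∂timeMeasure T +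
      ∫ s in Iic t, D.b ((g - v) s) ((g - v) s) ∂timeMeasure T + D.Q x x ≤
      D.Q y y + ∫ s in Iic t, D.b (g s) (g s) ∂timeMeasure T)
    (hc : (‖D.Q‖ + ‖D.b‖) / D.β = c) :
    normUpTo t v ^ 2 + normUpTo t (g - v) ^ 2 + ‖x‖ ^ 2 ≤
      c * (‖y‖ ^ 2 + normUpTo t g ^ 2) := by
  have hβ := D.β_pos
  have lower : ∀ u : TimeL2 T X₁, D.β * normUpTo t u ^ 2 ≤
      ∫ s in Iic t, D.b (u s) (u s) ∂timeMeasure T := fun u => by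
    rw [normUpTo_sq, ← integral_const_mul]
    exact integral_mono (u.integrable_norm_sq.const_mul _).integrableOn
      (integrable_bilin D.b (Lp.memLp u) (Lp.memLp u)).integrableOn fun t => D.b_coercive _
  have upper : ∫ s in Iic t, D.b (g s) (g s) ∂timeMeasure T ≤ ‖D.b‖ * normUpTo t g ^ 2 := by
    rw [normUpTo_sq, ← integral_const_mul]
    refine integral_mono (integrable_bilin D.b (Lp.memLp g) (Lp.memLp g)).integrableOn
      (g.integrable_norm_sq.const_mul _).integrableOn fun t => ?_
    refine (le_abs_self _).trans ((D.b.le_opNorm₂ _ _).trans (le_of_eq (by ring)))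
  have h1 : D.Q y y ≤ ‖D.Q‖ * ‖y‖ ^ 2 :=
    (le_abs_self _).trans ((D.Q.le_opNorm₂ _ _).trans (le_of_eq (by ring)))
  have h2 := D.Q_coercive x
  have h3 := lower v
  have h4 := lower (g - v)
  rw [← hc, div_mul_eq_mul_div, le_div_iff₀ hβ]
  have h5 : 0 ≤ ‖D.Q‖ * normUpTo t g ^ 2 := by positivity
  have h6 : 0 ≤ ‖D.b‖ * ‖y‖ ^ 2 := by positivity
  nlinarith

/-- Put `z = R y + prim w`. Then `u = r z`, the element `z` plays the role of `B u`, and `g = R w +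
z`. Expanding `b g g` leaves the cross term `2 b (R w) z = 2 b w (R z)`, which is the time
derivative of `b z (R z) = Q u u`. -/
theorem smooth_energy (hT : 0 ≤ T) (x : TimeL2 T X₁ × X₁) {t : ℝ} (ht : t ∈ Icc 0 T) :
    ∫ s in Iic t, D.b (D.smoothDt T x s) (D.smoothDt T x s) ∂timeMeasure T +
      ∫ s in Iic t, D.b (((D.smoothData hT x).1 - D.smoothDt T x) s)
        (((D.smoothData hT x).1 - D.smoothDt T x) s) ∂timeMeasure T +
      D.Q (D.smoothVal hT t x) (D.smoothVal hT t x) ≤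
      D.Q (D.smoothData hT x).2 (D.smoothData hT x).2 +
        ∫ s in Iic t, D.b ((D.smoothData hT x).1 s) ((D.smoothData hT x).1 s) ∂timeMeasure T := by
  obtain ⟨q, hqa⟩ : ∃ q : X₁ →L[ℝ] X₁ →L[ℝ] ℝ, ∀ x y, q x y = D.b x (D.R y) :=
    ⟨(D.b.flip.comp D.R).flip, fun _ _ => rfl⟩
  have h := two_mul_integral_bilin q (fun x y => by rw [hqa, hqa, b_R_symm]) x.1 (D.R x.2) ht
  simp only [hqa] at h
  have e1 : D.Q (D.smoothVal hT t x) (D.smoothVal hT t x) =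
      D.b (D.R x.2 + prim x.1 t) (D.R (D.R x.2 + prim x.1 t)) := by
    rw [b_R]; rfl
  have e2 : D.Q (D.smoothData hT x).2 (D.smoothData hT x).2 = D.b (D.R x.2) (D.R (D.R x.2)) := by
    rw [b_R]; rfl
  rw [e1, e2]
  set z : ℝ → X₁ := fun s => D.R x.2 + prim x.1 s
  have hz : MemLp z 2 (timeMeasure T) := (memLp_const (D.R x.2)).add (memLp_prim x.1)
  have hz' : MemLp z 2 ((timeMeasure T).restrict (Iic t)) := hz.restrict _
  have hw' : MemLp (fun s => x.1 s) 2 ((timeMeasure T).restrict (Iic t)) :=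
    (Lp.memLp x.1).restrict _
  have hv' : MemLp (fun s => D.R (x.1 s)) 2 ((timeMeasure T).restrict (Iic t)) :=
    (D.R.comp_memLp' (Lp.memLp x.1)).restrict _
  have ev : (D.smoothDt T x : ℝ → X₁) =ᵐ[(timeMeasure T).restrict (Iic t)]
      fun s => D.R (x.1 s) := ae_restrict_of_ae (D.R.coeFn_compLp x.1)
  have eg : ((D.smoothData hT x).1 : ℝ → X₁) =ᵐ[(timeMeasure T).restrict (Iic t)]
      fun s => D.R (x.1 s) + z s := ae_restrict_of_ae (D.coeFn_smoothData hT x)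
  have egv : (((D.smoothData hT x).1 - D.smoothDt T x : TimeL2 T X₁) : ℝ → X₁)
      =ᵐ[(timeMeasure T).restrict (Iic t)] z := by
    filter_upwards [ev, eg, ae_restrict_of_ae
      (Lp.coeFn_sub (D.smoothData hT x).1 (D.smoothDt T x))] with s h1 h2 h3
    rw [h3, Pi.sub_apply, h1, h2]
    abel
  have i1 : ∫ s in Iic t, D.b (D.smoothDt T x s) (D.smoothDt T x s) ∂timeMeasure T =
      ∫ s in Iic t, D.b (D.R (x.1 s)) (D.R (x.1 s)) ∂timeMeasure T :=
    integral_congr_ae (by filter_upwards [ev] with s hs; rw [hs])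
  have i2 : ∫ s in Iic t, D.b (((D.smoothData hT x).1 - D.smoothDt T x) s)
        (((D.smoothData hT x).1 - D.smoothDt T x) s) ∂timeMeasure T =
      ∫ s in Iic t, D.b (z s) (z s) ∂timeMeasure T :=
    integral_congr_ae (by filter_upwards [egv] with s hs; rw [hs])
  have i3 : ∫ s in Iic t, D.b ((D.smoothData hT x).1 s) ((D.smoothData hT x).1 s)
      ∂timeMeasure T = ∫ s in Iic t, D.b (D.R (x.1 s)) (D.R (x.1 s)) ∂timeMeasure T +
        ∫ s in Iic t, D.b (z s) (z s) ∂timeMeasure T +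
        2 * ∫ s in Iic t, D.b (x.1 s) (D.R (z s)) ∂timeMeasure T := by
    have j1 := integrable_bilin D.b hv' hv'
    have j2 := integrable_bilin D.b hz' hz'
    have j3 : Integrable (fun s => 2 * D.b (x.1 s) (D.R (z s))) ((timeMeasure T).restrict (Iic t)) :=
      (integrable_bilin D.b hw' (D.R.comp_memLp' hz')).const_mul 2
    have j4 : Integrable (fun s => D.b (D.R (x.1 s)) (D.R (x.1 s)) + D.b (z s) (z s))
      ((timeMeasure T).restrict (Iic t)) := j1.add j2
    rw [← integral_const_mul, ← integral_add j1 j2, ← integral_add j4 j3]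
    refine integral_congr_ae ?_
    filter_upwards [eg] with s hs
    rw [hs, D.b_R_symm (x.1 s) (z s), D.b_symm (z s) (D.R (x.1 s))]
    simp only [map_add, add_apply]
    rw [D.b_symm (z s) (D.R (x.1 s))]
    ring
  rw [i1, i2, i3, h]
  linarith

/-- `u` solves `∂ₜu + B u = g`: here `v = ∂ₜu` and `c` is the representative of `u` in
`C([0, T]; X₂)`. -/
structure Solves (g v : TimeL2 T X₁) (c : ℝ → X₂) : Prop where
  cont : ContinuousOn c (Icc 0 T)
  eq_prim : ∀ t ∈ Icc 0 T, D.ι₂ (c t) = D.ι₂ (c 0) + prim v t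
  eq_resolvent : ∀ᵐ t ∂timeMeasure T, D.ι₂ (c t) = D.R (g t - v t)

/-- The constant of maximal regularity. -/
def regConst : ℝ := (‖D.Q‖ + ‖D.b‖) / D.β

theorem regConst_nonneg : 0 ≤ D.regConst := by
  have := D.β_pos
  unfold regConst
  positivity

/-- The maps from data to `∂ₜu` and to `u(t)` are known on the dense set of smooth data and extend
by the energy bound to `Sv` and `Sc t`. Equation, initial value and estimate are closed conditions,
hence survive the extension. -/
theorem exists_solves_aux (hT : 0 ≤ T) (g : TimeL2 T X₁) (u₀ : X₂) :
    ∃ v c, D.Solves g v c ∧ c 0 = u₀ ∧ ∀ t ∈ Icc 0 T,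
      normUpTo t v ^ 2 + normUpTo t (g - v) ^ 2 + ‖c t‖ ^ 2 ≤
        D.regConst * (‖u₀‖ ^ 2 + normUpTo t g ^ 2) := by
  have hdense := D.denseRange_smoothData (T := T) hT
  have est : ∀ t ∈ Icc 0 T, ∀ x : TimeL2 T X₁ × X₁,
      normUpTo t (D.smoothDt T x) ^ 2 +
        normUpTo t ((D.smoothData hT x).1 - D.smoothDt T x) ^ 2 + ‖D.smoothVal hT t x‖ ^ 2 ≤
      D.regConst * (‖(D.smoothData hT x).2‖ ^ 2 + normUpTo t (D.smoothData hT x).1 ^ 2) :=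
    fun t ht x => D.sq_add_sq_le_of_form _ t _ _ _ _ (D.smooth_energy hT x ht) rfl
  -- The factor `2` compares the sum of squares in the estimate with the maximum norm on the
  -- product.
  set K := √(2 * D.regConst) with hK
  have hK2 : K ^ 2 = 2 * D.regConst :=
    Real.sq_sqrt (mul_nonneg zero_le_two D.regConst_nonneg)
  have bound : ∀ t ∈ Icc 0 T, ∀ x : TimeL2 T X₁ × X₁,
      D.regConst * (‖(D.smoothData hT x).2‖ ^ 2 + normUpTo t (D.smoothData hT x).1 ^ 2) ≤
        (K * ‖D.smoothData hT x‖) ^ 2 := by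
    intro t ht x
    have h1 : ‖(D.smoothData hT x).2‖ ^ 2 ≤ ‖D.smoothData hT x‖ ^ 2 :=
      pow_le_pow_left₀ (norm_nonneg _) (norm_snd_le _) 2
    have h2 : normUpTo t (D.smoothData hT x).1 ^ 2 ≤ ‖D.smoothData hT x‖ ^ 2 :=
      pow_le_pow_left₀ (normUpTo_nonneg _ _) ((normUpTo_le _ _).trans (norm_fst_le _)) 2
    rw [mul_pow, hK2]
    nlinarith [D.regConst_nonneg]
  have bdt : ∀ x, ‖D.smoothDt T x‖ ≤ K * ‖D.smoothData hT x‖ := by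
    intro x
    have h1 := (est T ⟨hT, le_rfl⟩ x).trans (bound T ⟨hT, le_rfl⟩ x)
    refine abs_le_of_sq_le_sq' ?_ (by positivity) |>.2
    rw [normUpTo_of_le le_rfl (D.smoothDt T x)] at h1
    nlinarith [sq_nonneg (normUpTo T ((D.smoothData hT x).1 - D.smoothDt T x)),
      sq_nonneg (‖D.smoothVal hT T x‖)]
  have bval : ∀ t ∈ Icc 0 T, ∀ x, ‖D.smoothVal hT t x‖ ≤ K * ‖D.smoothData hT x‖ := by
    intro t ht x
    have h1 := (est t ht x).trans (bound t ht x)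
    refine abs_le_of_sq_le_sq' ?_ (by positivity) |>.2
    nlinarith [sq_nonneg (normUpTo t ((D.smoothData hT x).1 - D.smoothDt T x)),
      sq_nonneg (normUpTo t (D.smoothDt T x))]
  set Sv := (D.smoothDt T).toLinearMap.extendOfNorm (D.smoothData hT).toLinearMap with hSv
  set Sc := fun t => (D.smoothVal hT t).toLinearMap.extendOfNorm
    (D.smoothData hT).toLinearMap with hSc
  have hdense' : DenseRange (D.smoothData hT).toLinearMap := hdense
  have Sv_eq : ∀ x, Sv (D.smoothData hT x) = D.smoothDt T x := fun x =>
    LinearMap.extendOfNorm_eq hdense' ⟨K, bdt⟩ x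
  have Sc_eq : ∀ t ∈ Icc 0 T, ∀ x, Sc t (D.smoothData hT x) = D.smoothVal hT t x :=
    fun t ht x => LinearMap.extendOfNorm_eq hdense' ⟨K, bval t ht⟩ x
  have Sc_le : ∀ t ∈ Icc 0 T, ∀ d, ‖Sc t d‖ ≤ K * ‖d‖ := fun t ht d =>
    LinearMap.norm_extendOfNorm_apply_le hdense' K (bval t ht) d
  have h0 : ∀ d : TimeL2 T X₁ × X₂, Sc 0 d = d.2 := by
    intro d
    refine hdense.induction_on d (isClosed_eq (by fun_prop) (by fun_prop)) fun x => ?_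
    rw [Sc_eq 0 ⟨le_rfl, hT⟩, smoothVal_apply, prim_zero_time _ hT, add_zero]
    rfl
  have h1 : ∀ t ∈ Icc 0 T, ∀ d : TimeL2 T X₁ × X₂,
      D.ι₂ (Sc t d) = D.ι₂ d.2 + primL hT X₁ t (Sv d) := by
    intro t ht d
    refine hdense.induction_on d (isClosed_eq (by fun_prop) (by fun_prop)) fun x => ?_
    rw [Sc_eq t ht, Sv_eq, smoothVal_apply, map_add, map_add, primL_apply]
    congr 1
    exact (prim_compLp D.R x.1 t).symm
  have h2 : ∀ d : TimeL2 T X₁ × X₂, D.R.compLpL 2 (timeMeasure T) (d.1 - Sv d) =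
      Lp.constL 2 (timeMeasure T) ℝ (D.ι₂ d.2) + volterra hT X₁ (Sv d) := by
    intro d
    refine hdense.induction_on d (isClosed_eq (by fun_prop) (by fun_prop)) fun x => ?_
    rw [Sv_eq]
    refine Lp.ext ?_
    filter_upwards [ContinuousLinearMap.coeFn_compLpL (p := 2) (μ := timeMeasure T) D.R
        ((D.smoothData hT x).1 - D.smoothDt T x),
      Lp.coeFn_add (Lp.constL 2 (timeMeasure T) ℝ (D.ι₂ (D.smoothData hT x).2))
        (volterra hT X₁ (D.smoothDt T x)), coeFn_volterra hT (D.smoothDt T x),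
      Lp.coeFn_const 2 (timeMeasure T) (D.ι₂ (D.smoothData hT x).2),
      Lp.coeFn_sub (D.smoothData hT x).1 (D.smoothDt T x), D.coeFn_smoothData hT x,
      D.R.coeFn_compLp x.1] with t e1 e2 e3 e4 e5 e6 e7
    have e8 : D.smoothDt T x t = D.R (x.1 t) := e7
    rw [e1, e2, Pi.add_apply, e3, e5, Pi.sub_apply, e6, e8, add_sub_cancel_left, map_add]
    have e9 : Lp.constL 2 (timeMeasure T) ℝ (D.ι₂ (D.smoothData hT x).2) t =
      D.ι₂ (D.smoothData hT x).2 := e4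
    rw [e9]
    congr 1
    exact (prim_compLp D.R x.1 t).symm
  have h3 : ∀ t ∈ Icc 0 T, ∀ d : TimeL2 T X₁ × X₂,
      normUpTo t (Sv d) ^ 2 + normUpTo t (d.1 - Sv d) ^ 2 + ‖Sc t d‖ ^ 2 ≤
      D.regConst * (‖d.2‖ ^ 2 + normUpTo t d.1 ^ 2) := by
    intro t ht d
    have hc := continuous_normUpTo (X := X₁) (T := T) t
    refine hdense.induction_on d (isClosed_le ?_ ?_) fun x => ?_
    · exact (((hc.comp (by fun_prop)).pow 2).add ((hc.comp (by fun_prop)).pow 2)).add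
        (by fun_prop)
    · exact continuous_const.mul (Continuous.add (by fun_prop) ((hc.comp (by fun_prop)).pow 2))
    · simpa only [Sv_eq, Sc_eq t ht] using est t ht x
  -- The bound `Sc_le` is uniform in `t`, so the curve is a uniform limit of continuous curves.
  have h4 : ContinuousOn (fun t => Sc t (g, u₀)) (Icc 0 T) := by
    have hK1 : 0 < K + 1 := by positivity
    refine continuousOn_of_uniform_approx_of_continuousOn fun U hU => ?_
    obtain ⟨ε, hε, hεU⟩ := Metric.mem_uniformity_dist.1 hU
    obtain ⟨x, hx⟩ := Metric.denseRange_iff.1 hdense (g, u₀) (ε / (K + 1)) (by positivity)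
    refine ⟨fun t => D.smoothVal hT t x, ?_, fun t ht => hεU ?_⟩
    · simp only [smoothVal_apply]
      exact (D.r.continuous.comp (continuous_const.add (continuous_prim _))).continuousOn
    · change dist _ (D.smoothVal hT t x) < ε
      rw [← Sc_eq t ht, dist_eq_norm, ← map_sub]
      refine (Sc_le t ht _).trans_lt ?_
      rw [dist_eq_norm, lt_div_iff₀ hK1] at hx
      nlinarith [norm_nonneg ((g, u₀) - D.smoothData hT x), hx]
  refine ⟨Sv (g, u₀), fun t => Sc t (g, u₀), ⟨h4, fun t ht => ?_, ?_⟩, h0 _, fun t ht => h3 t ht _⟩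
  · simp only [h0, h1 t ht, primL_apply]
  · have h5 := h2 (g, u₀)
    filter_upwards [ContinuousLinearMap.coeFn_compLpL (p := 2) (μ := timeMeasure T) D.R
        (g - Sv (g, u₀)),
      Lp.coeFn_add (Lp.constL 2 (timeMeasure T) ℝ (D.ι₂ u₀))
        (volterra hT X₁ (Sv (g, u₀))), coeFn_volterra hT (Sv (g, u₀)),
      Lp.coeFn_const 2 (timeMeasure T) (D.ι₂ u₀), Lp.coeFn_sub g (Sv (g, u₀)),
      ae_restrict_mem measurableSet_Ioo] with t e1 e2 e3 e4 e5 e6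
    simp only at h5
    rw [h5, e2, Pi.add_apply, e3, e5, Pi.sub_apply] at e1
    have e9 : Lp.constL 2 (timeMeasure T) ℝ (D.ι₂ u₀) t = D.ι₂ u₀ := e4
    rw [e9] at e1
    rw [← e1, h1 t (Ioo_subset_Icc_self e6), primL_apply]

variable {D}

theorem Solves.sub {g v g' v' : TimeL2 T X₁} {c c' : ℝ → X₂} (h : D.Solves g v c)
    (h' : D.Solves g' v' c') : D.Solves (g - g') (v - v') (fun t => c t - c' t) := by
  refine ⟨h.cont.sub h'.cont, fun t ht => ?_, ?_⟩
  · have e : prim (v - v') t = prim v t - prim v' t := by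
      have hT : 0 ≤ T := ht.1.trans ht.2
      simpa using (primL hT X₁ t).map_sub v v'
    rw [map_sub, map_sub, h.eq_prim t ht, h'.eq_prim t ht, e]
    abel
  · filter_upwards [h.eq_resolvent, h'.eq_resolvent, Lp.coeFn_sub g g', Lp.coeFn_sub v v']
      with t h1 h2 h3 h4
    rw [map_sub, h1, h2, h3, h4, Pi.sub_apply, Pi.sub_apply, ← map_sub]
    congr 1
    abel

/-- For zero data the two expressions of `ι₂ (c t)` give `R v + prim v = 0`, and strict positivity
of this operator yields `v = 0`. -/
theorem Solves.eq_zero (hT : 0 ≤ T) {v : TimeL2 T X₁} {c : ℝ → X₂} (h : D.Solves 0 v c)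
    (h0 : c 0 = 0) : v = 0 ∧ ∀ t ∈ Icc 0 T, c t = 0 := by
  have hv : v = 0 := by
    refine D.eq_zero_of_form_eq_zero hT v ?_
    rw [← integral_zero ℝ ℝ (μ := timeMeasure T)]
    refine integral_congr_ae ?_
    filter_upwards [h.eq_resolvent, Lp.coeFn_zero X₁ 2 (timeMeasure T),
      ae_restrict_mem measurableSet_Ioo] with t h1 h2 h3
    rw [h.eq_prim t (Ioo_subset_Icc_self h3), h2, h0, map_zero, Pi.zero_apply, zero_sub, map_neg,
      zero_add] at h1
    rw [h1, add_neg_cancel, map_zero]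
  refine ⟨hv, fun t ht => D.ι₂_injective ?_⟩
  have : prim v t = 0 := by
    have := (primL hT X₁ t).map_zero
    rwa [primL_apply, ← hv] at this
  rw [h.eq_prim t ht, h0, this, map_zero, add_zero]

/-- By uniqueness every solution is the one constructed by density, for which the estimate is known.
-/
theorem Solves.estimate (hT : 0 ≤ T) {g v : TimeL2 T X₁} {c : ℝ → X₂} (h : D.Solves g v c)
    {t : ℝ} (ht : t ∈ Icc 0 T) :
    normUpTo t v ^ 2 + normUpTo t (g - v) ^ 2 + ‖c t‖ ^ 2 ≤
        D.regConst * (‖c 0‖ ^ 2 + normUpTo t g ^ 2) := by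
  obtain ⟨v', c', h', h0, hest⟩ := D.exists_solves_aux hT g (c 0)
  have hs := h.sub h'
  rw [sub_self] at hs
  obtain ⟨e1, e2⟩ := hs.eq_zero hT (by simp [h0])
  rw [sub_eq_zero.1 e1, sub_eq_zero.1 (e2 t ht)]
  exact hest t ht

theorem exists_solves (hT : 0 ≤ T) (g : TimeL2 T X₁) (u₀ : X₂) :
    ∃ v c, D.Solves g v c ∧ c 0 = u₀ := by
  obtain ⟨v, c, h, h0, -⟩ := D.exists_solves_aux hT g u₀
  exact ⟨v, c, h, h0⟩

end ParabolicData

/-! ### Quasilinear parabolic problems -/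

section NormUpTo

variable {X Y Z : Type*} [NormedAddCommGroup X] [NormedSpace ℝ X]
  [NormedAddCommGroup Y] [NormedSpace ℝ Y] [NormedAddCommGroup Z] [NormedSpace ℝ Z] {T : ℝ}

theorem normUpTo_eq (t : ℝ) (v : TimeL2 T X) :
    normUpTo t v = (eLpNorm v 2 ((timeMeasure T).restrict (Iic t))).toReal :=
  Lp.norm_toLp _ ((Lp.memLp v).restrict (Iic t))

theorem ae_restrict_time {p : ℝ → Prop} {t : ℝ} (h : ∀ᵐ s ∂timeMeasure T, s ≤ t → p s) :
    ∀ᵐ s ∂(timeMeasure T).restrict (Iic t), p s := by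
  filter_upwards [ae_restrict_of_ae h, ae_restrict_mem measurableSet_Iic] with s hs hs'
  exact hs hs'

/-- A part of the bound that is constant in time costs only `√T`; smallness for short times enters
the nonlinear estimates here. -/
theorem normUpTo_le_of_bound (hT : 0 ≤ T) {t : ℝ} {h : TimeL2 T X} {p : TimeL2 T Y}
    {q : TimeL2 T Z} {a b c : ℝ} (ha : 0 ≤ a) (hb : 0 ≤ b) (hc : 0 ≤ c)
    (H : ∀ᵐ s ∂timeMeasure T, s ≤ t → ‖h s‖ ≤ a + b * ‖p s‖ + c * ‖q s‖) :
    normUpTo t h ≤ √T * a + b * normUpTo t p + c * normUpTo t q := by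
  set μ := (timeMeasure T).restrict (Iic t)
  have hp : MemLp p 2 μ := (Lp.memLp p).restrict _
  have hq : MemLp q 2 μ := (Lp.memLp q).restrict _
  have h1 : eLpNorm h 2 μ ≤ eLpNorm (fun s => a + b * ‖p s‖ + c * ‖q s‖) 2 μ :=
    eLpNorm_mono_ae_real (ae_restrict_time H)
  have m1 : MemLp (fun _ : ℝ => a) 2 μ := memLp_const _
  have m2 : MemLp (fun s => b * ‖p s‖) 2 μ := hp.norm.const_mul b
  have m3 : MemLp (fun s => c * ‖q s‖) 2 μ := hq.norm.const_mul c
  have h2 : eLpNorm (fun s => a + b * ‖p s‖ + c * ‖q s‖) 2 μ ≤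
      eLpNorm (fun _ : ℝ => a) 2 μ + eLpNorm (fun s => b * ‖p s‖) 2 μ +
        eLpNorm (fun s => c * ‖q s‖) 2 μ := by
    refine (eLpNorm_add_le (m1.1.add m2.1) m3.1 (by norm_num)).trans ?_
    gcongr
    exact eLpNorm_add_le m1.1 m2.1 (by norm_num)
  have e1 : (eLpNorm (fun _ : ℝ => a) 2 μ).toReal ≤ √T * a := by
    refine ENNReal.toReal_le_of_le_ofReal (by positivity) ?_
    refine (eLpNorm_mono_measure _ Measure.restrict_le_self).trans ?_
    refine (eLpNorm_le_of_ae_bound (C := a) (ae_of_all _ fun _ => by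
      rw [Real.norm_of_nonneg ha])).trans (le_of_eq ?_)
    rw [ENNReal.ofReal_mul (by positivity), Real.sqrt_eq_rpow,
      ← ENNReal.ofReal_rpow_of_nonneg hT (by norm_num)]
    simp
  have e2 : (eLpNorm (fun s => b * ‖p s‖) 2 μ).toReal = b * normUpTo t p := by
    have : (fun s => b * ‖p s‖) = b • (fun s => ‖p s‖) := rfl
    rw [this, eLpNorm_const_smul, eLpNorm_norm, ENNReal.toReal_mul, normUpTo_eq]
    simp [abs_of_nonneg hb, μ]
  have e3 : (eLpNorm (fun s => c * ‖q s‖) 2 μ).toReal = c * normUpTo t q := by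
    have : (fun s => c * ‖q s‖) = c • (fun s => ‖q s‖) := rfl
    rw [this, eLpNorm_const_smul, eLpNorm_norm, ENNReal.toReal_mul, normUpTo_eq]
    simp [abs_of_nonneg hc, μ]
  rw [← e2, ← e3]
  refine le_trans ?_ (add_le_add (add_le_add e1 le_rfl) le_rfl)
  rw [normUpTo_eq, ← ENNReal.toReal_add m1.2.ne m2.2.ne, ← ENNReal.toReal_add
    (ENNReal.add_ne_top.2 ⟨m1.2.ne, m2.2.ne⟩) m3.2.ne]
  exact ENNReal.toReal_mono (ENNReal.add_ne_top.2
    ⟨ENNReal.add_ne_top.2 ⟨m1.2.ne, m2.2.ne⟩, m3.2.ne⟩) (h1.trans h2)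

theorem normUpTo_compLp_le (hT : 0 ≤ T) (A : X →L[ℝ] Y) (v : TimeL2 T X) (t : ℝ) :
    normUpTo t (A.compLp v) ≤ ‖A‖ * normUpTo t v := by
  have := normUpTo_le_of_bound (h := A.compLp v) (p := v) (q := v) (t := t) hT le_rfl
    (norm_nonneg A) le_rfl (by
      filter_upwards [A.coeFn_compLp v] with s hs _
      rw [hs]
      simpa using A.le_opNorm (v s))
  simpa using this

theorem normUpTo_mono {s t : ℝ} (hst : s ≤ t) (v : TimeL2 T X) :
    normUpTo s v ≤ normUpTo t v := by
  rw [normUpTo_eq, normUpTo_eq]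
  exact ENNReal.toReal_mono (((Lp.memLp v).restrict _).2.ne)
    (eLpNorm_mono_measure _ (Measure.restrict_mono (Iic_subset_Iic.2 hst) le_rfl))

end NormUpTo

/-- A quasilinear problem `∂ₜu = A(u) u + f(u)` near `γ₀`, for which `1 - A(γ₀)` is one of the
operators of `ParabolicData`. -/
structure QuasilinearData (X₁ X₂ X₃ : Type*) [NormedAddCommGroup X₁] [InnerProductSpace ℝ X₁]
    [NormedAddCommGroup X₂] [InnerProductSpace ℝ X₂] [NormedAddCommGroup X₃]
    [NormedSpace ℝ X₃] extends ParabolicData X₁ X₂ X₃ where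
  γ₀ : X₂
  A : X₂ → X₃ →L[ℝ] X₁
  f : X₂ → X₁
  ρ : ℝ
  ρ_pos : 0 < ρ
  L : ℝ
  L_nonneg : 0 ≤ L
  A_lip : ∀ x ∈ Metric.ball γ₀ ρ, ∀ y ∈ Metric.ball γ₀ ρ, ‖A x - A y‖ ≤ L * ‖x - y‖
  f_lip : ∀ x ∈ Metric.ball γ₀ ρ, ∀ y ∈ Metric.ball γ₀ ρ, ‖f x - f y‖ ≤ L * ‖x - y‖
  B_eq : ∀ ξ, B ξ = ι₂ (ι₃ ξ) - A γ₀ ξ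

namespace QuasilinearData

variable {X₁ X₂ X₃ : Type*} [NormedAddCommGroup X₁] [InnerProductSpace ℝ X₁] [CompleteSpace X₁]
  [NormedAddCommGroup X₂] [InnerProductSpace ℝ X₂] [CompleteSpace X₂]
  [NormedAddCommGroup X₃] [NormedSpace ℝ X₃] [CompleteSpace X₃] (D : QuasilinearData X₁ X₂ X₃)
  {T : ℝ}

/-- The solutions of `∂ₜu = A(u) u + f(u)`, where the equation is imposed only at the times at
which `u` is close to `γ₀`; `v = ∂ₜu` and `c` is the representative in `C([0, T]; X₂)`. -/
structure IsSol (v : TimeL2 T X₁) (u : TimeL2 T X₃) (c : ℝ → X₂) : Prop where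
  cont : ContinuousOn c (Icc 0 T)
  eq_prim : ∀ t ∈ Icc 0 T, D.ι₂ (c t) = D.ι₂ (c 0) + prim v t
  eq_val : ∀ᵐ t ∂timeMeasure T, D.ι₃ (u t) = c t
  eq : ∀ᵐ t ∂timeMeasure T, c t ∈ Metric.ball D.γ₀ D.ρ → v t = D.A (c t) (u t) + D.f (c t)

/-- The right-hand side of `∂ₜu + B u = u + (A(u) - A(γ₀)) u + f(u)`. -/
def rhs (x : X₂) (ξ : X₃) : X₁ := D.ι₂ x + (D.A x - D.A D.γ₀) ξ + D.f x

/-- `∂ₜu + B u`. -/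
def total (v : TimeL2 T X₁) (u : TimeL2 T X₃) : TimeL2 T X₁ :=
  v + (D.B : X₃ →L[ℝ] X₁).compLp u

/-- `u = B⁻¹ (g - ∂ₜu)`. -/
def recover (g v : TimeL2 T X₁) : TimeL2 T X₃ := (D.B.symm : X₁ →L[ℝ] X₃).compLp (g - v)

theorem coeFn_recover (g v : TimeL2 T X₁) :
    ∀ᵐ t ∂timeMeasure T, D.recover g v t = D.B.symm (g t - v t) := by
  filter_upwards [(D.B.symm : X₁ →L[ℝ] X₃).coeFn_compLp (g - v), Lp.coeFn_sub g v] with t h1 h2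
  rw [recover, h1, h2]
  rfl

theorem coeFn_total (v : TimeL2 T X₁) (u : TimeL2 T X₃) :
    ∀ᵐ t ∂timeMeasure T, D.total v u t = v t + D.B (u t) := by
  filter_upwards [(D.B : X₃ →L[ℝ] X₁).coeFn_compLp u,
    Lp.coeFn_add v ((D.B : X₃ →L[ℝ] X₁).compLp u)] with t h1 h2
  rw [total, h2, Pi.add_apply, h1]
  rfl

theorem recover_total (v : TimeL2 T X₁) (u : TimeL2 T X₃) : D.recover (D.total v u) v = u := by
  refine Lp.ext ?_
  filter_upwards [D.coeFn_recover (D.total v u) v, D.coeFn_total v u] with t h1 h2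
  rw [h1, h2]
  simp

variable {D}

theorem ι₃_recover {g v : TimeL2 T X₁} {c : ℝ → X₂} (h : D.Solves g v c) :
    ∀ᵐ t ∂timeMeasure T, D.ι₃ (D.recover g v t) = c t := by
  filter_upwards [h.eq_resolvent, D.coeFn_recover g v] with t h1 h2
  rw [h2]
  exact D.ι₂_injective h1.symm

theorem IsSol.solves {v : TimeL2 T X₁} {u : TimeL2 T X₃} {c : ℝ → X₂} (h : D.IsSol v u c) :
    D.Solves (D.total v u) v c := by
  refine ⟨h.cont, h.eq_prim, ?_⟩
  filter_upwards [h.eq_val, D.coeFn_total v u] with t h1 h2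
  rw [h2, add_sub_cancel_left, ← h1]
  simp [ParabolicData.R, ParabolicData.r]

theorem IsSol.total_eq {v : TimeL2 T X₁} {u : TimeL2 T X₃} {c : ℝ → X₂} (h : D.IsSol v u c) :
    ∀ᵐ t ∂timeMeasure T, c t ∈ Metric.ball D.γ₀ D.ρ → D.total v u t = D.rhs (c t) (u t) := by
  filter_upwards [h.eq_val, h.eq, D.coeFn_total v u] with t h1 h2 h3 h4
  rw [h3, h2 h4, rhs, D.B_eq, h1, sub_apply]
  abel

theorem isSol_of_solves {g v : TimeL2 T X₁} {c : ℝ → X₂} (h : D.Solves g v c)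
    (hg : ∀ᵐ t ∂timeMeasure T, g t = D.rhs (c t) (D.recover g v t)) :
    D.IsSol v (D.recover g v) c := by
  refine ⟨h.cont, h.eq_prim, ι₃_recover h, ?_⟩
  filter_upwards [hg, D.coeFn_recover g v, ι₃_recover h] with t h1 h2 h3 _
  have h4 : D.B (D.recover g v t) = g t - v t := by rw [h2]; simp
  rw [D.B_eq, h3, h1, rhs, sub_apply] at h4
  have h5 := sub_eq_iff_eq_add.1 h4.symm
  have h6 := eq_sub_of_add_eq' h5.symm
  rw [h6]
  abel

variable (D)

/-- The constant of the estimate of `∂ₜu`, `u` in `L²(0, T; X₃)` and `u` in `C([0, T]; X₂)`. -/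
def K : ℝ := √D.regConst

theorem K_nonneg : 0 ≤ D.K := Real.sqrt_nonneg _

/-- The constant in the Lipschitz estimate of the right-hand side. -/
def M : ℝ := D.K * ((‖D.ι₂‖ + D.L) + D.L * (‖(D.B.symm : X₁ →L[ℝ] X₃)‖ + 1))

theorem M_nonneg : 0 ≤ D.M := by
  have := D.K_nonneg
  have := D.L_nonneg
  unfold M
  positivity

variable {D}

theorem solves_bounds (hT : 0 ≤ T) {g v : TimeL2 T X₁} {c : ℝ → X₂} (h : D.Solves g v c)
    {t : ℝ} (ht : t ∈ Icc 0 T) :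
    normUpTo t v ≤ D.K * (normUpTo t g + ‖c 0‖) ∧
      normUpTo t (g - v) ≤ D.K * (normUpTo t g + ‖c 0‖) ∧
      ∀ s ∈ Icc 0 t, ‖c s‖ ≤ D.K * (normUpTo t g + ‖c 0‖) := by
  have hK : D.K ^ 2 = D.regConst := Real.sq_sqrt D.regConst_nonneg
  have main : ∀ s ∈ Icc 0 t, normUpTo s v ^ 2 + normUpTo s (g - v) ^ 2 + ‖c s‖ ^ 2 ≤
      (D.K * (normUpTo t g + ‖c 0‖)) ^ 2 := by
    intro s hs
    have h1 := h.estimate hT ⟨hs.1, hs.2.trans ht.2⟩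
    refine h1.trans ?_
    rw [mul_pow, hK]
    refine mul_le_mul_of_nonneg_left ?_ D.regConst_nonneg
    have h2 := normUpTo_mono hs.2 g
    have h3 := normUpTo_nonneg s g
    nlinarith [norm_nonneg (c 0)]
  have hn : 0 ≤ D.K * (normUpTo t g + ‖c 0‖) :=
    mul_nonneg D.K_nonneg (add_nonneg (normUpTo_nonneg _ _) (norm_nonneg _))
  refine ⟨?_, ?_, fun s hs => ?_⟩
  · have := main t ⟨ht.1, le_rfl⟩
    exact (abs_le_of_sq_le_sq' (by
      nlinarith [sq_nonneg (normUpTo t (g - v)), sq_nonneg (‖c t‖)]) hn).2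
  · have := main t ⟨ht.1, le_rfl⟩
    exact (abs_le_of_sq_le_sq' (by
      nlinarith [sq_nonneg (normUpTo t v), sq_nonneg (‖c t‖)]) hn).2
  · have := main s hs
    exact (abs_le_of_sq_le_sq' (by
      nlinarith [sq_nonneg (normUpTo s (g - v)), sq_nonneg (normUpTo s v)]) hn).2

theorem recover_sub (g v g' v' : TimeL2 T X₁) :
    D.recover g v - D.recover g' v' = D.recover (g - g') (v - v') := by
  have e : ∀ g v, D.recover g v =
    (D.B.symm : X₁ →L[ℝ] X₃).compLpL 2 (timeMeasure T) (g - v) := fun g v => rfl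
  rw [e, e, e, ← map_sub]
  congr 1
  abel

theorem solves_sub_bounds (hT : 0 ≤ T) {g v g' v' : TimeL2 T X₁} {c c' : ℝ → X₂}
    (h : D.Solves g v c) (h' : D.Solves g' v' c') {t : ℝ} (ht : t ∈ Icc 0 T) :
    normUpTo t (v - v') ≤ D.K * (normUpTo t (g - g') + ‖c 0 - c' 0‖) ∧
      normUpTo t (D.recover g v - D.recover g' v') ≤
        ‖(D.B.symm : X₁ →L[ℝ] X₃)‖ * (D.K * (normUpTo t (g - g') + ‖c 0 - c' 0‖)) ∧
      ∀ s ∈ Icc 0 t, ‖c s - c' s‖ ≤ D.K * (normUpTo t (g - g') + ‖c 0 - c' 0‖) := by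
  obtain ⟨h1, h2, h3⟩ := solves_bounds hT (h.sub h') ht
  refine ⟨h1, ?_, h3⟩
  rw [recover_sub]
  exact (normUpTo_compLp_le hT _ _ _).trans (mul_le_mul_of_nonneg_left h2 (norm_nonneg _))

/-- Freezing the leading operator at `γ₀` puts the factor `δ` in front of the top-order difference
`ξ - η`. The remaining top-order quantity `η` occurs only multiplied by `‖x - y‖`. -/
theorem rhs_sub_le {δ : ℝ} (hδ : δ < D.ρ) {x y : X₂} (hx : ‖x - D.γ₀‖ ≤ δ)
    (hy : ‖y - D.γ₀‖ ≤ δ) (ξ η : X₃) :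
    ‖D.rhs x ξ - D.rhs y η‖ ≤
      (‖D.ι₂‖ + D.L) * ‖x - y‖ + D.L * δ * ‖ξ - η‖ + D.L * ‖x - y‖ * ‖η‖ := by
  have hx' : x ∈ Metric.ball D.γ₀ D.ρ := by
    rw [Metric.mem_ball, dist_eq_norm]; exact hx.trans_lt hδ
  have hy' : y ∈ Metric.ball D.γ₀ D.ρ := by
    rw [Metric.mem_ball, dist_eq_norm]; exact hy.trans_lt hδ
  have e : D.rhs x ξ - D.rhs y η = D.ι₂ (x - y) + (D.A x - D.A D.γ₀) (ξ - η) +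
      (D.A x - D.A y) η + (D.f x - D.f y) := by
    simp only [rhs, map_sub, sub_apply]
    abel
  have h1 : ‖D.ι₂ (x - y)‖ ≤ ‖D.ι₂‖ * ‖x - y‖ := D.ι₂.le_opNorm _
  have h2 : ‖(D.A x - D.A D.γ₀) (ξ - η)‖ ≤ D.L * δ * ‖ξ - η‖ := by
    refine ((D.A x - D.A D.γ₀).le_opNorm _).trans ?_
    have := D.A_lip x hx' D.γ₀ (Metric.mem_ball_self D.ρ_pos)
    have h0 := mul_le_mul_of_nonneg_left hx D.L_nonneg
    gcongr
    exact this.trans h0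
  have h3 : ‖(D.A x - D.A y) η‖ ≤ D.L * ‖x - y‖ * ‖η‖ := by
    refine ((D.A x - D.A y).le_opNorm _).trans ?_
    gcongr
    exact D.A_lip x hx' y hy'
  have h4 := D.f_lip x hx' y hy'
  rw [e]
  calc _ ≤ ‖D.ι₂ (x - y)‖ + ‖(D.A x - D.A D.γ₀) (ξ - η)‖ + ‖(D.A x - D.A y) η‖ +
      ‖D.f x - D.f y‖ := norm_add₄_le
    _ ≤ _ := by linarith

/-- This is the contraction estimate. The factor `√T` comes from the terms bounded in time; `δ`
comes once from `A x - A γ₀` and once from the smallness of the second solution in `L²(0, t; X₃)`.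
Closeness to `γ₀` is required only before `t`, so that the estimate applies at a first exit time. -/
theorem normUpTo_rhs_sub_le (hT : 0 ≤ T) {δ : ℝ} (hδ0 : 0 ≤ δ) (hδ : δ < D.ρ)
    {g v g' v' : TimeL2 T X₁} {c c' : ℝ → X₂} (h : D.Solves g v c) (h' : D.Solves g' v' c')
    {t : ℝ} (ht : t ∈ Icc 0 T) (hc : ∀ s ∈ Ico 0 t, ‖c s - D.γ₀‖ ≤ δ)
    (hc' : ∀ s ∈ Ico 0 t, ‖c' s - D.γ₀‖ ≤ δ) (hu : normUpTo t (D.recover g' v') ≤ δ)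
    {k : TimeL2 T X₁} (hk : ∀ᵐ s ∂timeMeasure T, s < t →
      k s = D.rhs (c s) (D.recover g v s) - D.rhs (c' s) (D.recover g' v' s)) :
    normUpTo t k ≤ D.M * (√T + δ) * (normUpTo t (g - g') + ‖c 0 - c' 0‖) := by
  set E := normUpTo t (g - g') + ‖c 0 - c' 0‖ with hE
  have hE0 : 0 ≤ E := add_nonneg (normUpTo_nonneg _ _) (norm_nonneg _)
  obtain ⟨-, h2, h3⟩ := solves_sub_bounds hT h h' ht
  rw [← hE] at h2 h3
  have hK := D.K_nonneg
  have hL := D.L_nonneg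
  have hKE : 0 ≤ D.K * E := mul_nonneg hK hE0
  have key : normUpTo t k ≤ √T * ((‖D.ι₂‖ + D.L) * (D.K * E)) +
      D.L * δ * normUpTo t (D.recover g v - D.recover g' v') +
      D.L * (D.K * E) * normUpTo t (D.recover g' v') := by
    refine normUpTo_le_of_bound hT (by positivity) (by positivity) (by positivity) ?_
    have hne : ∀ᵐ s ∂timeMeasure T, s ≠ t :=
      ae_restrict_of_ae (by simp [ae_iff, measure_singleton])
    filter_upwards [hk, Lp.coeFn_sub (D.recover g v) (D.recover g' v'),
      ae_restrict_mem measurableSet_Ioo, hne] with s e1 e2 e3 e4 e5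
    have hst : s < t := lt_of_le_of_ne e5 e4
    rw [e1 hst, e2, Pi.sub_apply]
    refine (rhs_sub_le hδ (hc s ⟨e3.1.le, hst⟩) (hc' s ⟨e3.1.le, hst⟩) _ _).trans ?_
    have := h3 s ⟨e3.1.le, e5⟩
    gcongr
  refine key.trans ?_
  have h4 : D.L * δ * normUpTo t (D.recover g v - D.recover g' v') ≤
      D.L * δ * (‖(D.B.symm : X₁ →L[ℝ] X₃)‖ * (D.K * E)) :=
    mul_le_mul_of_nonneg_left h2 (by positivity)
  have h5 : D.L * (D.K * E) * normUpTo t (D.recover g' v') ≤ D.L * (D.K * E) * δ :=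
    mul_le_mul_of_nonneg_left hu (by positivity)
  have h6 : 0 ≤ √T * D.L * (‖(D.B.symm : X₁ →L[ℝ] X₃)‖ + 1) * (D.K * E) := by positivity
  have h7 : 0 ≤ δ * (‖D.ι₂‖ + D.L) * (D.K * E) := by positivity
  unfold M
  nlinarith

theorem memLp_rhs {c : ℝ → X₂} (hc : ContinuousOn c (Icc 0 T))
    (hb : ∀ t ∈ Icc 0 T, c t ∈ Metric.ball D.γ₀ D.ρ) (u : TimeL2 T X₃) :
    MemLp (fun t => D.rhs (c t) (u t)) 2 (timeMeasure T) := by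
  have hsub : Ioo 0 T ⊆ Icc 0 T := Ioo_subset_Icc_self
  have hf : ContinuousOn D.f (Metric.ball D.γ₀ D.ρ) :=
    (LipschitzOnWith.of_dist_le_mul (K := ⟨D.L, D.L_nonneg⟩) fun x hx y hy => by
      rw [dist_eq_norm, dist_eq_norm]; exact D.f_lip x hx y hy).continuousOn
  have hA : ContinuousOn D.A (Metric.ball D.γ₀ D.ρ) :=
    (LipschitzOnWith.of_dist_le_mul (K := ⟨D.L, D.L_nonneg⟩) fun x hx y hy => by
      rw [dist_eq_norm, dist_eq_norm]; exact D.A_lip x hx y hy).continuousOn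
  have hfc : ContinuousOn (fun t => D.f (c t)) (Icc 0 T) := hf.comp hc hb
  have hAc : ContinuousOn (fun t => D.A (c t) - D.A D.γ₀) (Icc 0 T) :=
    (hA.comp hc hb).sub continuousOn_const
  have hιc : ContinuousOn (fun t => D.ι₂ (c t)) (Icc 0 T) := D.ι₂.continuous.comp_continuousOn hc
  have of_cont : ∀ {w : ℝ → X₁}, ContinuousOn w (Icc 0 T) → MemLp w 2 (timeMeasure T) := by
    intro w hw
    obtain ⟨C, hC⟩ := isCompact_Icc.exists_bound_of_continuousOn hw
    exact MemLp.of_bound ((hw.mono hsub).aestronglyMeasurable measurableSet_Ioo) C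
      (by filter_upwards [ae_restrict_mem measurableSet_Ioo] with t ht using hC t (hsub ht))
  refine ((of_cont hιc).add ?_).add (of_cont hfc)
  obtain ⟨C, hC⟩ := isCompact_Icc.exists_bound_of_continuousOn hAc
  refine MemLp.of_le_mul (c := C) (Lp.memLp u) ?_ ?_
  · exact (ContinuousLinearMap.id ℝ (X₃ →L[ℝ] X₁)).aestronglyMeasurable_comp₂
      ((hAc.mono hsub).aestronglyMeasurable measurableSet_Ioo) (Lp.aestronglyMeasurable u)
  · filter_upwards [ae_restrict_mem measurableSet_Ioo] with t ht
    exact ((D.A (c t) - D.A D.γ₀).le_opNorm _).trans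
      (mul_le_mul_of_nonneg_right (hC t (hsub ht)) (norm_nonneg _))

/-- The point `γ₀` need not lie in the range of `ι₃`. Linear solutions are therefore compared with
the constant curve through a nearby `ι₃ ξ`, whose norm in `L²(0, T; X₃)` is of order `√T`. -/
theorem solves_const (ξ : X₃) :
    D.Solves (Lp.const 2 (timeMeasure T) (D.B ξ)) 0 (fun _ => D.ι₃ ξ) := by
  refine ⟨continuousOn_const, fun t ht => ?_, ?_⟩
  · have : prim (0 : TimeL2 T X₁) t = 0 := (primL (ht.1.trans ht.2) X₁ t).map_zero
    rw [this, add_zero]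
  · filter_upwards [Lp.coeFn_const 2 (timeMeasure T) (D.B ξ),
      Lp.coeFn_zero X₁ 2 (timeMeasure T)] with t h1 h2
    rw [h1, h2]
    simp [ParabolicData.R, ParabolicData.r]

theorem norm_const_le {X : Type*} [NormedAddCommGroup X] [NormedSpace ℝ X] (hT : 0 ≤ T) (x : X) :
    ‖Lp.const 2 (timeMeasure T) x‖ ≤ √T * ‖x‖ :=
  norm_toLp_le_of_bound hT (memLp_const x) (ae_of_all _ fun _ => le_rfl) (norm_nonneg _)

end QuasilinearData

/-! ### Uniqueness, Lipschitz dependence and existence by contraction. -/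

namespace QuasilinearData

variable {X₁ X₂ X₃ : Type*} [NormedAddCommGroup X₁] [InnerProductSpace ℝ X₁] [CompleteSpace X₁]
  [NormedAddCommGroup X₂] [InnerProductSpace ℝ X₂] [CompleteSpace X₂]
  [NormedAddCommGroup X₃] [NormedSpace ℝ X₃] [CompleteSpace X₃] {D : QuasilinearData X₁ X₂ X₃}
  {T : ℝ}

/-- If `u` is a solution staying `δ`-close to `γ₀` and small in `L²(0, T; X₃)`, any other solution
with the same initial value agrees with it. -/
theorem IsSol.eq_of_close (hT : 0 ≤ T) {δ : ℝ} (hδ0 : 0 < δ) (hδ : 2 * δ < D.ρ)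
    (hsmall : D.M * (√T + 2 * δ) ≤ 1 / 2) {v v' : TimeL2 T X₁} {u u' : TimeL2 T X₃}
    {c c' : ℝ → X₂} (h : D.IsSol v u c) (h' : D.IsSol v' u' c') (h0 : c 0 = c' 0)
    (hc' : ∀ t ∈ Icc 0 T, ‖c' t - D.γ₀‖ ≤ δ) (hu' : ‖u'‖ ≤ δ) :
    v = v' ∧ u = u' ∧ ∀ t ∈ Icc 0 T, c t = c' t := by
  -- As long as `c` stays `2δ`-close, the difference of the forcings is at most half of itself and
  -- so vanishes.
  have step : ∀ t ∈ Icc 0 T, (∀ s ∈ Ico 0 t, ‖c s - D.γ₀‖ ≤ 2 * δ) →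
      normUpTo t (D.total v u - D.total v' u') + ‖c 0 - c' 0‖ = 0 := by
    intro t ht hct
    have hb : ∀ {x : X₂}, ‖x - D.γ₀‖ ≤ 2 * δ → x ∈ Metric.ball D.γ₀ D.ρ := fun {x} hx => by
      rw [Metric.mem_ball, dist_eq_norm]; exact hx.trans_lt hδ
    have hct' : ∀ s ∈ Ico 0 t, ‖c' s - D.γ₀‖ ≤ 2 * δ := fun s hs =>
      (hc' s ⟨hs.1, hs.2.le.trans ht.2⟩).trans (by linarith)
    have := normUpTo_rhs_sub_le hT (by linarith) hδ h.solves h'.solves ht hct hct'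
      (by rw [recover_total]; exact (normUpTo_le _ _).trans (hu'.trans (by linarith)))
      (k := D.total v u - D.total v' u') (by
        rw [recover_total, recover_total]
        filter_upwards [h.total_eq, h'.total_eq, Lp.coeFn_sub (D.total v u) (D.total v' u'),
          ae_restrict_mem measurableSet_Ioo] with s e1 e2 e3 e4 e5
        rw [e3, Pi.sub_apply, e1 (hb (hct s ⟨e4.1.le, e5⟩)), e2 (hb (hct' s ⟨e4.1.le, e5⟩))])
    rw [h0, sub_self, norm_zero, add_zero] at this ⊢
    nlinarith [normUpTo_nonneg t (D.total v u - D.total v' u')]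
  -- At the first time where the distance reaches `2δ` the two solutions still agree, but `c'` is
  -- within `δ` of `γ₀`. Closeness of `c` is thus a conclusion.
  have close : ∀ t ∈ Icc 0 T, ‖c t - D.γ₀‖ < 2 * δ := by
    by_contra hcon
    push Not at hcon
    set bad : Set ℝ := Icc 0 T ∩ (fun t => ‖c t - D.γ₀‖) ⁻¹' Ici (2 * δ) with hbad
    have hclosed : IsClosed bad :=
      (h.cont.sub continuousOn_const).norm.preimage_isClosed_of_isClosed isClosed_Icc isClosed_Ici
    have hcomp : IsCompact bad := isCompact_Icc.of_isClosed_subset hclosed inter_subset_left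
    obtain ⟨t, ht, hmin⟩ := hcomp.exists_isLeast (by
      obtain ⟨t, ht, ht'⟩ := hcon; exact ⟨t, ht, ht'⟩)
    have h1 := step t ht.1 (fun s hs => by
      by_contra hs'
      push Not at hs'
      exact absurd (hmin ⟨⟨hs.1, hs.2.le.trans ht.1.2⟩, hs'.le⟩) (not_le.2 hs.2))
    have h2 := (solves_sub_bounds hT h.solves h'.solves ht.1).2.2 t ⟨ht.1.1, le_rfl⟩
    rw [h1, mul_zero] at h2
    have h3 : c t = c' t := sub_eq_zero.1 (norm_le_zero_iff.1 h2)
    have h4 : 2 * δ ≤ ‖c t - D.γ₀‖ := ht.2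
    rw [h3] at h4
    have := hc' t ht.1
    linarith
  have hTm : T ∈ Icc 0 T := ⟨hT, le_rfl⟩
  have h1 := step T hTm (fun s hs => (close s ⟨hs.1, hs.2.le⟩).le)
  obtain ⟨b1, b2, b3⟩ := solves_sub_bounds hT h.solves h'.solves hTm
  rw [h1, mul_zero] at b1 b2 b3
  rw [normUpTo_of_le le_rfl] at b1
  rw [mul_zero, normUpTo_of_le le_rfl, recover_total, recover_total] at b2
  exact ⟨sub_eq_zero.1 (norm_le_zero_iff.1 b1), sub_eq_zero.1 (norm_le_zero_iff.1 b2),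
    fun t ht => sub_eq_zero.1 (norm_le_zero_iff.1 (b3 t ht))⟩

/-- The contraction estimate bounds the forcing difference by `E / 2`, where `E` is that difference
plus the initial distance; absorbing gives `E ≤ 2 ‖c 0 - c' 0‖`. -/
theorem IsSol.dist_le_of_close (hT : 0 ≤ T) {δ : ℝ} (hδ0 : 0 < δ) (hδ : 2 * δ < D.ρ)
    (hsmall : D.M * (√T + 2 * δ) ≤ 1 / 2) {v v' : TimeL2 T X₁} {u u' : TimeL2 T X₃}
    {c c' : ℝ → X₂} (h : D.IsSol v u c) (h' : D.IsSol v' u' c')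
    (hc : ∀ t ∈ Icc 0 T, ‖c t - D.γ₀‖ ≤ δ)
    (hc' : ∀ t ∈ Icc 0 T, ‖c' t - D.γ₀‖ ≤ δ) (hu' : ‖u'‖ ≤ δ) :
    ‖v - v'‖ ≤ 2 * D.K * ‖c 0 - c' 0‖ ∧
      ‖u - u'‖ ≤ ‖(D.B.symm : X₁ →L[ℝ] X₃)‖ * (2 * D.K * ‖c 0 - c' 0‖) := by
  have hTm : T ∈ Icc 0 T := ⟨hT, le_rfl⟩
  have hb : ∀ {x : X₂}, ‖x - D.γ₀‖ ≤ δ → x ∈ Metric.ball D.γ₀ D.ρ := fun {x} hx => by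
    rw [Metric.mem_ball, dist_eq_norm]; linarith
  have key := normUpTo_rhs_sub_le hT hδ0.le (by linarith) h.solves h'.solves hTm
    (fun s hs => hc s ⟨hs.1, hs.2.le⟩) (fun s hs => hc' s ⟨hs.1, hs.2.le⟩)
    (by rw [recover_total]; exact (normUpTo_le _ _).trans hu')
    (k := D.total v u - D.total v' u') (by
      rw [recover_total, recover_total]
      filter_upwards [h.total_eq, h'.total_eq, Lp.coeFn_sub (D.total v u) (D.total v' u'),
        ae_restrict_mem measurableSet_Ioo] with s e1 e2 e3 e4 e5
      rw [e3, Pi.sub_apply, e1 (hb (hc s ⟨e4.1.le, e5.le⟩)),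
        e2 (hb (hc' s ⟨e4.1.le, e5.le⟩))])
  obtain ⟨b1, b2, -⟩ := solves_sub_bounds hT h.solves h'.solves hTm
  rw [normUpTo_of_le le_rfl] at b1
  rw [recover_total, recover_total, normUpTo_of_le le_rfl] at b2
  set E := normUpTo T (D.total v u - D.total v' u') + ‖c 0 - c' 0‖ with hE
  have hE0 : 0 ≤ E := add_nonneg (normUpTo_nonneg _ _) (norm_nonneg _)
  have hM := D.M_nonneg
  have hE1 : E ≤ 2 * ‖c 0 - c' 0‖ := by
    have : D.M * (√T + δ) ≤ 1 / 2 := le_trans (by gcongr; linarith) hsmall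
    nlinarith
  have hKE : D.K * E ≤ 2 * D.K * ‖c 0 - c' 0‖ := by nlinarith [D.K_nonneg]
  exact ⟨b1.trans hKE, b2.trans (mul_le_mul_of_nonneg_left hKE (norm_nonneg _))⟩

/-- Existence of a solution with initial value close to `ι₃ ξ`, `ξ ∈ X₃`, on a short time
interval. -/
theorem exists_isSol (hT : 0 ≤ T) {r δ : ℝ} (hr : 0 < r)
    (hδ : δ = (4 * D.K + 4 * ‖(D.B.symm : X₁ →L[ℝ] X₃)‖ * D.K + 1) * r)
    (hδρ : δ < D.ρ) (hsmall : D.M * (√T + δ) ≤ 1 / 8) (ξ : X₃) (hξ : ‖D.ι₃ ξ - D.γ₀‖ < r)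
    (hT1 : √T * ‖D.B ξ‖ ≤ r) (hT2 : √T * ‖ξ‖ ≤ r) (hT3 : √T * ‖D.rhs (D.ι₃ ξ) ξ‖ ≤ r / 2)
    {γ₁ : X₂} (hγ : ‖γ₁ - D.γ₀‖ < r) :
    ∃ v u c, D.IsSol (T := T) v u c ∧ c 0 = γ₁ ∧ (∀ t ∈ Icc 0 T, ‖c t - D.γ₀‖ ≤ δ) ∧ ‖u‖ ≤ δ := by
  have hTm : T ∈ Icc 0 T := ⟨hT, le_rfl⟩
  have hK := D.K_nonneg
  have hrδ : r ≤ δ := by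
    rw [hδ]
    have : 0 ≤ (4 * D.K + 4 * ‖(D.B.symm : X₁ →L[ℝ] X₃)‖ * D.K) * r := by positivity
    linarith
  -- The unknown of the fixed-point problem is the forcing `g`; `V g` and `C g` are the time
  -- derivative and the curve of the linear solution with initial value `γ₁`.
  choose! V C hS hC0 using fun g : TimeL2 T X₁ => D.exists_solves hT g γ₁
  set g₀ : TimeL2 T X₁ := Lp.const 2 (timeMeasure T) (D.B ξ) with hg₀
  have hS₀ := solves_const (D := D) (T := T) ξ
  rw [← hg₀] at hS₀
  have hrec₀ : D.recover g₀ 0 = Lp.const 2 (timeMeasure T) ξ := by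
    refine Lp.ext ?_
    filter_upwards [D.coeFn_recover g₀ 0, Lp.coeFn_const 2 (timeMeasure T) (D.B ξ),
      Lp.coeFn_const 2 (timeMeasure T) ξ, Lp.coeFn_zero X₁ 2 (timeMeasure T)] with t h1 h2 h3 h4
    rw [h1, hg₀, h2, h3, h4]
    simp
  have hrec₀n : ‖D.recover g₀ 0‖ ≤ r := by
    rw [hrec₀]
    exact (norm_const_le hT ξ).trans hT2
  -- Forcing and initial value each differ by at most `2r` from those of the constant solution.
  -- After the linear estimates this `4r` produces the two constants `4` in `δ`, and the summand `1`
  -- pays for passing from `ξ` back to `γ₀` or to zero.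
  have hE : ∀ g, ‖g‖ ≤ r → normUpTo T (g - g₀) + ‖C g 0 - D.ι₃ ξ‖ ≤ 4 * r := by
    intro g hg
    have h1 : normUpTo T (g - g₀) ≤ r + r :=
      (normUpTo_le _ _).trans ((norm_sub_le _ _).trans
        (add_le_add hg ((norm_const_le hT _).trans hT1)))
    have h2 : ‖C g 0 - D.ι₃ ξ‖ ≤ r + r := by
      rw [hC0, ← sub_sub_sub_cancel_right _ _ D.γ₀]
      exact (norm_sub_le _ _).trans (add_le_add hγ.le hξ.le)
    linarith
  have hclose : ∀ g, ‖g‖ ≤ r → ∀ t ∈ Icc 0 T, ‖C g t - D.γ₀‖ ≤ δ := by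
    intro g hg t ht
    have h1 := (solves_sub_bounds hT (hS g) hS₀ hTm).2.2 t ht
    have h2 := mul_le_mul_of_nonneg_left (hE g hg) hK
    have h3 : ‖C g t - D.γ₀‖ ≤ ‖C g t - D.ι₃ ξ‖ + ‖D.ι₃ ξ - D.γ₀‖ := norm_sub_le_norm_sub_add_norm_sub _ _ _
    have h4 : 0 ≤ 4 * ‖(D.B.symm : X₁ →L[ℝ] X₃)‖ * D.K * r := by positivity
    rw [hδ]
    nlinarith
  have hsmallu : ∀ g, ‖g‖ ≤ r → ‖D.recover g (V g)‖ ≤ δ := by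
    intro g hg
    have h1 := (solves_sub_bounds hT (hS g) hS₀ hTm).2.1
    rw [normUpTo_of_le le_rfl] at h1
    have h2 := mul_le_mul_of_nonneg_left (mul_le_mul_of_nonneg_left (hE g hg) hK)
      (norm_nonneg (D.B.symm : X₁ →L[ℝ] X₃))
    have h3 := norm_le_norm_sub_add (D.recover g (V g)) (D.recover g₀ 0)
    have h4 : 0 ≤ 4 * D.K * r := by positivity
    rw [hδ]
    nlinarith
  have hball : ∀ {x : X₂}, ‖x - D.γ₀‖ ≤ δ → x ∈ Metric.ball D.γ₀ D.ρ := fun {x} hx => by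
    rw [Metric.mem_ball, dist_eq_norm]; linarith
  have hmem : ∀ g, ‖g‖ ≤ r →
      MemLp (fun t => D.rhs (C g t) (D.recover g (V g) t)) 2 (timeMeasure T) := fun g hg =>
    memLp_rhs (hS g).cont (fun t ht => hball (hclose g hg t ht)) _
  classical
  -- A fixed point of `Φ` is a forcing that equals the right-hand side along its own linear
  -- solution. The value `0` outside the ball is never used.
  set Φ : TimeL2 T X₁ → TimeL2 T X₁ := fun g => if hg : ‖g‖ ≤ r then (hmem g hg).toLp else 0
  have hΦ : ∀ g, ‖g‖ ≤ r →
      Φ g =ᵐ[timeMeasure T] fun t => D.rhs (C g t) (D.recover g (V g) t) := fun g hg => by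
    simp only [Φ, hg, dif_pos]
    exact (hmem g hg).coeFn_toLp
  have hM := D.M_nonneg
  have hlip : ∀ g g', ‖g‖ ≤ r → ‖g'‖ ≤ r → ‖Φ g - Φ g'‖ ≤ 1 / 2 * ‖g - g'‖ := by
    intro g g' hg hg'
    have := normUpTo_rhs_sub_le hT (hr.le.trans hrδ) hδρ (hS g) (hS g') hTm
      (fun s hs => hclose g hg s ⟨hs.1, hs.2.le⟩) (fun s hs => hclose g' hg' s ⟨hs.1, hs.2.le⟩)
      ((normUpTo_le _ _).trans (hsmallu g' hg')) (k := Φ g - Φ g') (by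
        filter_upwards [hΦ g hg, hΦ g' hg', Lp.coeFn_sub (Φ g) (Φ g')] with s h1 h2 h3 _
        rw [h3, Pi.sub_apply, h1, h2])
    rw [hC0, hC0, sub_self, norm_zero, add_zero, normUpTo_of_le le_rfl,
      normUpTo_of_le le_rfl] at this
    nlinarith [norm_nonneg (g - g')]
  -- Comparison with the constant solution gives `(1/8)(4r) + r/2 = r`.
  have hself : ∀ g, ‖g‖ ≤ r → ‖Φ g‖ ≤ r := by
    intro g hg
    set k₀ : TimeL2 T X₁ := Lp.const 2 (timeMeasure T) (D.rhs (D.ι₃ ξ) ξ) with hk₀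
    have h1 := normUpTo_rhs_sub_le hT (hr.le.trans hrδ) hδρ (hS g) hS₀ hTm
      (fun s hs => hclose g hg s ⟨hs.1, hs.2.le⟩) (fun s hs => hξ.le.trans hrδ)
      ((normUpTo_le _ _).trans (hrec₀n.trans hrδ)) (k := Φ g - k₀) (by
        rw [hrec₀]
        filter_upwards [hΦ g hg, Lp.coeFn_const 2 (timeMeasure T) ξ,
          Lp.coeFn_const 2 (timeMeasure T) (D.rhs (D.ι₃ ξ) ξ),
          Lp.coeFn_sub (Φ g) k₀] with s h1 h2 h3 h4 _
        rw [h4, Pi.sub_apply, h1, h2, hk₀, h3]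
        rfl)
    rw [normUpTo_of_le le_rfl] at h1
    have h2 := hE g hg
    have h3 : ‖k₀‖ ≤ r / 2 := (norm_const_le hT _).trans hT3
    have h4 := norm_le_norm_sub_add (Φ g) k₀
    have h5 : D.M * (√T + δ) * (normUpTo T (g - g₀) + ‖C g 0 - D.ι₃ ξ‖) ≤ 1 / 8 * (4 * r) := by
      gcongr
      exact add_nonneg (normUpTo_nonneg _ _) (norm_nonneg _)
    linarith
  have hmaps : MapsTo Φ (Metric.closedBall 0 r) (Metric.closedBall 0 r) := fun g hg => by
    rw [mem_closedBall_zero_iff] at hg ⊢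
    exact hself g hg
  have hcontr : ContractingWith (1 / 2) (hmaps.restrict Φ _ _) := by
    refine ⟨by norm_num, LipschitzWith.of_dist_le_mul ?_⟩
    rintro ⟨g, hg⟩ ⟨g', hg'⟩
    rw [Subtype.dist_eq, Subtype.dist_eq, dist_eq_norm, dist_eq_norm]
    have := hlip g g' (mem_closedBall_zero_iff.1 hg) (mem_closedBall_zero_iff.1 hg')
    simpa using this
  obtain ⟨g, hg, hfix, -⟩ := hcontr.exists_fixedPoint' Metric.isClosed_closedBall.isComplete hmaps
    (x := 0) (Metric.mem_closedBall_self hr.le) (edist_ne_top _ _)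
  rw [mem_closedBall_zero_iff] at hg
  refine ⟨V g, D.recover g (V g), C g, isSol_of_solves (hS g) ?_, hC0 g, hclose g hg,
    hsmallu g hg⟩
  have := hΦ g hg
  rwa [show Φ g = g from hfix] at this

variable (D)

/-- Local well-posedness of the quasilinear problem. -/
theorem wellPosed : ∃ T : ℝ, 0 < T ∧ ∃ ε : ℝ, 0 < ε ∧ ε ≤ D.ρ ∧
    (∀ γ₁ ∈ Metric.ball D.γ₀ ε, ∃ v u c, D.IsSol (T := T) v u c ∧ c 0 = γ₁ ∧
      (∀ t ∈ Icc 0 T, c t ∈ Metric.ball D.γ₀ D.ρ)) ∧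
    ∃ C : ℝ, 0 ≤ C ∧ ∀ v u c v' u' c', D.IsSol (T := T) v u c → D.IsSol (T := T) v' u' c' →
      c 0 ∈ Metric.ball D.γ₀ ε → c' 0 ∈ Metric.ball D.γ₀ ε →
      ‖v - v'‖ ≤ C * ‖c 0 - c' 0‖ ∧ ‖u - u'‖ ≤ C * ‖c 0 - c' 0‖ := by
  have hK := D.K_nonneg
  have hM := D.M_nonneg
  set nB := ‖(D.B.symm : X₁ →L[ℝ] X₃)‖ with hnB
  have hnB0 : 0 ≤ nB := norm_nonneg _
  set k := 4 * D.K + 4 * nB * D.K + 1 with hk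
  have hk1 : 0 < k := by positivity
  set δ := min (D.ρ / 4) (1 / (32 * (D.M + 1))) with hδ
  have hδ0 : 0 < δ := lt_min (by have := D.ρ_pos; linarith) (by positivity)
  have hδρ : 2 * δ < D.ρ := by
    have := min_le_left (D.ρ / 4) (1 / (32 * (D.M + 1)))
    have := D.ρ_pos
    linarith
  have hMδ : D.M * δ ≤ 1 / 32 := by
    have h1 : δ ≤ 1 / (32 * (D.M + 1)) := min_le_right _ _
    rw [le_div_iff₀ (by positivity)] at h1
    nlinarith
  set r := δ / k with hr
  have hr0 : 0 < r := div_pos hδ0 hk1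
  have hδr : δ = k * r := by rw [hr]; field_simp
  have hrδ : r ≤ δ := by
    rw [hδr]
    nlinarith [mul_nonneg hnB0 hK]
  -- The approximation `ξ` is fixed before the existence time: nothing controls its `X₃` norm in
  -- terms of `r`, and the time has to be short relative to it.
  obtain ⟨x, hx⟩ := Metric.denseRange_iff.1 D.denseRange_r D.γ₀ r hr0
  set ξ := D.B.symm x with hξdef
  have hξ : ‖D.ι₃ ξ - D.γ₀‖ < r := by rw [dist_comm, dist_eq_norm] at hx; exact hx
  set m := ‖D.B ξ‖ + ‖ξ‖ + ‖D.rhs (D.ι₃ ξ) ξ‖ + 1 with hm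
  have hm0 : 0 < m := by positivity
  -- The existence time will be `τ ^ 2`, so that `√T = τ`. The first bound yields the contraction
  -- and the second makes the constant solution small.
  set τ := min (1 / (32 * (D.M + 1))) (r / (2 * m)) with hτ
  have hτ0 : 0 < τ := lt_min (by positivity) (by positivity)
  have hsqrt : √(τ ^ 2) = τ := Real.sqrt_sq hτ0.le
  have hMτ : D.M * τ ≤ 1 / 32 := by
    have h1 : τ ≤ 1 / (32 * (D.M + 1)) := min_le_left _ _
    rw [le_div_iff₀ (by positivity)] at h1
    nlinarith
  have hτm : τ * m ≤ r / 2 := by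
    have h1 : τ ≤ r / (2 * m) := min_le_right _ _
    rw [le_div_iff₀ (by positivity)] at h1
    linarith
  have hT : 0 ≤ τ ^ 2 := by positivity
  have n1 := norm_nonneg (D.B ξ)
  have n2 := norm_nonneg ξ
  have n3 := norm_nonneg (D.rhs (D.ι₃ ξ) ξ)
  have ex : ∀ γ₁ ∈ Metric.ball D.γ₀ r, ∃ v u c, D.IsSol (T := τ ^ 2) v u c ∧ c 0 = γ₁ ∧
      (∀ t ∈ Icc 0 (τ ^ 2), ‖c t - D.γ₀‖ ≤ δ) ∧ ‖u‖ ≤ δ := by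
    intro γ₁ hγ₁
    rw [Metric.mem_ball, dist_eq_norm] at hγ₁
    refine exists_isSol hT hr0 hδr (by linarith) ?_ ξ hξ ?_ ?_ ?_ hγ₁ <;> rw [hsqrt] <;> nlinarith
  have hsmall : D.M * (√(τ ^ 2) + 2 * δ) ≤ 1 / 2 := by rw [hsqrt]; linarith
  refine ⟨τ ^ 2, by positivity, r, hr0, by linarith, fun γ₁ hγ₁ => ?_,
    2 * D.K + nB * (2 * D.K), by positivity, ?_⟩
  · obtain ⟨v, u, c, h, h0, hc, -⟩ := ex γ₁ hγ₁
    refine ⟨v, u, c, h, h0, fun t ht => ?_⟩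
    rw [Metric.mem_ball, dist_eq_norm]
    linarith [hc t ht]
  · intro v u c v' u' c' h h' h0 h0'
    obtain ⟨w, z, d, s, s0, sc, sz⟩ := ex _ h0
    obtain ⟨w', z', d', s', s0', sc', sz'⟩ := ex _ h0'
    -- Arbitrary solutions are identified with the constructed ones, which are known to stay near
    -- `γ₀`.
    obtain ⟨rfl, rfl, -⟩ := h.eq_of_close hT hδ0 hδρ hsmall s s0.symm sc sz
    obtain ⟨rfl, rfl, -⟩ := h'.eq_of_close hT hδ0 hδρ hsmall s' s0'.symm sc' sz'
    obtain ⟨b1, b2⟩ := s.dist_le_of_close hT hδ0 hδρ hsmall s' sc sc' sz'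
    rw [s0, s0'] at b1 b2
    have p1 : 0 ≤ nB * (2 * D.K) * ‖c 0 - c' 0‖ := by positivity
    have p2 : 0 ≤ 2 * D.K * ‖c 0 - c' 0‖ := by positivity
    rw [add_mul]
    refine ⟨b1.trans (le_add_of_nonneg_right p1), b2.trans ?_⟩
    rw [mul_assoc nB]
    exact le_add_of_nonneg_left p2

end QuasilinearData

/-! ### Weakly differentiable functions on the circle -/

section Circle

variable {Y Z W : Type*} [NormedAddCommGroup Y] [NormedSpace ℝ Y]
  [NormedAddCommGroup Z] [NormedSpace ℝ Z] [NormedAddCommGroup W] [NormedSpace ℝ W]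

/-- The line is a countable union of unit intervals, each of which projects to the circle preserving
measure. -/
theorem ae_real_of_ae_circ {p : Circ → Prop} (h : ∀ᵐ x : Circ, p x) : ∀ᵐ s : ℝ, p (s : Circ) := by
  have h1 : ∀ n : ℤ, ∀ᵐ (s : ℝ) ∂(volume.restrict (Ioc (n : ℝ) (n + 1))), p (s : Circ) := fun n =>
    (UnitAddCircle.measurePreserving_mk (n : ℝ)).quasiMeasurePreserving.ae h
  have h2 : (⋃ n : ℤ, Ioc (n : ℝ) (n + 1)) = univ := iUnion_Ioc_intCast ℝ
  rw [← Measure.restrict_univ (μ := (volume : Measure ℝ)), ← h2]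
  exact (ae_restrict_iUnion_iff _ _).2 h1

theorem periodic_lift (f : Circ → Y) : Function.Periodic (fun s : ℝ => f (s : Circ)) 1 := by
  intro s
  simp only
  congr 1
  exact AddCircle.coe_add_period 1 s

theorem intervalIntegrable_lift {f : Circ → Y} (hf : Integrable f) (a b : ℝ) :
    IntervalIntegrable (fun s : ℝ => f (s : Circ)) volume a b := by
  refine (periodic_lift f).intervalIntegrable₀ one_ne_zero ?_ a b
  rw [intervalIntegrable_iff_integrableOn_Ioc_of_le zero_le_one]
  have h1 : MeasurePreserving (fun s : ℝ => (s : Circ)) (volume.restrict (Ioc 0 (0 + 1))) volume :=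
    UnitAddCircle.measurePreserving_mk 0
  rw [zero_add] at h1
  exact (h1.integrable_comp hf.aestronglyMeasurable).2 hf

theorem integral_circ (f : Circ → Y) (a : ℝ) : ∫ x, f x = ∫ s in a..(a + 1), f (s : Circ) :=
  (UnitAddCircle.intervalIntegral_preimage a f).symm

theorem continuous_of_lift {X : Type*} [TopologicalSpace X] {f : Circ → X}
    (h : Continuous (fun s : ℝ => f (s : Circ))) : Continuous f :=
  (QuotientAddGroup.isQuotientMap_mk (N := AddSubgroup.zmultiples (1 : ℝ))).continuous_iff.2 h

theorem continuous_coe_circ : Continuous (fun s : ℝ => (s : Circ)) := AddCircle.continuous_mk' 1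

theorem memLp_of_continuous {f : Circ → Y} (hf : Continuous f) : MemLp f 2 volume := by
  obtain ⟨C, hC⟩ := isCompact_univ.exists_bound_of_continuousOn hf.continuousOn
  exact MemLp.of_bound hf.aestronglyMeasurable C (ae_of_all _ fun x => hC x (mem_univ x))

/-- `U` is a primitive of the square integrable function `U'` on the circle. -/
structure HasL2Deriv (U U' : Circ → Y) : Prop where
  memLp : MemLp U' 2 volume
  eq : ∀ a b : ℝ, U b - U a = ∫ s in a..b, U' (s : Circ)

namespace HasL2Deriv

variable {U U' : Circ → Y} {V V' : Circ → Z}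

theorem intervalIntegrable (h : HasL2Deriv U U') (a b : ℝ) :
    IntervalIntegrable (fun s : ℝ => U' (s : Circ)) volume a b :=
  intervalIntegrable_lift (h.memLp.integrable (by norm_num)) a b

theorem continuous (h : HasL2Deriv U U') : Continuous U := by
  refine continuous_of_lift ?_
  have h1 : (fun s : ℝ => U (s : Circ)) =
      fun s => U (0 : ℝ) + ∫ r in (0 : ℝ)..s, U' (r : Circ) := by
    funext s
    rw [← h.eq, add_sub_cancel]
  rw [h1]
  exact continuous_const.add (intervalIntegral.continuous_primitive h.intervalIntegrable 0)

theorem memLp_self (h : HasL2Deriv U U') : MemLp U 2 volume := memLp_of_continuous h.continuous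

theorem ac (h : HasL2Deriv U U') (a b : ℝ) :
    AbsolutelyContinuousOnInterval (fun s : ℝ => U (s : Circ)) a b := by
  refine absolutelyContinuousOnInterval_of_dist_le (K := 1)
    (absolutelyContinuousOnInterval_integral (c := 0) (a := a) (b := b) h.intervalIntegrable)
    fun x _ y _ => ?_
  rw [dist_eq_norm, dist_eq_norm, one_mul, ← h.eq, ← h.eq, sub_sub_sub_cancel_right]

theorem ae_hasDerivAt [CompleteSpace Y] (h : HasL2Deriv U U') :
    ∀ᵐ s : ℝ, HasDerivAt (fun s : ℝ => U (s : Circ)) (U' (s : Circ)) s := by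
  have h1 : ∀ n : ℕ, ∀ᵐ s : ℝ, s ∈ Ioo (-(n : ℝ)) n →
      HasDerivAt (fun s : ℝ => U (s : Circ)) (U' (s : Circ)) s := by
    intro n
    filter_upwards [(h.intervalIntegrable (-(n : ℝ)) n).ae_hasDerivAt_integral] with s hs hsn
    have hn : -(n : ℝ) ≤ n := (hsn.1.trans hsn.2).le
    have h2 := hs (by rw [uIcc_of_le hn]; exact Ioo_subset_Icc_self hsn) (-(n : ℝ)) (by simp)
    have h3 : (fun s : ℝ => U (s : Circ)) =
        fun s => U ((-(n : ℝ) : ℝ) : Circ) + ∫ r in (-(n : ℝ))..s, U' (r : Circ) := by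
      funext s
      rw [← h.eq, add_sub_cancel]
    rw [h3]
    exact h2.const_add _
  filter_upwards [ae_all_iff.2 h1] with s hs
  obtain ⟨n, hn⟩ := exists_nat_gt |s|
  exact hs n (abs_lt.1 hn)

theorem of_ac [CompleteSpace Y] (hm : MemLp U' 2 volume)
    (hac : ∀ a b, AbsolutelyContinuousOnInterval (fun s : ℝ => U (s : Circ)) a b)
    (hd : ∀ᵐ s : ℝ, HasDerivAt (fun s : ℝ => U (s : Circ)) (U' (s : Circ)) s) :
    HasL2Deriv U U' :=
  ⟨hm, fun a b => (integral_eq_sub_of_absolutelyContinuous (hac a b)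
    (intervalIntegrable_lift (hm.integrable (by norm_num)))
    (by filter_upwards [hd] with s hs _ using hs)).symm⟩

theorem congr_ae {U'' : Circ → Y} (h : HasL2Deriv U U') (he : U' =ᵐ[volume] U'') :
    HasL2Deriv U U'' :=
  ⟨h.memLp.ae_eq he, fun a b => by
    rw [h.eq]
    refine intervalIntegral.integral_congr_ae ?_
    filter_upwards [ae_real_of_ae_circ he] with s hs _ using hs⟩

theorem add (h : HasL2Deriv U U') {V V' : Circ → Y} (k : HasL2Deriv V V') :
    HasL2Deriv (fun x => U x + V x) (fun x => U' x + V' x) :=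
  ⟨h.memLp.add k.memLp, fun a b => by
    rw [intervalIntegral.integral_add (h.intervalIntegrable a b) (k.intervalIntegrable a b),
      ← h.eq, ← k.eq]
    abel⟩

theorem clm [CompleteSpace Y] [CompleteSpace Z] (A : Y →L[ℝ] Z) (h : HasL2Deriv U U') :
    HasL2Deriv (fun x => A (U x)) (fun x => A (U' x)) :=
  ⟨A.comp_memLp' h.memLp, fun a b => by
    rw [← map_sub, h.eq, A.intervalIntegral_comp_comm (h.intervalIntegrable a b)]⟩

theorem sub (h : HasL2Deriv U U') {V V' : Circ → Y} (k : HasL2Deriv V V') :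
    HasL2Deriv (fun x => U x - V x) (fun x => U' x - V' x) :=
  ⟨h.memLp.sub k.memLp, fun a b => by
    rw [intervalIntegral.integral_sub (h.intervalIntegrable a b) (k.intervalIntegrable a b),
      ← h.eq, ← k.eq]
    abel⟩

theorem const (y : Y) : HasL2Deriv (fun _ => y) (fun _ => 0) :=
  ⟨MemLp.zero, fun a b => by simp⟩

/-- Both factors are bounded, so increments of the product are dominated by those of a primitive of
`‖U'‖ + ‖V'‖`, which gives absolute continuity; the pointwise product rule identifies the
derivative. This is the algebra property of `H¹` in one dimension. -/
theorem bilin [CompleteSpace W] [CompleteSpace Y] [CompleteSpace Z] (B : Y →L[ℝ] Z →L[ℝ] W)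
    (h : HasL2Deriv U U') (k : HasL2Deriv V V') :
    HasL2Deriv (fun x => B (U x) (V x)) (fun x => B (U' x) (V x) + B (U x) (V' x)) := by
  obtain ⟨C, hC⟩ := isCompact_univ.exists_bound_of_continuousOn h.continuous.continuousOn
  obtain ⟨C', hC'⟩ := isCompact_univ.exists_bound_of_continuousOn k.continuous.continuousOn
  have hCU : ∀ x, ‖U x‖ ≤ |C| := fun x => (hC x (mem_univ _)).trans (le_abs_self _)
  have hCV : ∀ x, ‖V x‖ ≤ |C'| := fun x => (hC' x (mem_univ _)).trans (le_abs_self _)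
  refine of_ac (MemLp.add ?_ ?_) (fun a b => ?_) ?_
  · refine MemLp.of_le_mul (c := ‖B‖ * |C'|) h.memLp (B.aestronglyMeasurable_comp₂ h.memLp.1
      k.continuous.aestronglyMeasurable) (ae_of_all _ fun x => ?_)
    calc ‖B (U' x) (V x)‖ ≤ ‖B‖ * ‖U' x‖ * ‖V x‖ := B.le_opNorm₂ _ _
      _ ≤ ‖B‖ * ‖U' x‖ * |C'| := by gcongr; exact hCV x
      _ = _ := by ring
  · refine MemLp.of_le_mul (c := ‖B‖ * |C|) k.memLp (B.aestronglyMeasurable_comp₂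
      h.continuous.aestronglyMeasurable k.memLp.1) (ae_of_all _ fun x => ?_)
    calc ‖B (U x) (V' x)‖ ≤ ‖B‖ * ‖U x‖ * ‖V' x‖ := B.le_opNorm₂ _ _
      _ ≤ ‖B‖ * |C| * ‖V' x‖ := by gcongr; exact hCU x
  · have hp : AbsolutelyContinuousOnInterval
        (fun s => ∫ r in a..s, (‖U' (r : Circ)‖ + ‖V' (r : Circ)‖)) a b :=
      absolutelyContinuousOnInterval_integral (c := a) fun x y =>
        (h.intervalIntegrable x y).norm.add (k.intervalIntegrable x y).norm
    refine absolutelyContinuousOnInterval_of_dist_le (K := ‖B‖ * (|C| + |C'|)) hp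
      fun x _ y _ => ?_
    have e : B (U x) (V x) - B (U y) (V y) =
        B (U x - U y) (V x) + B (U y) (V x - V y) := by
      simp only [map_sub, sub_apply]
      abel
    have i1 := fun x y => (h.intervalIntegrable x y).norm
    have i2 := fun x y => (k.intervalIntegrable x y).norm
    have hi : ∀ x y, IntervalIntegrable (fun r : ℝ => ‖U' (r : Circ)‖ + ‖V' (r : Circ)‖)
      volume x y := fun x y => (i1 x y).add (i2 x y)
    rw [dist_eq_norm, dist_eq_norm, e,
      intervalIntegral.integral_interval_sub_left (hi _ _) (hi _ _)]
    set I := ‖∫ r in y..x, (‖U' (r : Circ)‖ + ‖V' (r : Circ)‖)‖ with hI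
    have h1 : ‖U x - U y‖ ≤ I := by
      rw [h.eq]
      refine intervalIntegral.norm_integral_le_abs_of_norm_le (ae_of_all _ fun r => ?_) (hi _ _)
      linarith [norm_nonneg (V' (r : Circ))]
    have h2 : ‖V x - V y‖ ≤ I := by
      rw [k.eq]
      refine intervalIntegral.norm_integral_le_abs_of_norm_le (ae_of_all _ fun r => ?_) (hi _ _)
      linarith [norm_nonneg (U' (r : Circ))]
    calc ‖B (U x - U y) (V x) + B (U y) (V x - V y)‖
        ≤ ‖B‖ * ‖U x - U y‖ * ‖V x‖ + ‖B‖ * ‖U y‖ * ‖V x - V y‖ :=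
          (norm_add_le _ _).trans (add_le_add (B.le_opNorm₂ _ _) (B.le_opNorm₂ _ _))
      _ ≤ ‖B‖ * I * |C'| + ‖B‖ * |C| * I := by
          gcongr
          · exact hCV x
          · exact hCU y
      _ = _ := by ring
  · filter_upwards [h.ae_hasDerivAt, k.ae_hasDerivAt] with s h1 h2
    have h3 := (B.hasFDerivAt_of_bilinear h1.hasFDerivAt h2.hasFDerivAt).hasDerivAt
    convert h3 using 1
    simp [add_comm]

/-- Differentiability of `φ` is needed only on an interval containing the values of `U`, which
admits reciprocals and inverse square roots of functions bounded away from zero. -/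
theorem comp_real {U U' : Circ → ℝ} (h : HasL2Deriv U U') {φ φ' : ℝ → ℝ} {a b : ℝ}
    (hφ : ∀ y ∈ Icc a b, HasDerivAt φ (φ' y) y) (hφ' : ContinuousOn φ' (Icc a b))
    (hU : ∀ x, U x ∈ Icc a b) :
    HasL2Deriv (fun x => φ (U x)) (fun x => φ' (U x) * U' x) := by
  obtain ⟨C, hC⟩ := isCompact_Icc.exists_bound_of_continuousOn hφ'
  have hC0 : 0 ≤ C := (norm_nonneg _).trans (hC _ (hU 0))
  refine of_ac ?_ (fun c d => ?_) ?_
  · refine MemLp.of_le_mul (c := C) h.memLp (((hφ'.comp_continuous h.continuous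
      hU).aestronglyMeasurable).mul h.memLp.1) (ae_of_all _ fun x => ?_)
    rw [norm_mul]
    gcongr
    exact hC _ (hU x)
  · refine absolutelyContinuousOnInterval_of_dist_le (K := C) (h.ac c d) fun x _ y _ => ?_
    rw [dist_eq_norm, dist_eq_norm]
    exact (convex_Icc a b).norm_image_sub_le_of_norm_hasDerivWithin_le
      (fun z hz => (hφ z hz).hasDerivWithinAt) hC (hU _) (hU _)
  · filter_upwards [h.ae_hasDerivAt] with s hs
    exact (hφ _ (hU s)).comp s hs

theorem integral_eq_zero (h : HasL2Deriv U U') : ∫ x, U' x = 0 := by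
  rw [integral_circ U' 0, ← h.eq]
  have : ((0 + 1 : ℝ) : Circ) = ((0 : ℝ) : Circ) := AddCircle.coe_add_period 1 0
  rw [this, sub_self]

theorem of_hasDerivAt {φ φ' : Circ → Y} [CompleteSpace Y] (hc : Continuous φ')
    (hd : ∀ s : ℝ, HasDerivAt (fun r : ℝ => φ (r : Circ)) (φ' (s : Circ)) s) :
    HasL2Deriv φ φ' :=
  ⟨memLp_of_continuous hc, fun a b =>
    (intervalIntegral.integral_eq_sub_of_hasDerivAt (fun x _ => hd x)
      ((hc.comp continuous_coe_circ).intervalIntegrable a b)).symm⟩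

theorem smul [CompleteSpace Y] {V V' : Circ → ℝ} (k : HasL2Deriv V V') (h : HasL2Deriv U U') :
    HasL2Deriv (fun x => V x • U x) (fun x => V' x • U x + V x • U' x) :=
  bilin (ContinuousLinearMap.lsmul ℝ ℝ) k h

theorem mul {U U' V V' : Circ → ℝ} (k : HasL2Deriv V V') (h : HasL2Deriv U U') :
    HasL2Deriv (fun x => V x * U x) (fun x => V' x * U x + V x * U' x) :=
  bilin (ContinuousLinearMap.mul ℝ ℝ) k h

theorem inner {U U' V V' : Circ → Plane} (k : HasL2Deriv V V') (h : HasL2Deriv U U') :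
    HasL2Deriv (fun x => inner ℝ (V x) (U x))
      (fun x => inner ℝ (V' x) (U x) + inner ℝ (V x) (U' x)) :=
  bilin (innerSL ℝ) k h

theorem eq_of_ae_eq {V V' : Circ → Y} (h : HasL2Deriv U U') (k : HasL2Deriv V V')
    (he : U =ᵐ[volume] V) : U = V :=
  (h.continuous.ae_eq_iff_eq volume k.continuous).1 he

theorem norm_sub_le (h : HasL2Deriv U U') (x y : Circ) : ‖U x - U y‖ ≤ ∫ z, ‖U' z‖ := by
  induction x using QuotientAddGroup.induction_on with | H a =>
  -- The second point is lifted to the period ending at `a`, so the integral between the lifts is at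
  -- most the integral over the whole circle.
  obtain ⟨b, hb, rfl⟩ : ∃ b : ℝ, b ∈ Ioc (a - 1) a ∧ (b : Circ) = y := by
    have := (AddCircle.coe_image_Ioc_eq (1 : ℝ) (a - 1))
    rw [sub_add_cancel] at this
    have hy : y ∈ ((fun s : ℝ => (s : Circ)) '' Ioc (a - 1) a) := by rw [this]; exact mem_univ y
    obtain ⟨b, hb, h⟩ := hy
    exact ⟨b, hb, h⟩
  have hn := h.memLp.norm.integrable (by norm_num : (1 : ENNReal) ≤ 2)
  rw [h.eq b a, integral_circ _ (a - 1), sub_add_cancel]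
  refine (intervalIntegral.norm_integral_le_integral_norm hb.2).trans ?_
  refine intervalIntegral.integral_mono_interval hb.1.le hb.2 le_rfl
    (ae_of_all _ fun _ => norm_nonneg _) (intervalIntegrable_lift hn _ _)

end HasL2Deriv

end Circle

/-! ### Weak derivatives and the spaces `H^k` -/

theorem integrable_smul_circ (φ : C(Circ, ℝ)) {f : Circ → Plane} (hf : Integrable f) :
    Integrable (fun x => φ x • f x) := by
  refine Integrable.mono' (hf.norm.const_mul ‖φ‖)
    (φ.continuous.aestronglyMeasurable.smul hf.1) (ae_of_all _ fun x => ?_)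
  rw [norm_smul]
  exact mul_le_mul_of_nonneg_right (φ.norm_coe_le_norm x) (norm_nonneg _)

theorem integrable_L2 (w : L2) : Integrable w := (Lp.memLp w).integrable (by norm_num)

theorem HasL2Deriv.hasWeakDeriv {U U' : Circ → Plane} (h : HasL2Deriv U U') {u v : L2}
    (hu : u =ᵐ[volume] U) (hv : v =ᵐ[volume] U') : HasWeakDeriv u v := by
  intro φ φ' _ hd
  have h1 : HasL2Deriv φ φ' := HasL2Deriv.of_hasDerivAt φ'.continuous hd
  have h2 := (h1.smul h).integral_eq_zero
  have i1 : Integrable (fun x => φ' x • U x) :=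
    (φ'.continuous.smul h.continuous).integrable_of_hasCompactSupport
      (HasCompactSupport.of_compactSpace _)
  have hU' : Integrable U' := h.memLp.integrable (by norm_num)
  have i2 : Integrable (fun x => φ x • U' x) := integrable_smul_circ φ hU'
  rw [integral_add i1 i2] at h2
  have e1 : ∫ x, φ' x • u x = ∫ x, φ' x • U x :=
    integral_congr_ae (by filter_upwards [hu] with x hx; rw [hx])
  have e2 : ∫ x, φ x • v x = ∫ x, φ x • U' x :=
    integral_congr_ae (by filter_upwards [hv] with x hx; rw [hx])
  rw [e1, e2]
  exact eq_neg_of_add_eq_zero_left h2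

/-- The real part of the character `x ↦ exp (2 π i n x)`. -/
def cosMode (n : ℤ) : C(Circ, ℝ) := ⟨fun x => (fourier n x).re, by fun_prop⟩

/-- The imaginary part of the character `x ↦ exp (2 π i n x)`. -/
def sinMode (n : ℤ) : C(Circ, ℝ) := ⟨fun x => (fourier n x).im, by fun_prop⟩

theorem contDiff_fourier (n : ℤ) : ContDiff ℝ ∞ (fun s : ℝ => (fourier n (s : Circ) : ℂ)) := by
  have : (fun s : ℝ => (fourier n (s : Circ) : ℂ)) =
      fun s : ℝ => Complex.exp (2 * Real.pi * Complex.I * n * s / (1 : ℝ)) := by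
    funext s
    exact fourier_coe_apply
  rw [this]
  have h : ContDiff ℝ ∞ (fun s : ℝ => (s : ℂ)) := Complex.ofRealCLM.contDiff
  fun_prop

theorem contDiff_cosMode (n : ℤ) : ContDiff ℝ ∞ (fun s : ℝ => cosMode n (s : Circ)) :=
  Complex.reCLM.contDiff.comp (contDiff_fourier n)

theorem contDiff_sinMode (n : ℤ) : ContDiff ℝ ∞ (fun s : ℝ => sinMode n (s : Circ)) :=
  Complex.imCLM.contDiff.comp (contDiff_fourier n)

theorem hasDerivAt_cosMode (n : ℤ) (s : ℝ) :
    HasDerivAt (fun r : ℝ => cosMode n (r : Circ)) ((-(2 * Real.pi * n) • sinMode n) (s : Circ))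
      s := by
  have h := Complex.reCLM.hasFDerivAt.comp_hasDerivAt s (hasDerivAt_fourier 1 n s)
  have e : ∀ z : ℂ, ((2 * Real.pi * Complex.I * n / (1 : ℝ) * z : ℂ)).re =
      -(2 * Real.pi * n) * z.im := fun z => by
    simp [Complex.mul_re, Complex.mul_im]
  exact h.congr_deriv (e _)

theorem hasDerivAt_sinMode (n : ℤ) (s : ℝ) :
    HasDerivAt (fun r : ℝ => sinMode n (r : Circ)) (((2 * Real.pi * n) • cosMode n) (s : Circ))
      s := by
  have h := Complex.imCLM.hasFDerivAt.comp_hasDerivAt s (hasDerivAt_fourier 1 n s)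
  have e : ∀ z : ℂ, ((2 * Real.pi * Complex.I * n / (1 : ℝ) * z : ℂ)).im =
      (2 * Real.pi * n) * z.re := fun z => by
    simp [Complex.mul_re, Complex.mul_im]
  exact h.congr_deriv (e _)

theorem integrable_smul_L2 (φ : C(Circ, ℝ)) (w : L2) : Integrable (fun x => φ x • w x) :=
  integrable_smul_circ φ (integrable_L2 w)

/-- The cosine and sine moments assemble to the complex Fourier coefficients of each component, and
the Fourier basis is complete. -/
theorem eq_zero_of_modes (w : L2)
    (h : ∀ n : ℤ, ∫ x, cosMode n x • w x = 0 ∧ ∫ x, sinMode n x • w x = 0) : w = 0 := by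
  have comp : ∀ i : Fin 2, ∀ᵐ x, w x i = 0 := by
    intro i
    set A : Plane →L[ℝ] ℂ := Complex.ofRealCLM.comp (EuclideanSpace.proj i) with hA
    have hAx : ∀ x, A (w x) = ((w x i : ℝ) : ℂ) := fun x => rfl
    have hm : MemLp (fun x => A (w x)) 2 (volume : Measure Circ) := A.comp_memLp' (Lp.memLp w)
    have hm' : MemLp (fun x => A (w x)) 2 (AddCircle.haarAddCircle (T := (1 : ℝ))) :=
      memLp_haarAddCircle_iff.2 hm
    set F : Lp ℂ 2 (AddCircle.haarAddCircle (T := (1 : ℝ))) := hm'.toLp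
    have hF : F = 0 := by
      rw [← fourierBasis.repr.map_eq_zero_iff]
      ext n
      rw [fourierBasis_repr, fourierCoeff_congr_ae hm'.coeFn_toLp, fourierCoeff,
        AddCircle.integral_haarAddCircle]
      have e : ∫ t : AddCircle (1 : ℝ), fourier (-n) t • A (w t) =
          A (∫ x, cosMode (-n) x • w x) + Complex.I * A (∫ x, sinMode (-n) x • w x) := by
        rw [← A.integral_comp_comm (integrable_smul_L2 _ w),
          ← A.integral_comp_comm (integrable_smul_L2 _ w), ← integral_const_mul,
          ← integral_add (A.integrable_comp (integrable_smul_L2 _ w))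
          ((A.integrable_comp (integrable_smul_L2 _ w)).const_mul _)]
        refine integral_congr_ae (ae_of_all _ fun x => ?_)
        simp only [map_smul, smul_eq_mul, cosMode, sinMode, ContinuousMap.coe_mk,
          Complex.real_smul]
        conv_lhs => rw [← Complex.re_add_im (fourier (-n) x)]
        ring
      rw [e, (h (-n)).1, (h (-n)).2]
      simp
    have hF2 := (Lp.eq_zero_iff_ae_eq_zero (f := F)).1 hF
    have hF3 : ∀ᵐ x ∂(AddCircle.haarAddCircle (T := (1 : ℝ))), A (w x) = 0 := by
      filter_upwards [hF2, hm'.coeFn_toLp] with x h1 h2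
      rw [← h2]; exact h1
    have hv : (volume : Measure Circ) = ENNReal.ofReal 1 • AddCircle.haarAddCircle :=
      AddCircle.volume_eq_smul_haarAddCircle
    rw [ENNReal.ofReal_one, one_smul] at hv
    have hF4 : ∀ᵐ x : Circ, A (w x) = 0 := by
      have := hF3
      rwa [← hv] at this
    filter_upwards [hF4] with x hx
    rw [hAx] at hx
    exact_mod_cast hx
  refine (Lp.eq_zero_iff_ae_eq_zero).2 ?_
  filter_upwards [comp 0, comp 1] with x h0 h1
  ext i
  fin_cases i
  · exact h0
  · exact h1

theorem integral_smul_sub (φ : C(Circ, ℝ)) (u v : L2) :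
    ∫ x, φ x • (u - v) x = (∫ x, φ x • u x) - ∫ x, φ x • v x := by
  rw [← integral_sub (integrable_smul_L2 φ u) (integrable_smul_L2 φ v)]
  refine integral_congr_ae ?_
  filter_upwards [Lp.coeFn_sub u v] with x hx
  rw [hx, Pi.sub_apply, smul_sub]

theorem HasWeakDeriv.unique {u v w : L2} (hv : HasWeakDeriv u v) (hw : HasWeakDeriv u w) :
    v = w := by
  refine sub_eq_zero.1 (eq_zero_of_modes _ fun n => ⟨?_, ?_⟩)
  · have h1 := hv _ _ (contDiff_cosMode n) (hasDerivAt_cosMode n)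
    have h2 := hw _ _ (contDiff_cosMode n) (hasDerivAt_cosMode n)
    rw [integral_smul_sub, ← neg_inj, neg_sub, neg_zero, sub_eq_zero]
    rw [h1] at h2
    exact (neg_inj.1 h2).symm
  · have h1 := hv _ _ (contDiff_sinMode n) (hasDerivAt_sinMode n)
    have h2 := hw _ _ (contDiff_sinMode n) (hasDerivAt_sinMode n)
    rw [integral_smul_sub, ← neg_inj, neg_sub, neg_zero, sub_eq_zero]
    rw [h1] at h2
    exact (neg_inj.1 h2).symm

/-- Each nonconstant mode is a multiple of the derivative of another mode, hence integrates to zero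
both alone and against `w`. Only the zero mode survives, and it gives the mean. -/
theorem eq_const_of_weakDeriv_zero {w : L2} (h : HasWeakDeriv w 0) :
    w = Lp.const 2 volume (∫ x, w x) := by
  have hz : ∀ φ : C(Circ, ℝ), ∫ x, φ x • (0 : L2) x = 0 := by
    intro φ
    rw [← integral_zero Circ Plane (μ := volume)]
    refine integral_congr_ae ?_
    filter_upwards [Lp.coeFn_zero Plane 2 (volume : Measure Circ)] with x hx
    rw [hx, Pi.zero_apply, smul_zero]
  have hc : ∀ (φ : C(Circ, ℝ)) (y : Plane),
      ∫ x, φ x • (Lp.const 2 (volume : Measure Circ) y) x = (∫ x, φ x) • y := by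
    intro φ y
    rw [← integral_smul_const]
    refine integral_congr_ae ?_
    filter_upwards [Lp.coeFn_const 2 (volume : Measure Circ) y] with x hx
    rw [hx, Function.const_apply]
  have mode : ∀ (ψ φ φ' : C(Circ, ℝ)) (k : ℝ), k ≠ 0 → φ' = k • ψ →
      ContDiff ℝ ∞ (fun s : ℝ => φ (s : Circ)) →
      (∀ s : ℝ, HasDerivAt (fun r : ℝ => φ (r : Circ)) (φ' (s : Circ)) s) →
      ∫ x, ψ x • w x = 0 ∧ ∫ x, ψ x = 0 := by
    intro ψ φ φ' k hk hφ' hs hd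
    have h1 := h φ φ' hs hd
    rw [hz, neg_zero] at h1
    have h2 := (HasL2Deriv.of_hasDerivAt (φ := φ) φ'.continuous hd).integral_eq_zero
    subst hφ'
    simp only [ContinuousMap.coe_smul, Pi.smul_apply, smul_assoc] at h1 h2
    rw [integral_smul, smul_eq_zero_iff_right hk] at h1 h2
    exact ⟨h1, h2⟩
  refine sub_eq_zero.1 (eq_zero_of_modes _ fun n => ?_)
  rw [integral_smul_sub, integral_smul_sub, hc, hc]
  by_cases hn : n = 0
  · subst hn
    have e1 : ∀ x, cosMode 0 x = 1 := fun x => by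
      show (fourier 0 x).re = 1
      rw [fourier_zero]; simp
    have e2 : ∀ x, sinMode 0 x = 0 := fun x => by
      show (fourier 0 x).im = 0
      rw [fourier_zero]; simp
    have e3 : (volume : Measure Circ).real univ = 1 := by simp [Measure.real]
    simp [e1, e2, e3]
  · have hk : (2 * Real.pi * n) ≠ 0 := by
      have := Real.pi_ne_zero
      have : (n : ℝ) ≠ 0 := by exact_mod_cast hn
      positivity
    obtain ⟨a1, a2⟩ := mode (cosMode n) (sinMode n) _ _ hk rfl (contDiff_sinMode n)
      (hasDerivAt_sinMode n)
    obtain ⟨b1, b2⟩ := mode (sinMode n) (cosMode n) _ _ (neg_ne_zero.2 hk) rfl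
      (contDiff_cosMode n) (hasDerivAt_cosMode n)
    rw [a1, a2, b1, b2]
    simp

/-- Vanishing of the mean is exactly periodicity of the primitive on the line. -/
theorem exists_primitive {v : L2} (hv : ∫ x, v x = 0) : ∃ U : Circ → Plane, HasL2Deriv U v := by
  have hi : Integrable v volume := (Lp.memLp v).integrable (by norm_num)
  set P : ℝ → Plane := fun s => ∫ r in (0 : ℝ)..s, v (r : Circ) with hP
  have hper : Function.Periodic P 1 := by
    intro s
    have h1 := intervalIntegral.integral_interval_sub_left
      (intervalIntegrable_lift hi 0 (s + 1)) (intervalIntegrable_lift hi 0 s)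
    rw [← integral_circ, hv] at h1
    exact sub_eq_zero.1 h1
  refine ⟨hper.lift, Lp.memLp v, fun a b => ?_⟩
  rw [hper.lift_coe, hper.lift_coe]
  exact intervalIntegral.integral_interval_sub_left
    (intervalIntegrable_lift hi 0 b) (intervalIntegrable_lift hi 0 a)

/-- Testing with the constant `1` shows that `v` has mean zero, so it has a periodic primitive; this
differs from `u` by a function with zero weak derivative. The result connects distributional
derivatives with the calculus of absolutely continuous functions. -/
theorem HasWeakDeriv.exists_hasL2Deriv {u v : L2} (h : HasWeakDeriv u v) :
    ∃ U, HasL2Deriv U v ∧ u =ᵐ[volume] U := by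
  have hmean : ∫ x, v x = 0 := by
    have h1 := h 1 0 (by simpa using contDiff_const) (fun s => by
      simpa using hasDerivAt_const s (1 : ℝ))
    simpa using h1.symm
  obtain ⟨U, hU⟩ := exists_primitive hmean
  set U2 : L2 := hU.memLp_self.toLp with hU2
  have hw : HasWeakDeriv (u - U2) 0 := by
    intro φ φ' h1 h2
    have a1 := h φ φ' h1 h2
    have a2 := hU.hasWeakDeriv (u := U2) (v := v) hU.memLp_self.coeFn_toLp (ae_eq_refl _) φ φ' h1 h2
    have a3 : ∫ x, φ x • (0 : L2) x = 0 := by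
      have := integral_smul_sub φ v v
      rwa [sub_self, sub_self] at this
    rw [integral_smul_sub, a1, a2, a3]
    simp
  have hc := eq_const_of_weakDeriv_zero hw
  set y := ∫ x, (u - U2) x
  refine ⟨fun x => U x + y, ⟨hU.memLp, fun a b => by rw [← hU.eq]; abel⟩, ?_⟩
  filter_upwards [Lp.coeFn_sub u U2, Lp.coeFn_const 2 (volume : Measure Circ) y,
    hU.memLp_self.coeFn_toLp] with x h1 h2 h3
  rw [hc, h2, Pi.sub_apply, Function.const_apply, h3] at h1
  rw [h1]
  abel

/-! ### Square integrable functions on the circle -/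

section L2Norm

variable {Y Z : Type*} [NormedAddCommGroup Y] [NormedAddCommGroup Z]

/-- The `L²` norm on the circle. -/
def l2 (f : Circ → Y) : ℝ := (eLpNorm f 2 volume).toReal

theorem l2_nonneg (f : Circ → Y) : 0 ≤ l2 f := ENNReal.toReal_nonneg

theorem l2_coe (u : Lp Y 2 (volume : Measure Circ)) : l2 u = ‖u‖ := (Lp.norm_def u).symm

theorem l2_toLp {f : Circ → Y} (hf : MemLp f 2 volume) : ‖hf.toLp f‖ = l2 f := Lp.norm_toLp f hf

theorem l2_congr {f g : Circ → Y} (h : f =ᵐ[volume] g) : l2 f = l2 g := by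
  rw [l2, l2, eLpNorm_congr_ae h]

theorem l2_le_of_ae {f : Circ → Y} {g : Circ → Z} {C : ℝ} (hC : 0 ≤ C) (hg : MemLp g 2 volume)
    (h : ∀ᵐ x, ‖f x‖ ≤ C * ‖g x‖) : l2 f ≤ C * l2 g := by
  have h1 := eLpNorm_le_mul_eLpNorm_of_ae_le_mul h 2
  have h2 := ENNReal.toReal_mono (ENNReal.mul_ne_top ENNReal.ofReal_ne_top hg.2.ne) h1
  rwa [ENNReal.toReal_mul, ENNReal.toReal_ofReal hC] at h2

theorem l2_le_of_bound {f : Circ → Y} {C : ℝ} (hC : 0 ≤ C) (h : ∀ᵐ x, ‖f x‖ ≤ C) : l2 f ≤ C := by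
  have h1 := eLpNorm_le_of_ae_bound (p := 2) h
  have h2 := ENNReal.toReal_mono (by simp) h1
  simpa [l2, hC] using h2

theorem l2_add_le {f g : Circ → Y} (hf : MemLp f 2 volume) (hg : MemLp g 2 volume) :
    l2 (fun x => f x + g x) ≤ l2 f + l2 g := by
  rw [l2, l2, l2, ← ENNReal.toReal_add hf.2.ne hg.2.ne]
  exact ENNReal.toReal_mono (ENNReal.add_ne_top.2 ⟨hf.2.ne, hg.2.ne⟩)
    (eLpNorm_add_le hf.1 hg.1 (by norm_num))

theorem l2_norm (f : Circ → Y) : l2 (fun x => ‖f x‖) = l2 f := by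
  rw [l2, l2, eLpNorm_norm]

theorem l2_sub_comm (f g : Circ → Y) : l2 (fun x => f x - g x) = l2 (fun x => g x - f x) := by
  rw [← l2_norm, ← l2_norm (fun x => g x - f x)]
  simp only [norm_sub_rev]

theorem volume_circ : (volume : Measure Circ) univ = 1 := by simp

instance isProbabilityMeasure_circ : IsProbabilityMeasure (volume : Measure Circ) :=
  ⟨volume_circ⟩

theorem integral_norm_le_l2 {f : Circ → Y} (hf : MemLp f 2 volume) : ∫ x, ‖f x‖ ≤ l2 f := by
  rw [integral_norm_eq_lintegral_enorm hf.1, ← eLpNorm_one_eq_lintegral_enorm]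
  exact ENNReal.toReal_mono hf.2.ne (eLpNorm_le_eLpNorm_of_exponent_le (by norm_num) hf.1)

variable [NormedSpace ℝ Y]

/-- The oscillation is bounded by the integral of `‖U'‖`, and averaging over the second point gives
the Sobolev embedding into bounded functions. -/
theorem HasL2Deriv.norm_le {U U' : Circ → Y} (h : HasL2Deriv U U') (x : Circ) :
    ‖U x‖ ≤ l2 U + l2 U' := by
  have h1 : ∀ y, ‖U x‖ ≤ ‖U y‖ + ∫ z, ‖U' z‖ := fun y => by
    have := h.norm_sub_le x y
    have h2 := norm_le_norm_add_norm_sub' (U x) (U y)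
    linarith
  have hi : Integrable (fun y => ‖U y‖) volume := (h.memLp_self.integrable (by norm_num)).norm
  have h2 : ∫ _ : Circ, ‖U x‖ ≤ ∫ y, (‖U y‖ + ∫ z, ‖U' z‖) :=
    integral_mono (integrable_const _) (hi.add (integrable_const _)) h1
  rw [integral_add hi (integrable_const _)] at h2
  simp only [integral_const, smul_eq_mul] at h2
  have h3 : (volume : Measure Circ).real univ = 1 := by simp [Measure.real]
  rw [h3, one_mul, one_mul] at h2
  exact h2.trans (add_le_add (integral_norm_le_l2 h.memLp_self) (integral_norm_le_l2 h.memLp))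

end L2Norm

/-! ### The spaces `H^k` -/

namespace H

variable {k : ℕ}

theorem weakDeriv (u : H k) (j : Fin k) : HasWeakDeriv (u.der j.castSucc) (u.der j.succ) := u.2 j

/-- The element of `H^k` with given derivatives. -/
def mk (w : Fin (k + 1) → L2) (h : ∀ j : Fin k, HasWeakDeriv (w j.castSucc) (w j.succ)) : H k :=
  ⟨WithLp.toLp 2 w, h⟩

theorem ext_der {u v : H k} (h : ∀ j, u.der j = v.der j) : u = v :=
  Subtype.ext (PiLp.ext h)

@[simp] theorem der_sub (u v : H k) (j : Fin (k + 1)) : (u - v).der j = u.der j - v.der j := rfl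
theorem norm_sq_eq (u : H k) : ‖u‖ ^ 2 = ∑ j, ‖u.der j‖ ^ 2 :=
  PiLp.norm_sq_eq_of_L2 _ (u : PiLp 2 (fun _ : Fin (k + 1) => L2))

theorem norm_der_le (u : H k) (j : Fin (k + 1)) : ‖u.der j‖ ≤ ‖u‖ :=
  PiLp.norm_apply_le (u : PiLp 2 (fun _ : Fin (k + 1) => L2)) j

theorem norm_le_sum (u : H k) : ‖u‖ ≤ ∑ j, ‖u.der j‖ := by
  refine abs_le_of_sq_le_sq' ?_ (by positivity) |>.2
  rw [norm_sq_eq]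
  exact Finset.sum_sq_le_sq_sum_of_nonneg fun _ _ => norm_nonneg _

theorem ext_toL2 {u v : H k} (h : u.toL2 = v.toL2) : u = v := by
  refine ext_der fun j => ?_
  induction j using Fin.induction with
  | zero => exact h
  | succ j ih =>
    have h1 := u.weakDeriv j
    rw [ih] at h1
    exact h1.unique (v.weakDeriv j)

theorem ext_toL2_ae {u v : H k} (h : u.toL2 =ᵐ[volume] v.toL2) : u = v := ext_toL2 (Lp.ext h)

theorem exists_rep (u : H k) (j : Fin k) :
    ∃ U, HasL2Deriv U (u.der j.succ) ∧ u.der j.castSucc =ᵐ[volume] U :=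
  (u.weakDeriv j).exists_hasL2Deriv

/-- The continuous representative of the `j`-th derivative, `j < k`. -/
def rep (u : H k) (j : Fin k) : Circ → Plane := (u.exists_rep j).choose

theorem hasL2Deriv_rep (u : H k) (j : Fin k) : HasL2Deriv (u.rep j) (u.der j.succ) :=
  (u.exists_rep j).choose_spec.1

theorem coeFn_rep (u : H k) (j : Fin k) : u.der j.castSucc =ᵐ[volume] u.rep j :=
  (u.exists_rep j).choose_spec.2

theorem rep_eq (u : H k) (j : Fin k) {U U' : Circ → Plane} (h : HasL2Deriv U U')
    (he : u.der j.castSucc =ᵐ[volume] U) : u.rep j = U :=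
  (u.hasL2Deriv_rep j).eq_of_ae_eq h ((u.coeFn_rep j).symm.trans he)

theorem rep_sub (u v : H k) (j : Fin k) : (u - v).rep j = fun x => u.rep j x - v.rep j x := by
  refine rep_eq _ _ ((u.hasL2Deriv_rep j).sub (v.hasL2Deriv_rep j)) ?_
  filter_upwards [Lp.coeFn_sub (u.der j.castSucc) (v.der j.castSucc), u.coeFn_rep j,
    v.coeFn_rep j] with x h1 h2 h3
  rw [der_sub, h1, Pi.sub_apply, h2, h3]

theorem norm_rep_le (u : H k) (j : Fin k) (x : Circ) : ‖u.rep j x‖ ≤ 2 * ‖u‖ := by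
  have h := (u.hasL2Deriv_rep j).norm_le x
  rw [← l2_congr (u.coeFn_rep j), l2_coe, l2_coe] at h
  linarith [u.norm_der_le j.castSucc, u.norm_der_le j.succ]

/-- The inclusion `H^{k+1} → H^k`. -/
def trunc (k : ℕ) : H (k + 1) →L[ℝ] H k :=
  LinearMap.mkContinuous
    { toFun := fun u => mk (fun j => u.der j.castSucc) (fun j => u.weakDeriv j.castSucc)
      map_add' _ _ := rfl
      map_smul' _ _ := rfl } 1 (fun u => by
      rw [one_mul]
      refine abs_le_of_sq_le_sq' ?_ (norm_nonneg _) |>.2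
      rw [norm_sq_eq, norm_sq_eq, Fin.sum_univ_castSucc (n := k + 1)]
      exact le_add_of_nonneg_right (by positivity))

/-- The derivative `H^{k+1} → H^k`. -/
def shift (k : ℕ) : H (k + 1) →L[ℝ] H k :=
  LinearMap.mkContinuous
    { toFun := fun u => mk (fun j => u.der j.succ) (fun j => u.weakDeriv j.succ)
      map_add' _ _ := rfl
      map_smul' _ _ := rfl } 1 (fun u => by
      rw [one_mul]
      refine abs_le_of_sq_le_sq' ?_ (norm_nonneg _) |>.2
      rw [norm_sq_eq, norm_sq_eq, Fin.sum_univ_succ (n := k + 1)]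
      exact le_add_of_nonneg_left (by positivity))

theorem trunc_injective : Function.Injective (trunc k) := fun _ _ h =>
  ext_toL2 (congrArg (fun w : H k => w.toL2) h)

/-- The element of `H¹` with continuous representative `U` and derivative `U'`. -/
def ofDeriv {U U' : Circ → Plane} (h : HasL2Deriv U U') : H 1 :=
  mk ![h.memLp_self.toLp, h.memLp.toLp] (fun j => by
    fin_cases j
    exact h.hasWeakDeriv h.memLp_self.coeFn_toLp h.memLp.coeFn_toLp)

theorem coeFn_ofDeriv {U U' : Circ → Plane} (h : HasL2Deriv U U') :
    (ofDeriv h).toL2 =ᵐ[volume] U := h.memLp_self.coeFn_toLp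

theorem coeFn_der_ofDeriv {U U' : Circ → Plane} (h : HasL2Deriv U U') :
    (ofDeriv h).der 1 =ᵐ[volume] U' := h.memLp.coeFn_toLp

theorem norm_ofDeriv_le {U U' : Circ → Plane} (h : HasL2Deriv U U') :
    ‖ofDeriv h‖ ≤ l2 U + l2 U' := by
  refine (norm_le_sum _).trans (le_of_eq ?_)
  rw [Fin.sum_univ_two, ← l2_toLp h.memLp_self, ← l2_toLp h.memLp]
  rfl

theorem ofDeriv_sub {U U' V V' : Circ → Plane} (h : HasL2Deriv U U') (k : HasL2Deriv V V') :
    ofDeriv h - ofDeriv k = ofDeriv (h.sub k) := by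
  refine ext_toL2_ae ?_
  filter_upwards [Lp.coeFn_sub (ofDeriv h).toL2 (ofDeriv k).toL2, coeFn_ofDeriv h,
    coeFn_ofDeriv k, coeFn_ofDeriv (h.sub k)] with x h1 h2 h3 h4
  rw [h4, ← h2, ← h3]
  exact h1

variable {a a' : Circ → ℝ}

/-- Multiplication by a scalar function as an operator in `H¹`. -/
def mulFun (h : HasL2Deriv a a') (u : H 1) : H 1 := ofDeriv (h.smul (u.hasL2Deriv_rep 0))

theorem toL2_mulFun (h : HasL2Deriv a a') (u : H 1) :
    ∀ᵐ x, (mulFun h u).toL2 x = a x • u.toL2 x := by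
  filter_upwards [coeFn_ofDeriv (h.smul (u.hasL2Deriv_rep 0)), u.coeFn_rep 0] with x h1 h2
  have h2' : u.toL2 x = u.rep 0 x := h2
  rw [mulFun, h1, h2']

/-- In the derivative `a' u + a u'` the first term is estimated with `u` in the supremum norm, so
that `a'` is needed only in `L²`. -/
theorem norm_mulFun_le (h : HasL2Deriv a a') {C : ℝ} (hC : ∀ x, |a x| ≤ C) (u : H 1) :
    ‖mulFun h u‖ ≤ (2 * C + 2 * l2 a') * ‖u‖ := by
  have hC0 : 0 ≤ C := (abs_nonneg _).trans (hC 0)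
  refine (norm_ofDeriv_le _).trans ?_
  have hu := u.hasL2Deriv_rep 0
  have h1 : l2 (fun x => a x • u.rep 0 x) ≤ C * ‖u‖ := by
    refine (l2_le_of_ae hC0 hu.memLp_self (ae_of_all _ fun x => ?_)).trans ?_
    · rw [norm_smul]; exact mul_le_mul_of_nonneg_right (hC x) (norm_nonneg _)
    · rw [← l2_congr (u.coeFn_rep 0), l2_coe]
      exact mul_le_mul_of_nonneg_left (u.norm_der_le _) hC0
  have b2 : ∀ x, ‖a x • u.der 1 x‖ ≤ C * ‖u.der 1 x‖ := fun x => by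
    rw [norm_smul]; exact mul_le_mul_of_nonneg_right (hC x) (norm_nonneg _)
  have b3 : ∀ x, ‖a' x • u.rep 0 x‖ ≤ 2 * ‖u‖ * ‖a' x‖ := fun x => by
    rw [norm_smul, mul_comm]; exact mul_le_mul_of_nonneg_right (u.norm_rep_le _ _) (norm_nonneg _)
  have m2 : MemLp (fun x => a x • u.der 1 x) 2 volume :=
    MemLp.of_le_mul (c := C) (Lp.memLp (u.der 1)) (h.continuous.aestronglyMeasurable.smul
      (Lp.aestronglyMeasurable _)) (ae_of_all _ b2)
  have m3 : MemLp (fun x => a' x • u.rep 0 x) 2 volume :=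
    MemLp.of_le_mul (c := 2 * ‖u‖) h.memLp (h.memLp.1.smul
      hu.continuous.aestronglyMeasurable) (ae_of_all _ b3)
  have h2 : l2 (fun x => a x • u.der 1 x) ≤ C * ‖u‖ := by
    refine (l2_le_of_ae hC0 (Lp.memLp (u.der 1)) (ae_of_all _ b2)).trans ?_
    rw [l2_coe]
    exact mul_le_mul_of_nonneg_left (u.norm_der_le _) hC0
  have h3 : l2 (fun x => a' x • u.rep 0 x) ≤ 2 * ‖u‖ * l2 a' :=
    l2_le_of_ae (by positivity) h.memLp (ae_of_all _ b3)
  have h4 := l2_add_le m3 m2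
  have h5 : l2 (fun x => a' x • u.rep 0 x + a x • u.der 1 x) ≤ 2 * ‖u‖ * l2 a' + C * ‖u‖ :=
    h4.trans (add_le_add h3 h2)
  refine (add_le_add h1 h5).trans (le_of_eq (by ring))

/-- Multiplication by a scalar function as a continuous linear operator in `H¹`. -/
def mulL (h : HasL2Deriv a a') : H 1 →L[ℝ] H 1 :=
  LinearMap.mkContinuousOfExistsBound
    { toFun := mulFun h
      map_add' := by
        intro u v
        refine ext_toL2_ae ?_
        filter_upwards [toL2_mulFun h (u + v), toL2_mulFun h u, toL2_mulFun h v,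
          Lp.coeFn_add u.toL2 v.toL2, Lp.coeFn_add (mulFun h u).toL2 (mulFun h v).toL2]
          with x h1 h2 h3 h4 h5
        have e1 : (u + v).toL2 = u.toL2 + v.toL2 := rfl
        have e2 : (mulFun h u + mulFun h v).toL2 = (mulFun h u).toL2 + (mulFun h v).toL2 := rfl
        rw [h1, e1, h4, e2, h5, Pi.add_apply, Pi.add_apply, h2, h3, smul_add]
      map_smul' := by
        intro r u
        refine ext_toL2_ae ?_
        filter_upwards [toL2_mulFun h (r • u), toL2_mulFun h u,
          Lp.coeFn_smul r u.toL2, Lp.coeFn_smul r (mulFun h u).toL2]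
          with x h1 h2 h4 h5
        have e1 : (r • u).toL2 = r • u.toL2 := rfl
        have e2 : (r • mulFun h u).toL2 = r • (mulFun h u).toL2 := rfl
        rw [h1, e1, h4, RingHom.id_apply, e2, h5, Pi.smul_apply, Pi.smul_apply, h2, smul_comm] }
    (by
      obtain ⟨C, hC⟩ := isCompact_univ.exists_bound_of_continuousOn h.continuous.continuousOn
      exact ⟨_, norm_mulFun_le h (fun x => hC x (mem_univ x))⟩)

theorem toL2_mulL (h : HasL2Deriv a a') (u : H 1) :
    ∀ᵐ x, (mulL h u).toL2 x = a x • u.toL2 x := toL2_mulFun h u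

theorem norm_mulL_le (h : HasL2Deriv a a') {C : ℝ} (hC : ∀ x, |a x| ≤ C) :
    ‖mulL h‖ ≤ 2 * C + 2 * l2 a' := by
  have hC0 : 0 ≤ C := (abs_nonneg _).trans (hC 0)
  exact ContinuousLinearMap.opNorm_le_bound _ (by have := l2_nonneg a'; positivity)
    (norm_mulFun_le h hC)

theorem mulL_sub {b b' : Circ → ℝ} (h : HasL2Deriv a a') (k : HasL2Deriv b b') :
    mulL h - mulL k = mulL (h.sub k) := by
  ext1 u
  refine ext_toL2_ae ?_
  filter_upwards [toL2_mulL h u, toL2_mulL k u, toL2_mulL (h.sub k) u,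
    Lp.coeFn_sub (mulL h u).toL2 (mulL k u).toL2] with x h1 h2 h3 h4
  have e : ((mulL h - mulL k) u).toL2 = (mulL h u).toL2 - (mulL k u).toL2 := rfl
  rw [e, h4, Pi.sub_apply, h1, h2, h3, sub_smul]

end H

/-! ### The elliptic operator -/

theorem memLp_smul_circ (g : C(Circ, ℝ)) (u : L2) :
    MemLp (fun x => g x • u x) 2 (volume : Measure Circ) :=
  MemLp.of_le_mul (c := ‖g‖) (Lp.memLp u)
    (g.continuous.aestronglyMeasurable.smul (Lp.aestronglyMeasurable u))
    (ae_of_all _ fun x => by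
      rw [norm_smul]
      exact mul_le_mul_of_nonneg_right (g.norm_coe_le_norm x) (norm_nonneg _))

/-- Multiplication by a continuous function in `L²`. -/
def mulL2 (g : C(Circ, ℝ)) : L2 →L[ℝ] L2 :=
  LinearMap.mkContinuous
    { toFun u := (memLp_smul_circ g u).toLp
      map_add' u v := by
        refine Lp.ext ?_
        filter_upwards [Lp.coeFn_add u v, (memLp_smul_circ g (u + v)).coeFn_toLp,
          (memLp_smul_circ g u).coeFn_toLp, (memLp_smul_circ g v).coeFn_toLp,
          Lp.coeFn_add (memLp_smul_circ g u).toLp (memLp_smul_circ g v).toLp] with x h1 h2 h3 h4 h5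
        rw [h2, h5, Pi.add_apply, h1, Pi.add_apply, smul_add, h3, h4]
      map_smul' r u := by
        refine Lp.ext ?_
        filter_upwards [Lp.coeFn_smul r u, (memLp_smul_circ g (r • u)).coeFn_toLp,
          (memLp_smul_circ g u).coeFn_toLp,
          Lp.coeFn_smul r (memLp_smul_circ g u).toLp] with x h1 h2 h3 h5
        rw [h2, RingHom.id_apply, h5, Pi.smul_apply, h1, Pi.smul_apply, smul_comm, h3] }
    ‖g‖ (fun u => by
      refine Lp.norm_le_mul_norm_of_ae_le_mul ?_
      refine (memLp_smul_circ g u).coeFn_toLp.mono fun x hx => ?_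
      refine (congrArg norm hx).trans_le ?_
      rw [norm_smul]
      exact mul_le_mul_of_nonneg_right (g.norm_coe_le_norm x) (norm_nonneg _))

theorem coeFn_mulL2 (g : C(Circ, ℝ)) (u : L2) : mulL2 g u =ᵐ[volume] fun x => g x • u x :=
  (memLp_smul_circ g u).coeFn_toLp

/-- The scalar product of `L²` as a bilinear map. -/
def innerL2 : L2 →L[ℝ] L2 →L[ℝ] ℝ := innerSL ℝ

theorem inner_mulL2_left (g : C(Circ, ℝ)) (u v : L2) :
    inner ℝ (mulL2 g u) v = ∫ x, g x * inner ℝ (u x) (v x) := by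
  rw [L2.inner_def]
  refine integral_congr_ae ?_
  filter_upwards [coeFn_mulL2 g u] with x hx
  rw [hx, real_inner_smul_left]

theorem inner_mulL2_comm (g : C(Circ, ℝ)) (u v : L2) :
    inner ℝ (mulL2 g u) v = inner ℝ (mulL2 g v) u := by
  rw [inner_mulL2_left, inner_mulL2_left]
  simp only [real_inner_comm]

theorem le_inner_mulL2 {g : C(Circ, ℝ)} {m : ℝ} (hg : ∀ x, m ≤ g x) (u : L2) :
    m * ‖u‖ ^ 2 ≤ inner ℝ (mulL2 g u) u := by
  rw [inner_mulL2_left, ← real_inner_self_eq_norm_sq, L2.inner_def, ← integral_const_mul]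
  have hi : Integrable (fun x => inner ℝ (u x) (u x)) (volume : Measure Circ) :=
    L2.integrable_inner u u
  refine integral_mono (hi.const_mul m) ?_ fun x => ?_
  · refine (L2.integrable_inner (𝕜 := ℝ) (mulL2 g u) u).congr ?_
    filter_upwards [coeFn_mulL2 g u] with x hx
    rw [hx, real_inner_smul_left]
  · exact mul_le_mul_of_nonneg_right (hg x) real_inner_self_nonneg

namespace H

variable {k : ℕ}

/-- The `j`-th derivative as a continuous linear map. -/
def derL (j : Fin (k + 1)) : H k →L[ℝ] L2 :=
  (PiLp.proj 2 (fun _ : Fin (k + 1) => L2) j).comp (sobolev k).subtypeL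

theorem inner_der_eq_neg (u v : H 1) :
    inner ℝ (u.der 1) (v.der 0) = -inner ℝ (u.der 0) (v.der 1) := by
  have h := ((u.hasL2Deriv_rep 0).inner (v.hasL2Deriv_rep 0)).integral_eq_zero
  have e : ∀ᵐ x, inner ℝ (u.der 1 x) (v.rep 0 x) + inner ℝ (u.rep 0 x) (v.der 1 x) =
      inner ℝ (u.der 1 x) (v.der 0 x) + inner ℝ (u.der 0 x) (v.der 1 x) := by
    filter_upwards [u.coeFn_rep 0, v.coeFn_rep 0] with x h1 h2
    have h1' : u.der 0 x = u.rep 0 x := h1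
    have h2' : v.der 0 x = v.rep 0 x := h2
    rw [h1', h2']
  have h' : ∫ x, (inner ℝ (u.der 1 x) (v.der 0 x) + inner ℝ (u.der 0 x) (v.der 1 x)) = 0 :=
    (integral_congr_ae e).symm.trans h
  rw [integral_add (L2.integrable_inner (𝕜 := ℝ) _ _) (L2.integrable_inner (𝕜 := ℝ) _ _)] at h'
  rw [L2.inner_def, L2.inner_def]
  exact eq_neg_of_add_eq_zero_left h'

/-- Test functions `φ e` with constant vectors `e` recover the vector-valued defining identity. The
weak elliptic equation is read as a statement on weak derivatives in this way. -/
theorem hasWeakDeriv_of_inner {p q : L2}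
    (h : ∀ v : H 1, inner ℝ p (v.der 1) = -inner ℝ q (v.der 0)) : HasWeakDeriv p q := by
  intro φ φ' _ hd
  refine ext_inner_right ℝ fun e => ?_
  have hφ : HasL2Deriv φ φ' := HasL2Deriv.of_hasDerivAt φ'.continuous hd
  have h1 := h (ofDeriv (hφ.smul (HasL2Deriv.const e)))
  rw [L2.inner_def, L2.inner_def] at h1
  have e1 : ∫ x, inner ℝ (p x) ((ofDeriv (hφ.smul (HasL2Deriv.const e))).der 1 x) =
      inner ℝ (∫ x, φ' x • p x) e := by
    rw [real_inner_comm, ← integral_inner (integrable_smul_L2 φ' p)]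
    refine integral_congr_ae ?_
    filter_upwards [coeFn_der_ofDeriv (hφ.smul (HasL2Deriv.const e))] with x hx
    rw [hx, smul_zero, add_zero, real_inner_smul_right, real_inner_smul_right, real_inner_comm]
  have e2 : ∫ x, inner ℝ (q x) ((ofDeriv (hφ.smul (HasL2Deriv.const e))).der 0 x) =
      inner ℝ (∫ x, φ x • q x) e := by
    rw [real_inner_comm, ← integral_inner (integrable_smul_L2 φ q)]
    refine integral_congr_ae ?_
    filter_upwards [coeFn_ofDeriv (hφ.smul (HasL2Deriv.const e))] with x hx
    have hx' : (ofDeriv (hφ.smul (HasL2Deriv.const e))).der 0 x = φ x • e := hx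
    rw [hx', real_inner_smul_right, real_inner_smul_right, real_inner_comm]
  rw [e1, e2] at h1
  rw [h1, inner_neg_left]

end H

/-- Two positive weights, one the reciprocal of the other. -/
structure WeightPair (a w : Circ → ℝ) where
  a' : Circ → ℝ
  w' : Circ → ℝ
  ha : HasL2Deriv a a'
  hw : HasL2Deriv w w'
  mul_eq : ∀ x, a x * w x = 1
  m : ℝ
  m_pos : 0 < m
  m_le_one : m ≤ 1
  m_le_a : ∀ x, m ≤ a x
  m_le_w : ∀ x, m ≤ w x

namespace WeightPair

variable {a w : Circ → ℝ} (P : WeightPair a w)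

/-- The operator `1 - a ∂ₓ²`. -/
def op : H 3 →L[ℝ] H 1 :=
  (H.trunc 1).comp (H.trunc 2) - (H.mulL P.ha).comp ((H.shift 1).comp (H.shift 2))

/-- The scalar product `∫ u' v' + ∫ w u v` on `H¹`. -/
def b : H 1 →L[ℝ] H 1 →L[ℝ] ℝ :=
  innerL2.bilinearComp (H.derL 1) (H.derL 1) +
    innerL2.bilinearComp ((mulL2 ⟨w, P.hw.continuous⟩).comp (H.derL 0)) (H.derL 0)

/-- The form `∫ a u'' v'' + 2 ∫ u' v' + ∫ w u v` on `H²`. -/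
def Q : H 2 →L[ℝ] H 2 →L[ℝ] ℝ :=
  innerL2.bilinearComp ((mulL2 ⟨a, P.ha.continuous⟩).comp (H.derL 2)) (H.derL 2) +
    ((2 : ℝ) • innerL2.bilinearComp (H.derL 1) (H.derL 1) +
    innerL2.bilinearComp ((mulL2 ⟨w, P.hw.continuous⟩).comp (H.derL 0)) (H.derL 0))

theorem b_apply (u v : H 1) : P.b u v =
    inner ℝ (u.der 1) (v.der 1) + inner ℝ (mulL2 ⟨w, P.hw.continuous⟩ (u.der 0)) (v.der 0) := rfl

theorem Q_apply (u v : H 2) : P.Q u v =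
    inner ℝ (mulL2 ⟨a, P.ha.continuous⟩ (u.der 2)) (v.der 2) +
    (2 * inner ℝ (u.der 1) (v.der 1) +
      inner ℝ (mulL2 ⟨w, P.hw.continuous⟩ (u.der 0)) (v.der 0)) := rfl

theorem b_symm (u v : H 1) : P.b u v = P.b v u := by
  rw [b_apply, b_apply, inner_mulL2_comm, real_inner_comm]

theorem Q_symm (u v : H 2) : P.Q u v = P.Q v u := by
  rw [Q_apply, Q_apply, inner_mulL2_comm, inner_mulL2_comm (u := u.der 0),
    real_inner_comm (u.der 1)]

theorem b_coercive (u : H 1) : P.m * ‖u‖ ^ 2 ≤ P.b u u := by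
  rw [b_apply, H.norm_sq_eq, Fin.sum_univ_two, real_inner_self_eq_norm_sq]
  have h1 := le_inner_mulL2 (g := ⟨w, P.hw.continuous⟩) P.m_le_w (u.der 0)
  have h2 := mul_le_mul_of_nonneg_right P.m_le_one (sq_nonneg ‖u.der 1‖)
  linarith

theorem Q_coercive (u : H 2) : P.m * ‖u‖ ^ 2 ≤ P.Q u u := by
  rw [Q_apply, H.norm_sq_eq, Fin.sum_univ_three, real_inner_self_eq_norm_sq]
  have h1 := le_inner_mulL2 (g := ⟨w, P.hw.continuous⟩) P.m_le_w (u.der 0)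
  have h3 := le_inner_mulL2 (g := ⟨a, P.ha.continuous⟩) P.m_le_a (u.der 2)
  have h2 := mul_le_mul_of_nonneg_right P.m_le_one (sq_nonneg ‖u.der 1‖)
  nlinarith [sq_nonneg (‖u.der 1‖)]

theorem mulL2_der_zero_mulL (u : H 1) :
    mulL2 ⟨w, P.hw.continuous⟩ ((H.mulL P.ha u).der 0) = u.der 0 := by
  refine Lp.ext ?_
  filter_upwards [coeFn_mulL2 ⟨w, P.hw.continuous⟩ ((H.mulL P.ha u).der 0), H.toL2_mulL P.ha u]
    with x h1 h2
  have h2' : (H.mulL P.ha u).der 0 x = a x • u.der 0 x := h2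
  rw [h1, h2', ContinuousMap.coe_mk, smul_smul, mul_comm, P.mul_eq, one_smul]

/-- The weight `w = 1/a` cancels the coefficient in the zero-order part: `w (ξ - a ξ'') = w ξ -
ξ''`. One integration by parts turns `-∫ (a ξ'')' y'` into `∫ a ξ'' y''`, another turns `-∫ ξ'' y`
into a second copy of `∫ ξ' y'`. No derivative of `a` remains in the form. -/
theorem Q_eq (ξ : H 3) (y : H 2) : P.Q (H.trunc 2 ξ) y = P.b (P.op ξ) (H.trunc 1 y) := by
  set z : H 1 := H.mulL P.ha ((H.shift 1) (H.shift 2 ξ)) with hz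
  have hop : P.op ξ = H.trunc 1 (H.trunc 2 ξ) - z := rfl
  have h1 := H.inner_der_eq_neg z ((H.shift 1) y)
  have h2 := H.inner_der_eq_neg (H.trunc 1 (H.shift 2 ξ)) (H.trunc 1 y)
  have e0 : mulL2 ⟨a, P.ha.continuous⟩ (ξ.der 2) = z.der 0 := by
    refine Lp.ext ?_
    filter_upwards [coeFn_mulL2 ⟨a, P.ha.continuous⟩ (ξ.der 2),
      H.toL2_mulL P.ha ((H.shift 1) (H.shift 2 ξ))] with x h1 h2
    have h2' : z.der 0 x = a x • ξ.der 2 x := h2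
    rw [h1, h2', ContinuousMap.coe_mk]
  rw [hop, map_sub, sub_apply, b_apply, b_apply, Q_apply, hz,
    mulL2_der_zero_mulL, ← hz]
  have g1 : inner ℝ (z.der 1) (y.der 1) = -inner ℝ (z.der 0) (y.der 2) := h1
  have g2 : inner ℝ (ξ.der 2) (y.der 0) = -inner ℝ (ξ.der 1) (y.der 1) := h2
  change inner ℝ (mulL2 _ (ξ.der 2)) (y.der 2) + (2 * inner ℝ (ξ.der 1) (y.der 1) +
    inner ℝ (mulL2 _ (ξ.der 0)) (y.der 0)) = inner ℝ (ξ.der 1) (y.der 1) +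
    inner ℝ (mulL2 _ (ξ.der 0)) (y.der 0) - (inner ℝ (z.der 1) (y.der 1) +
    inner ℝ (ξ.der 2) (y.der 0))
  rw [e0, g1, g2]
  ring

theorem op_injective : Function.Injective P.op := by
  refine (injective_iff_map_eq_zero _).2 fun ξ hξ => ?_
  have h1 := P.Q_eq ξ (H.trunc 2 ξ)
  have h2 := P.Q_coercive (H.trunc 2 ξ)
  rw [h1, hξ, map_zero, zero_apply] at h2
  have h3 : ‖H.trunc 2 ξ‖ ^ 2 ≤ 0 := by
    have := P.m_pos
    by_contra hc
    push Not at hc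
    have := mul_pos P.m_pos hc
    linarith
  have h4 : H.trunc 2 ξ = 0 := by
    have := le_antisymm h3 (sq_nonneg _)
    simpa using this
  exact H.trunc_injective (h4.trans (map_zero _).symm)

/-- Lax–Milgram in `H¹` solves `w u - u'' = w g` weakly. Then `u'' = w (u - g)` is itself in `H¹`,
so `u` is in `H³`, and multiplication by `a` returns the original equation. -/
theorem op_surjective : Function.Surjective P.op := by
  intro g
  have hco : IsCoercive P.b := ⟨P.m, P.m_pos, fun u => by
    have := P.b_coercive u
    rwa [sq, ← mul_assoc] at this⟩
  set ℓ : H 1 →L[ℝ] ℝ :=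
    (innerSL ℝ (mulL2 ⟨w, P.hw.continuous⟩ (g.der 0))).comp (H.derL 0) with hℓ
  obtain ⟨u, hu⟩ : ∃ u : H 1, ∀ v, P.b u v = ℓ v := by
    refine ⟨hco.continuousLinearEquivOfBilin.symm ((InnerProductSpace.toDual ℝ (H 1)).symm ℓ),
      fun v => ?_⟩
    rw [← hco.continuousLinearEquivOfBilin_apply, ContinuousLinearEquiv.apply_symm_apply,
      InnerProductSpace.toDual_symm_apply]
  set z := H.mulL P.hw (u - g) with hz
  have hz0 : z.der 0 = mulL2 ⟨w, P.hw.continuous⟩ (u.der 0 - g.der 0) := by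
    refine Lp.ext ?_
    filter_upwards [coeFn_mulL2 ⟨w, P.hw.continuous⟩ (u.der 0 - g.der 0),
      H.toL2_mulL P.hw (u - g)] with x h1 h2
    rw [h1]
    exact h2
  have hweak : HasWeakDeriv (u.der 1) (z.der 0) := by
    refine H.hasWeakDeriv_of_inner fun v => ?_
    have h1 := hu v
    rw [b_apply] at h1
    have h2 : ℓ v = inner ℝ (mulL2 ⟨w, P.hw.continuous⟩ (g.der 0)) (v.der 0) := rfl
    rw [hz0, map_sub, inner_sub_left]
    rw [h2] at h1
    linarith
  set ξ : H 3 := H.mk ![u.der 0, u.der 1, z.der 0, z.der 1] (fun j => by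
    fin_cases j
    · exact u.weakDeriv 0
    · exact hweak
    · exact z.weakDeriv 0) with hξ
  refine ⟨ξ, H.ext_toL2_ae ?_⟩
  have e : (P.op ξ).toL2 = u.der 0 - (H.mulL P.ha ((H.shift 1) (H.shift 2 ξ))).toL2 := rfl
  rw [e]
  filter_upwards [Lp.coeFn_sub (u.der 0) (H.mulL P.ha ((H.shift 1) (H.shift 2 ξ))).toL2,
    H.toL2_mulL P.ha ((H.shift 1) (H.shift 2 ξ)), H.toL2_mulL P.hw (u - g),
    Lp.coeFn_sub (u.der 0) (g.der 0)] with x h1 h2 h3 h4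
  have h5 : ((H.shift 1) (H.shift 2 ξ)).toL2 x = w x • (u - g).toL2 x := h3
  have h6 : (u - g).toL2 x = u.der 0 x - g.der 0 x := h4
  rw [h1, Pi.sub_apply, h2, h5, h6, smul_smul, P.mul_eq, one_smul, sub_sub_cancel]
  rfl

/-- The operator `1 - a ∂ₓ²` as an isomorphism. -/
def opEquiv : H 3 ≃L[ℝ] H 1 :=
  ContinuousLinearEquiv.ofBijective P.op (LinearMap.ker_eq_bot.2 P.op_injective)
    (LinearMap.range_eq_top.2 P.op_surjective)

/-- The parabolic problem with the operator `1 - a ∂ₓ²`. -/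
def parabolicData : ParabolicData (H 1) (H 2) (H 3) where
  b := P.b
  b_symm := P.b_symm
  Q := P.Q
  Q_symm := P.Q_symm
  β := P.m
  β_pos := P.m_pos
  b_coercive := P.b_coercive
  Q_coercive := P.Q_coercive
  ι₂ := H.trunc 1
  ι₂_injective := H.trunc_injective
  ι₃ := H.trunc 2
  ι₃_injective := H.trunc_injective
  B := P.opEquiv
  Q_eq := P.Q_eq

end WeightPair

/-! ### Hardy's inequality on the circle -/

theorem sq_lintegral_mul_le {α : Type*} [MeasurableSpace α] {μ : Measure α} {f g : α → ℝ≥0∞}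
    (hf : AEMeasurable f μ) (hg : AEMeasurable g μ) :
    (∫⁻ x, f x * g x ∂μ) ^ 2 ≤ (∫⁻ x, f x ^ 2 ∂μ) * ∫⁻ x, g x ^ 2 ∂μ := by
  have h := ENNReal.lintegral_mul_le_Lp_mul_Lq μ (p := 2) (q := 2)
    (Real.HolderConjugate.two_two) hf hg
  have h2 := pow_le_pow_left' h 2
  have e : ∀ a : ℝ≥0∞, (a ^ (1 / (2 : ℝ))) ^ 2 = a := fun a => by
    rw [← ENNReal.rpow_natCast, ← ENNReal.rpow_mul]
    norm_num
  rw [mul_pow, e, e] at h2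
  simpa only [ENNReal.rpow_two, Pi.mul_apply] using h2

theorem lintegral_comp_mul_le {θ : ℝ} (h0 : 0 < θ) (h1 : θ ≤ 1) {ψ : ℝ → ℝ≥0∞}
    (hψ : Measurable ψ) :
    ∫⁻ h in Ioc (-1 / 2 : ℝ) (1 / 2), ψ (θ * h) ≤
      ENNReal.ofReal θ⁻¹ * ∫⁻ s in Ioc (-1 / 2 : ℝ) (1 / 2), ψ s := by
  set S := Ioc (-1 / 2 : ℝ) (1 / 2)
  have hS : MeasurableSet S := measurableSet_Ioc
  rw [← lintegral_indicator hS, ← lintegral_indicator hS]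
  calc ∫⁻ h, S.indicator (fun h => ψ (θ * h)) h ≤ ∫⁻ h, S.indicator ψ (θ * h) := by
        refine lintegral_mono fun h => ?_
        by_cases hh : h ∈ S
        · have : θ * h ∈ S := ⟨by nlinarith [hh.1, hh.2], by nlinarith [hh.1, hh.2]⟩
          rw [indicator_of_mem hh, indicator_of_mem this]
        · rw [indicator_of_notMem hh]; exact zero_le
    _ = ∫⁻ s, S.indicator ψ s ∂(Measure.map (θ * ·) volume) :=
        (lintegral_map (hψ.indicator hS) (measurable_const_mul θ)).symm
    _ = ENNReal.ofReal θ⁻¹ * ∫⁻ s, S.indicator ψ s := by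
        rw [Real.map_volume_mul_left h0.ne', lintegral_smul_measure, abs_of_pos (inv_pos.2 h0),
          smul_eq_mul]

theorem lintegral_rpow_neg_half :
    ∫⁻ θ in Ioo (0 : ℝ) 1, ENNReal.ofReal (θ ^ (-1 / 2 : ℝ)) = 2 := by
  have hi : IntervalIntegrable (fun θ : ℝ => θ ^ (-1 / 2 : ℝ)) volume 0 1 :=
    intervalIntegral.intervalIntegrable_rpow' (by norm_num)
  rw [intervalIntegrable_iff_integrableOn_Ioo_of_le zero_le_one] at hi
  rw [← ofReal_integral_eq_lintegral_ofReal hi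
    ((ae_restrict_iff' measurableSet_Ioo).2 (ae_of_all _ fun θ hθ =>
      Real.rpow_nonneg hθ.1.le _)), ← integral_Ioc_eq_integral_Ioo,
    ← intervalIntegral.integral_of_le zero_le_one, integral_rpow (Or.inl (by norm_num))]
  norm_num

/-- Cauchy–Schwarz is applied with the splitting `θ^(-1/4) · θ^(1/4) φ`, whose first factor has
square integral `2`. The dilation `h ↦ θ h` turns the remaining weight `θ^(1/2)` into `θ^(-1/2)`,
with integral `2` again, whence the constant `4`. -/
theorem hardy {φ : ℝ → ℝ≥0∞} (hφ : Measurable φ) :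
    ∫⁻ h in Ioc (-1 / 2 : ℝ) (1 / 2), (∫⁻ θ in Ioo (0 : ℝ) 1, φ (θ * h)) ^ 2 ≤
      4 * ∫⁻ s in Ioc (-1 / 2 : ℝ) (1 / 2), φ s ^ 2 := by
  set N := ∫⁻ s in Ioc (-1 / 2 : ℝ) (1 / 2), φ s ^ 2
  have m1 : Measurable fun θ : ℝ => ENNReal.ofReal (θ ^ (-1 / 4 : ℝ)) := by fun_prop
  have m2 : Measurable fun θ : ℝ => ENNReal.ofReal (θ ^ (1 / 4 : ℝ)) := by fun_prop
  have m3 : Measurable fun θ : ℝ => ENNReal.ofReal (θ ^ (1 / 2 : ℝ)) := by fun_prop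
  have key : ∀ h : ℝ, (∫⁻ θ in Ioo (0 : ℝ) 1, φ (θ * h)) ^ 2 ≤
      2 * ∫⁻ θ in Ioo (0 : ℝ) 1, ENNReal.ofReal (θ ^ (1 / 2 : ℝ)) * φ (θ * h) ^ 2 := by
    intro h
    have m4 : Measurable fun θ : ℝ => φ (θ * h) := by fun_prop
    have h1 := sq_lintegral_mul_le (μ := volume.restrict (Ioo (0 : ℝ) 1)) m1.aemeasurable
      (m2.mul m4).aemeasurable
    refine le_trans (le_of_eq ?_) (h1.trans (le_of_eq ?_))
    · congr 1
      refine setLIntegral_congr_fun measurableSet_Ioo fun θ hθ => ?_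
      simp only [Pi.mul_apply]
      rw [← mul_assoc, ← ENNReal.ofReal_mul (Real.rpow_nonneg hθ.1.le _),
        ← Real.rpow_add hθ.1]
      norm_num
    · congr 1
      · rw [← lintegral_rpow_neg_half]
        refine setLIntegral_congr_fun measurableSet_Ioo fun θ hθ => ?_
        rw [← ENNReal.ofReal_pow (Real.rpow_nonneg hθ.1.le _), ← Real.rpow_natCast,
          ← Real.rpow_mul hθ.1.le]
        norm_num
      · refine setLIntegral_congr_fun measurableSet_Ioo fun θ hθ => ?_
        simp only [Pi.mul_apply]
        rw [mul_pow, ← ENNReal.ofReal_pow (Real.rpow_nonneg hθ.1.le _), ← Real.rpow_natCast,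
          ← Real.rpow_mul hθ.1.le]
        norm_num
  have m5 : Measurable (Function.uncurry fun (h θ : ℝ) =>
      ENNReal.ofReal (θ ^ (1 / 2 : ℝ)) * φ (θ * h) ^ 2) := by
    unfold Function.uncurry
    fun_prop
  calc ∫⁻ h in Ioc (-1 / 2 : ℝ) (1 / 2), (∫⁻ θ in Ioo (0 : ℝ) 1, φ (θ * h)) ^ 2
      ≤ ∫⁻ h in Ioc (-1 / 2 : ℝ) (1 / 2), 2 * ∫⁻ θ in Ioo (0 : ℝ) 1,
          ENNReal.ofReal (θ ^ (1 / 2 : ℝ)) * φ (θ * h) ^ 2 := lintegral_mono key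
    _ = 2 * ∫⁻ θ in Ioo (0 : ℝ) 1, ∫⁻ h in Ioc (-1 / 2 : ℝ) (1 / 2),
          ENNReal.ofReal (θ ^ (1 / 2 : ℝ)) * φ (θ * h) ^ 2 := by
        rw [lintegral_const_mul' _ _ (by norm_num), lintegral_lintegral_swap m5.aemeasurable]
    _ ≤ 2 * ∫⁻ θ in Ioo (0 : ℝ) 1, ENNReal.ofReal (θ ^ (-1 / 2 : ℝ)) * N := by
        refine mul_le_mul_right (setLIntegral_mono' measurableSet_Ioo fun θ hθ => ?_) _
        rw [lintegral_const_mul' _ _ ENNReal.ofReal_ne_top]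
        refine (mul_le_mul_right (lintegral_comp_mul_le hθ.1 hθ.2.le (hφ.pow_const 2)) _).trans
          (le_of_eq ?_)
        rw [← mul_assoc, ← ENNReal.ofReal_mul (Real.rpow_nonneg hθ.1.le _),
          ← Real.rpow_neg_one, ← Real.rpow_add hθ.1]
        congr 3
        norm_num
    _ = 4 * N := by
        rw [lintegral_mul_const _ (by fun_prop), lintegral_rpow_neg_half, ← mul_assoc]
        norm_num

/-- The signed arc length: the representative in `(-1/2, 1/2]` of a point of the circle. -/
def arc (z : Circ) : ℝ := AddCircle.equivIoc 1 (-1 / 2) z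

theorem coe_arc (z : Circ) : (arc z : Circ) = z := AddCircle.coe_equivIoc

theorem arc_mem (z : Circ) : arc z ∈ Ioc (-1 / 2 : ℝ) (1 / 2) := by
  have h := (AddCircle.equivIoc (1 : ℝ) (-1 / 2) z).2
  exact ⟨h.1, h.2.trans_eq (by norm_num)⟩

theorem abs_arc_le (z : Circ) : |arc z| ≤ 1 / 2 :=
  abs_le.2 ⟨by linarith [(arc_mem z).1], (arc_mem z).2⟩

theorem norm_eq_abs_arc (z : Circ) : ‖z‖ = |arc z| := by
  conv_lhs => rw [← coe_arc z]
  refine (AddCircle.norm_coe_eq_abs_iff (p := (1 : ℝ)) one_ne_zero).2 ?_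
  rw [abs_one]
  exact abs_arc_le z

theorem arc_eq_zero_iff {z : Circ} : arc z = 0 ↔ z = 0 := by
  rw [← abs_eq_zero, ← norm_eq_abs_arc, norm_eq_zero]

theorem measurable_arc : Measurable arc :=
  measurable_subtype_coe.comp (AddCircle.measurableEquivIoc (1 : ℝ) (-1 / 2)).measurable

theorem arc_coe {s : ℝ} (hs : s ∈ Ioc (-1 / 2 : ℝ) (1 / 2)) : arc (s : Circ) = s := by
  have e : (-1 / 2 : ℝ) + 1 = 1 / 2 := by norm_num
  rw [← e] at hs
  exact AddCircle.equivIoc_coe_of_mem hs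

theorem lintegral_circ (f : Circ → ℝ≥0∞) :
    ∫⁻ x, f x = ∫⁻ s in Ioc (-1 / 2 : ℝ) (1 / 2), f (s : Circ) := by
  have h := UnitAddCircle.lintegral_preimage (-1 / 2) f
  have e : (-1 / 2 : ℝ) + 1 = 1 / 2 := by norm_num
  rw [e] at h
  exact h.symm

theorem lintegral_comp_arc (F : ℝ → ℝ≥0∞) :
    ∫⁻ z, F (arc z) = ∫⁻ s in Ioc (-1 / 2 : ℝ) (1 / 2), F s := by
  rw [lintegral_circ]
  exact setLIntegral_congr_fun measurableSet_Ioc fun s hs => by simp only [arc_coe hs]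

/-- The average of `g` over the arc from `x` to `y`. -/
def arcMean (g : Circ → ℝ≥0∞) (x y : Circ) : ℝ≥0∞ :=
  ∫⁻ θ in Ioo (0 : ℝ) 1, g (x + ((θ * arc (y - x) : ℝ) : Circ))

theorem measurable_coe_circ : Measurable (fun s : ℝ => (s : Circ)) := continuous_coe_circ.measurable

theorem measurable_arcMean {g : Circ → ℝ≥0∞} (hg : Measurable g) :
    Measurable (Function.uncurry (arcMean g)) := by
  have h : Measurable fun p : (Circ × Circ) × ℝ =>
      g (p.1.1 + ((p.2 * arc (p.1.2 - p.1.1) : ℝ) : Circ)) := by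
    refine hg.comp (Measurable.add (by fun_prop) (measurable_coe_circ.comp ?_))
    exact measurable_snd.mul (measurable_arc.comp (by fun_prop))
  exact h.lintegral_prod_right'

/-- Reading the same arc from its other end makes Hardy's inequality available in `x` as well as in
`y`. The number `arc (y - x)` is kept, since `arc` is not odd at antipodal points. -/
theorem arcMean_swap (g : Circ → ℝ≥0∞) (x y : Circ) :
    arcMean g x y = ∫⁻ θ in Ioo (0 : ℝ) 1, g (y - ((θ * arc (y - x) : ℝ) : Circ)) := by
  have h : MeasurePreserving (fun θ : ℝ => 1 - θ) volume volume :=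
    Measure.measurePreserving_sub_left volume 1
  have hp : (fun θ : ℝ => 1 - θ) ⁻¹' Ioo 0 1 = Ioo 0 1 := by
    ext θ
    simp only [mem_preimage, mem_Ioo]
    constructor <;> rintro ⟨h1, h2⟩ <;> constructor <;> linarith
  have h2 := h.setLIntegral_comp_preimage_emb (MeasurableEquiv.subLeft (1 : ℝ)).measurableEmbedding
    (fun θ => g (y - ((θ * arc (y - x) : ℝ) : Circ))) (Ioo 0 1)
  rw [hp] at h2
  rw [arcMean, ← h2]
  refine lintegral_congr fun θ => ?_
  congr 1
  have : (((1 - θ) * arc (y - x) : ℝ) : Circ) = (y - x) - ((θ * arc (y - x) : ℝ) : Circ) := by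
    conv_rhs => rw [← coe_arc (y - x)]
    rw [← AddCircle.coe_sub]
    congr 1
    rw [coe_arc]
    ring
  rw [this]
  abel

theorem lintegral_arcMean_sq_right {g : Circ → ℝ≥0∞} (hg : Measurable g) (x : Circ) :
    ∫⁻ y, arcMean g x y ^ 2 ≤ 4 * ∫⁻ z, g z ^ 2 := by
  have h1 := hardy (φ := fun s : ℝ => g (x + (s : Circ)))
    (hg.comp (measurable_const.add measurable_coe_circ))
  have h2 : ∫⁻ y, arcMean g x y ^ 2 = ∫⁻ z, arcMean g x (z + x) ^ 2 :=
    (lintegral_add_right_eq_self (fun y => arcMean g x y ^ 2) x).symm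
  have h3 : ∫⁻ z, g z ^ 2 = ∫⁻ s in Ioc (-1 / 2 : ℝ) (1 / 2), g (x + (s : Circ)) ^ 2 := by
    rw [← lintegral_circ (fun z => g (x + z) ^ 2)]
    exact (lintegral_add_left_eq_self (fun z => g z ^ 2) x).symm
  rw [h2, h3]
  simp only [arcMean, add_sub_cancel_right]
  rw [lintegral_comp_arc (fun h => (∫⁻ θ in Ioo (0 : ℝ) 1, g (x + ((θ * h : ℝ) : Circ))) ^ 2)]
  exact h1

theorem lintegral_arcMean_sq_left {g : Circ → ℝ≥0∞} (hg : Measurable g) (y : Circ) :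
    ∫⁻ x, arcMean g x y ^ 2 ≤ 4 * ∫⁻ z, g z ^ 2 := by
  have h1 := hardy (φ := fun s : ℝ => g (y - (s : Circ)))
    (hg.comp (measurable_const.sub measurable_coe_circ))
  have h2 : ∫⁻ x, arcMean g x y ^ 2 = ∫⁻ z, arcMean g (y - z) y ^ 2 :=
    (lintegral_sub_left_eq_self (fun x => arcMean g x y ^ 2) y).symm
  have h3 : ∫⁻ z, g z ^ 2 = ∫⁻ s in Ioc (-1 / 2 : ℝ) (1 / 2), g (y - (s : Circ)) ^ 2 := by
    rw [← lintegral_circ (fun z => g (y - z) ^ 2)]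
    exact (lintegral_sub_left_eq_self (fun z => g z ^ 2) y).symm
  rw [h2, h3]
  simp only [arcMean_swap, sub_sub_cancel]
  rw [lintegral_comp_arc (fun h => (∫⁻ θ in Ioo (0 : ℝ) 1, g (y - ((θ * h : ℝ) : Circ))) ^ 2)]
  exact h1

/-- The singular weight controlling the tangential derivative of the kernel. -/
def singWeight (g : Circ → ℝ≥0∞) (x y : Circ) : ℝ≥0∞ :=
  g x * arcMean g x y + arcMean g x y ^ 2

theorem lintegral_singWeight_left_lt_top {g : Circ → ℝ≥0∞} (hg : Measurable g)
    (hN : ∫⁻ z, g z ^ 2 ≠ ⊤) (y : Circ) : ∫⁻ x, singWeight g x y < ⊤ := by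
  have hm : Measurable fun x => arcMean g x y := (measurable_arcMean hg).of_uncurry_right
  have h1 : ∫⁻ x, arcMean g x y ^ 2 < ⊤ :=
    (lintegral_arcMean_sq_left hg y).trans_lt (ENNReal.mul_lt_top (by norm_num) hN.lt_top)
  have h2 : ∫⁻ x, g x * arcMean g x y < ⊤ := by
    have := sq_lintegral_mul_le (μ := (volume : Measure Circ)) hg.aemeasurable hm.aemeasurable
    exact (ENNReal.pow_lt_top_iff.1 (this.trans_lt (ENNReal.mul_lt_top hN.lt_top h1))).resolve_right
      (by norm_num)
  unfold singWeight
  rw [lintegral_add_right _ (hm.pow_const 2)]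
  exact ENNReal.add_lt_top.2 ⟨h2, h1⟩

/-- Write `m` for the arc mean and `N` for `∫ g²`. Hardy bounds the square of `∫ m g` by `4N²`,
which contributes `4N³` after multiplication by `g(x)²` and integration. Splitting `m² g` as `m · (m
g)` contributes `4N · 4N²`. With the factor `2` from squaring a sum the total is `40 N³`. -/
theorem lintegral_sq_lintegral_singWeight_le {g : Circ → ℝ≥0∞} (hg : Measurable g) :
    ∫⁻ x, (∫⁻ y, singWeight g x y * g y) ^ 2 ≤ 40 * (∫⁻ z, g z ^ 2) ^ 3 := by
  set N := ∫⁻ z, g z ^ 2 with hN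
  have hx : ∀ x, Measurable (arcMean g x) := fun x => (measurable_arcMean hg).of_uncurry_left
  have hy : ∀ y, Measurable fun x => arcMean g x y := fun y =>
    (measurable_arcMean hg).of_uncurry_right
  have b1 : ∀ x, (∫⁻ y, arcMean g x y * g y) ^ 2 ≤ 4 * N * N := fun x =>
    (sq_lintegral_mul_le (hx x).aemeasurable hg.aemeasurable).trans
      (mul_le_mul_left (lintegral_arcMean_sq_right hg x) _)
  have b2 : ∀ x, (∫⁻ y, arcMean g x y ^ 2 * g y) ^ 2 ≤
      4 * N * ∫⁻ y, arcMean g x y ^ 2 * g y ^ 2 := fun x => by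
    have h := sq_lintegral_mul_le (μ := (volume : Measure Circ)) (hx x).aemeasurable
      ((hx x).mul hg).aemeasurable
    simp only [Pi.mul_apply, mul_pow, ← mul_assoc, ← sq] at h
    exact h.trans (mul_le_mul_left (lintegral_arcMean_sq_right hg x) _)
  have b3 : ∫⁻ x, ∫⁻ y, arcMean g x y ^ 2 * g y ^ 2 ≤ 4 * N * N := by
    rw [lintegral_lintegral_swap
      (((measurable_arcMean hg).pow_const 2).mul ((hg.comp measurable_snd).pow_const 2)).aemeasurable]
    calc ∫⁻ y, ∫⁻ x, arcMean g x y ^ 2 * g y ^ 2 = ∫⁻ y, (∫⁻ x, arcMean g x y ^ 2) * g y ^ 2 :=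
          lintegral_congr fun y => lintegral_mul_const _ ((hy y).pow_const 2)
      _ ≤ ∫⁻ y, 4 * N * g y ^ 2 :=
          lintegral_mono fun y => mul_le_mul_left (lintegral_arcMean_sq_left hg y) _
      _ = 4 * N * N := lintegral_const_mul _ (hg.pow_const 2)
  have hsplit : ∀ x, ∫⁻ y, singWeight g x y * g y =
      g x * (∫⁻ y, arcMean g x y * g y) + ∫⁻ y, arcMean g x y ^ 2 * g y := fun x => by
    unfold singWeight
    simp only [add_mul]
    rw [lintegral_add_right (μ := volume) (fun y => g x * arcMean g x y * g y)
      (g := fun y => arcMean g x y ^ 2 * g y) (((hx x).pow_const 2).mul hg),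
      ← lintegral_const_mul (g x) (f := fun y => arcMean g x y * g y) ((hx x).mul hg)]
    simp only [mul_assoc]
  have hsq : ∀ a b : ℝ≥0∞, (a + b) ^ 2 ≤ 2 * a ^ 2 + 2 * b ^ 2 := fun a b => by
    have := ENNReal.rpow_add_le_mul_rpow_add_rpow a b (p := 2) (by norm_num)
    have e : (2 : ℝ≥0∞) ^ ((2 : ℝ) - 1) = 2 := by norm_num
    rw [e, ENNReal.rpow_two, ENNReal.rpow_two, ENNReal.rpow_two, mul_add] at this
    exact this
  have hm : Measurable fun x => ∫⁻ y, arcMean g x y ^ 2 * g y ^ 2 :=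
    (((measurable_arcMean hg).pow_const 2).mul
      ((hg.comp measurable_snd).pow_const 2)).lintegral_prod_right'
  calc ∫⁻ x, (∫⁻ y, singWeight g x y * g y) ^ 2
      ≤ ∫⁻ x, (2 * (4 * N * N) * g x ^ 2 + 2 * (4 * N) * ∫⁻ y, arcMean g x y ^ 2 * g y ^ 2) := by
        refine lintegral_mono fun x => ?_
        rw [hsplit]
        refine (hsq _ _).trans (add_le_add ?_ ?_)
        · rw [mul_pow, mul_assoc, mul_comm (g x ^ 2)]
          exact mul_le_mul_right (mul_le_mul_left (b1 x) _) _
        · rw [mul_assoc]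
          exact mul_le_mul_right (b2 x) _
    _ = 2 * (4 * N * N) * N + 2 * (4 * N) * ∫⁻ x, ∫⁻ y, arcMean g x y ^ 2 * g y ^ 2 := by
        rw [lintegral_add_right _ (hm.const_mul _), lintegral_const_mul _ (hg.pow_const 2),
          lintegral_const_mul _ hm]
    _ ≤ 2 * (4 * N * N) * N + 2 * (4 * N) * (4 * N * N) :=
        add_le_add le_rfl (mul_le_mul_right b3 _)
    _ = 40 * N ^ 3 := by ring

/-! ### Pairs of nearby quantities -/

/-- The elements `u`, `v` have size at most `w` and distance at most `D w`. -/
structure LipPair {Y : Type*} [NormedAddCommGroup Y] (D w : ℝ) (u v : Y) : Prop where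
  left : ‖u‖ ≤ w
  right : ‖v‖ ≤ w
  sub : ‖u - v‖ ≤ D * w

namespace LipPair

variable {Y : Type*} [NormedAddCommGroup Y] {D w w' : ℝ} {u v u' v' : Y}

theorem nonneg (h : LipPair D w u v) : 0 ≤ w := (norm_nonneg _).trans h.left

theorem mono (hD : 0 ≤ D) (h : LipPair D w u v) (hw : w ≤ w') : LipPair D w' u v :=
  ⟨h.left.trans hw, h.right.trans hw, h.sub.trans (mul_le_mul_of_nonneg_left hw hD)⟩

theorem refl (hD : 0 ≤ D) (h : ‖u‖ ≤ w) : LipPair D w u u :=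
  ⟨h, h, by simpa using mul_nonneg hD ((norm_nonneg _).trans h)⟩

theorem add (h : LipPair D w u v) (h' : LipPair D w' u' v') :
    LipPair D (w + w') (u + u') (v + v') :=
  ⟨(norm_add_le _ _).trans (add_le_add h.left h'.left),
    (norm_add_le _ _).trans (add_le_add h.right h'.right), by
      rw [add_sub_add_comm, mul_add]
      exact (norm_add_le _ _).trans (add_le_add h.sub h'.sub)⟩

theorem neg (h : LipPair D w u v) : LipPair D w (-u) (-v) :=
  ⟨by rw [norm_neg]; exact h.left, by rw [norm_neg]; exact h.right, by
    rw [neg_sub_neg, norm_sub_rev]; exact h.sub⟩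

/-- The telescoped difference has two terms, whence the factor `2`. The distance parameter `D` is
unchanged, so products of many factors keep a bound linear in `D`. -/
theorem bilin {Z W : Type*} [NormedAddCommGroup Z] [NormedAddCommGroup W] [NormedSpace ℝ Y]
    [NormedSpace ℝ Z] [NormedSpace ℝ W] (B : Y →L[ℝ] Z →L[ℝ] W)
    (hB : ∀ y z, ‖B y z‖ ≤ ‖y‖ * ‖z‖) (hD : 0 ≤ D) {a b : Z}
    (h : LipPair D w u v) (h' : LipPair D w' a b) :
    LipPair D (2 * (w * w')) (B u a) (B v b) := by
  have hw := h.nonneg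
  have hw' := h'.nonneg
  have h0 : 0 ≤ w * w' := mul_nonneg hw hw'
  refine ⟨?_, ?_, ?_⟩
  · have := (hB u a).trans (mul_le_mul h.left h'.left (norm_nonneg _) hw)
    linarith
  · have := (hB v b).trans (mul_le_mul h.right h'.right (norm_nonneg _) hw)
    linarith
  · have e : B u a - B v b = B (u - v) a + B v (a - b) := by
      simp only [map_sub, sub_apply]
      abel
    rw [e]
    have h1 := (hB (u - v) a).trans (mul_le_mul h.sub h'.left (norm_nonneg _) (mul_nonneg hD hw))
    have h2 := (hB v (a - b)).trans (mul_le_mul h.right h'.sub (norm_nonneg _) hw)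
    refine (norm_add_le _ _).trans ((add_le_add h1 h2).trans (le_of_eq ?_))
    ring

theorem mul (hD : 0 ≤ D) {a b u v : ℝ} (h : LipPair D w u v) (h' : LipPair D w' a b) :
    LipPair D (2 * (w * w')) (u * a) (v * b) :=
  bilin (ContinuousLinearMap.mul ℝ ℝ) (fun y z => (norm_mul y z).le) hD h h'

theorem inner {u v a b : Plane} (hD : 0 ≤ D) (h : LipPair D w u v) (h' : LipPair D w' a b) :
    LipPair D (2 * (w * w')) (inner ℝ u a) (inner ℝ v b) :=
  bilin (innerSL ℝ) (fun y z => norm_inner_le_norm y z) hD h h'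

theorem const_smul [NormedSpace ℝ Y] (t : ℝ) (h : LipPair D w u v) :
    LipPair D (|t| * w) (t • u) (t • v) :=
  ⟨by rw [norm_smul]; exact mul_le_mul_of_nonneg_left h.left (abs_nonneg t),
    by rw [norm_smul]; exact mul_le_mul_of_nonneg_left h.right (abs_nonneg t), by
      rw [← smul_sub, norm_smul, mul_left_comm]
      exact mul_le_mul_of_nonneg_left h.sub (abs_nonneg t)⟩

/-- The condition `ℓ ≤ w` makes the size bound `ℓ⁻¹` fit under the scale `w ℓ⁻²` dictated by the
difference. -/
theorem inv {a b ℓ : ℝ} (hℓ : 0 < ℓ) (ha : ℓ ≤ a) (hb : ℓ ≤ b)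
    (h : |a - b| ≤ D * w) (hw : ℓ ≤ w) : LipPair D (w * (ℓ⁻¹) ^ 2) a⁻¹ b⁻¹ := by
  have ha0 := hℓ.trans_le ha
  have hb0 := hℓ.trans_le hb
  have i0 : 0 < ℓ⁻¹ := inv_pos.2 hℓ
  have ia : a⁻¹ ≤ ℓ⁻¹ := inv_anti₀ hℓ ha
  have ib : b⁻¹ ≤ ℓ⁻¹ := inv_anti₀ hℓ hb
  have hl : ℓ⁻¹ ≤ w * (ℓ⁻¹) ^ 2 := by
    have : ℓ * (ℓ⁻¹) ^ 2 = ℓ⁻¹ := by field_simp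
    exact this.symm.trans_le (mul_le_mul_of_nonneg_right hw (by positivity))
  refine ⟨?_, ?_, ?_⟩
  · rw [Real.norm_of_nonneg (inv_nonneg.2 ha0.le)]; linarith
  · rw [Real.norm_of_nonneg (inv_nonneg.2 hb0.le)]; linarith
  · have e : a⁻¹ - b⁻¹ = (b - a) * (a⁻¹ * b⁻¹) := by field_simp
    rw [e, norm_mul, Real.norm_eq_abs, abs_sub_comm, Real.norm_of_nonneg (by positivity)]
    exact (mul_le_mul h (mul_le_mul ia ib (by positivity) i0.le) (by positivity)
      ((abs_nonneg _).trans h)).trans_eq (by ring)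

theorem clm [NormedSpace ℝ Y] {Z : Type*} [NormedAddCommGroup Z] [NormedSpace ℝ Z] (A : Y →L[ℝ] Z)
    (hA : ∀ y, ‖A y‖ ≤ ‖y‖) (h : LipPair D w u v) : LipPair D w (A u) (A v) :=
  ⟨(hA _).trans h.left, (hA _).trans h.right, by rw [← map_sub]; exact (hA _).trans h.sub⟩

end LipPair

/-- Rotation as a linear map. -/
def rotL : Plane →L[ℝ] Plane :=
  LinearMap.toContinuousLinearMap
    { toFun := rot
      map_add' u v := by
        ext i
        fin_cases i <;> simp [rot]
        ring
      map_smul' r u := by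
        ext i
        fin_cases i <;> simp [rot] }

theorem rotL_apply (v : Plane) : rotL v = rot v := rfl

theorem norm_rotL (v : Plane) : ‖rotL v‖ = ‖v‖ := by
  rw [EuclideanSpace.norm_eq, EuclideanSpace.norm_eq, Fin.sum_univ_two, Fin.sum_univ_two]
  congr 1
  simp [rotL_apply, rot, add_comm]

theorem inner_rotL_self (v : Plane) : inner ℝ (rotL v) v = 0 := by
  simp [rotL_apply, rot, PiLp.inner_apply, Fin.sum_univ_two]
  ring

theorem LipPair.rotL {D w : ℝ} {u v : Plane} (h : LipPair D w u v) :
    LipPair D w (rotL u) (rotL v) := h.clm Langmuir.rotL fun y => (norm_rotL y).le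

/-! ### The kernel -/

/-- The regularised reciprocal chord length. -/
def invChord (δ : ℝ) (d : Plane) : ℝ := (√(‖d‖ ^ 2 + δ ^ 2))⁻¹

/-- The regularised kernel `(N(x) · Δ) (N(y) · Δ) / |Δ|³`, with `N` the rotation of `∂ₓγ = p`. -/
def kern (δ : ℝ) (γ p : Circ → Plane) (x y : Circ) : ℝ :=
  inner ℝ (rotL (p x)) (γ y - γ x) * inner ℝ (rotL (p y)) (γ y - γ x) *
    invChord δ (γ y - γ x) ^ 3

/-- The derivative of the regularised kernel in the first variable, with `q = ∂ₓp`. -/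
def kernDeriv (δ : ℝ) (γ p q : Circ → Plane) (x y : Circ) : ℝ :=
  inner ℝ (rotL (q x)) (γ y - γ x) * inner ℝ (rotL (p y)) (γ y - γ x) *
      invChord δ (γ y - γ x) ^ 3 +
    -(inner ℝ (rotL (p x)) (γ y - γ x) * inner ℝ (rotL (p y)) (p x) *
      invChord δ (γ y - γ x) ^ 3) +
    (3 : ℝ) • (inner ℝ (rotL (p x)) (γ y - γ x) * inner ℝ (rotL (p y)) (γ y - γ x) *
      (invChord δ (γ y - γ x) ^ 5 * inner ℝ (γ y - γ x) (p x)))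

/-- The radicand stays above `δ²`, so the chain rule applies across the diagonal as well; the
singular kernel is reached only in the limit. -/
theorem hasL2Deriv_invChord_pow {δ : ℝ} (hδ : 0 < δ) {γ p : Circ → Plane} (h : HasL2Deriv γ p)
    (y : Circ) : HasL2Deriv (fun x => invChord δ (γ y - γ x) ^ 3)
      (fun x => 3 * (invChord δ (γ y - γ x) ^ 5 * inner ℝ (γ y - γ x) (p x))) := by
  have h1 := (HasL2Deriv.const (γ y)).sub h
  have h2 := (h1.inner h1).add (HasL2Deriv.const (δ ^ 2))
  obtain ⟨C, hC⟩ := isCompact_univ.exists_bound_of_continuousOn h2.continuous.continuousOn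
  have hs : ∀ x, inner ℝ (γ y - γ x) (γ y - γ x) + δ ^ 2 ∈ Icc (δ ^ 2) C := fun x =>
    ⟨by linarith [real_inner_self_nonneg (F := Plane) (x := γ y - γ x)],
      (le_abs_self _).trans (hC x (mem_univ x))⟩
  have hd : ∀ s ∈ Icc (δ ^ 2) C, HasDerivAt (fun s : ℝ => (√s)⁻¹ ^ 3)
      (-(3 / 2) * (√s)⁻¹ ^ 5) s := fun s hs => by
    have s0 : 0 < s := (by positivity : 0 < δ ^ 2).trans_le hs.1
    have r0 : 0 < √s := Real.sqrt_pos.2 s0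
    have := ((Real.hasDerivAt_sqrt s0.ne').inv r0.ne').pow 3
    refine this.congr_deriv ?_
    simp only [Pi.inv_apply]
    have e : √s ≠ 0 := r0.ne'
    norm_num
    field_simp
  have hc : ContinuousOn (fun s : ℝ => -(3 / 2) * (√s)⁻¹ ^ 5) (Icc (δ ^ 2) C) := by
    refine continuousOn_const.mul (ContinuousOn.pow (ContinuousOn.inv₀ (by fun_prop) ?_) 5)
    intro s hs
    exact (Real.sqrt_pos.2 ((by positivity : 0 < δ ^ 2).trans_le hs.1)).ne'
  have h3 := h2.comp_real hd hc hs
  have e1 : (fun x => invChord δ (γ y - γ x) ^ 3) =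
      fun x => (√(inner ℝ (γ y - γ x) (γ y - γ x) + δ ^ 2))⁻¹ ^ 3 := by
    funext x
    rw [invChord, real_inner_self_eq_norm_sq]
  have e2 : (fun x => 3 * (invChord δ (γ y - γ x) ^ 5 * inner ℝ (γ y - γ x) (p x))) =
      fun x => -(3 / 2) * (√(inner ℝ (γ y - γ x) (γ y - γ x) + δ ^ 2))⁻¹ ^ 5 *
        (inner ℝ (0 - p x) (γ y - γ x) + inner ℝ (γ y - γ x) (0 - p x) + 0) := by
    funext x
    rw [invChord, real_inner_self_eq_norm_sq, zero_sub, inner_neg_left, inner_neg_right,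
      real_inner_comm]
    ring
  rw [e1, e2]
  exact h3

/-- Differentiating the first factor also produces `-N(x) · p(x)`, which is zero because the
rotation is by a right angle. -/
theorem hasL2Deriv_kern {δ : ℝ} (hδ : 0 < δ) {γ p q : Circ → Plane} (h : HasL2Deriv γ p)
    (h' : HasL2Deriv p q) (y : Circ) :
    HasL2Deriv (fun x => kern δ γ p x y) (fun x => kernDeriv δ γ p q x y) := by
  have h1 := (HasL2Deriv.const (γ y)).sub h
  have h2 := ((h'.clm rotL).inner h1).mul (((HasL2Deriv.const (rotL (p y))).inner h1))
  have h3 := h2.mul (hasL2Deriv_invChord_pow hδ h y)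
  refine h3.congr_ae (ae_of_all _ fun x => ?_)
  simp only [kernDeriv, zero_sub, inner_neg_right, inner_rotL_self, inner_zero_left, smul_eq_mul]
  ring

/-! ### Pointwise bounds for the kernel -/

theorem LipPair.intervalIntegral {Y : Type*} [NormedAddCommGroup Y] [NormedSpace ℝ Y] {D a b : ℝ}
    {f₁ f₂ : ℝ → Y} {w : ℝ → ℝ} (hD : 0 ≤ D) (h₁ : IntervalIntegrable f₁ volume a b)
    (h₂ : IntervalIntegrable f₂ volume a b) (hw : IntervalIntegrable w volume a b)
    (h : ∀ t ∈ uIoc a b, LipPair D (w t) (f₁ t) (f₂ t)) :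
    LipPair D |∫ t in a..b, w t| (∫ t in a..b, f₁ t) (∫ t in a..b, f₂ t) := by
  have hm : MeasurableSet (uIoc a b) := measurableSet_uIoc
  refine ⟨?_, ?_, ?_⟩
  · exact intervalIntegral.norm_integral_le_abs_of_norm_le
      ((ae_restrict_iff' hm).2 (ae_of_all _ fun t ht => (h t ht).left)) hw
  · exact intervalIntegral.norm_integral_le_abs_of_norm_le
      ((ae_restrict_iff' hm).2 (ae_of_all _ fun t ht => (h t ht).right)) hw
  · rw [← intervalIntegral.integral_sub h₁ h₂, ← abs_of_nonneg hD, ← abs_mul,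
      ← intervalIntegral.integral_const_mul]
    exact intervalIntegral.norm_integral_le_abs_of_norm_le
      ((ae_restrict_iff' hm).2 (ae_of_all _ fun t ht => (h t ht).sub)) (hw.const_mul D)

/-- The Lipschitz constant does not depend on `δ`, as is needed for kernel bounds that are uniform
in the regularisation. -/
theorem abs_sqrt_sub_sqrt_le (a b δ : ℝ) : |√(a ^ 2 + δ ^ 2) - √(b ^ 2 + δ ^ 2)| ≤ |a - b| := by
  refine abs_le_of_sq_le_sq ?_ (abs_nonneg _)
  rw [sq_abs]
  have h1 := Real.sq_sqrt (by positivity : 0 ≤ a ^ 2 + δ ^ 2)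
  have h2 := Real.sq_sqrt (by positivity : 0 ≤ b ^ 2 + δ ^ 2)
  have h3 : a * b + δ ^ 2 ≤ √(a ^ 2 + δ ^ 2) * √(b ^ 2 + δ ^ 2) := by
    rw [← Real.sqrt_mul (by positivity)]
    refine Real.le_sqrt_of_sq_le ?_
    nlinarith [sq_nonneg (δ * (a - b))]
  nlinarith

/-- Two curves `γᵢ ∈ H²` with uniform bounds, whose distance is measured by `D`. -/
structure CurvePair (K D : ℝ) (γ₁ p₁ q₁ γ₂ p₂ q₂ : Circ → Plane) (G : Circ → ℝ) : Prop where
  one_le : 1 ≤ K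
  D_nonneg : 0 ≤ D
  hγ₁ : HasL2Deriv γ₁ p₁
  hp₁ : HasL2Deriv p₁ q₁
  hγ₂ : HasL2Deriv γ₂ p₂
  hp₂ : HasL2Deriv p₂ q₂
  hq₁ : Measurable q₁
  hq₂ : Measurable q₂
  hG : Measurable G
  memLp : MemLp G 2 volume
  p : ∀ x, LipPair D K (p₁ x) (p₂ x)
  q : ∀ x, LipPair D (G x) (q₁ x) (q₂ x)
  chord₁ : ∀ x y, ‖y - x‖ ≤ K * ‖γ₁ y - γ₁ x‖
  chord₂ : ∀ x y, ‖y - x‖ ≤ K * ‖γ₂ y - γ₂ x‖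
  speed₁ : ∀ x, 1 ≤ K * ‖p₁ x‖
  speed₂ : ∀ x, 1 ≤ K * ‖p₂ x‖

/-- The average of `G` over the arc from `x` to `y`. -/
def arcAvg (G : Circ → ℝ) (x y : Circ) : ℝ :=
  ∫ θ in (0 : ℝ)..1, G (x + ((θ * arc (y - x) : ℝ) : Circ))

theorem abs_arc_mul_arcAvg {G : Circ → ℝ} (hG : ∀ x, 0 ≤ G x) (s h : ℝ) (y : Circ)
    (hh : arc (y - s) = h) :
    |∫ t in s..(s + h), G (t : Circ)| = |h| * arcAvg G s y := by
  have h0 : 0 ≤ arcAvg G s y := intervalIntegral.integral_nonneg zero_le_one fun θ _ => hG _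
  have h1 := intervalIntegral.mul_integral_comp_mul_right (a := 0) (b := 1) (c := h)
    (f := fun t => G ((s : Circ) + (t : Circ)))
  have h2 := intervalIntegral.integral_comp_add_left (a := 0) (b := h)
    (fun t => G (t : Circ)) s
  rw [← abs_of_nonneg h0, ← abs_mul, arcAvg, hh, h1, zero_mul, one_mul]
  rw [add_zero] at h2
  rw [← h2]
  rfl

theorem ofReal_arcAvg_le {G : Circ → ℝ} (hG : ∀ x, 0 ≤ G x) (x y : Circ) :
    ENNReal.ofReal (arcAvg G x y) ≤ arcMean (fun z => ENNReal.ofReal (G z)) x y := by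
  have h0 : 0 ≤ arcAvg G x y := intervalIntegral.integral_nonneg zero_le_one fun θ _ => hG _
  have h1 : ENNReal.ofReal (arcAvg G x y) = ‖arcAvg G x y‖ₑ :=
    (Real.enorm_of_nonneg h0).symm
  rw [h1, arcAvg, intervalIntegral.integral_of_le zero_le_one, integral_Ioc_eq_integral_Ioo]
  refine (enorm_integral_le_lintegral_enorm _).trans (le_of_eq ?_)
  exact lintegral_congr fun θ => Real.enorm_of_nonneg (hG _)

namespace CurvePair

variable {K D : ℝ} {γ₁ p₁ q₁ γ₂ p₂ q₂ : Circ → Plane} {G : Circ → ℝ}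
  (P : CurvePair K D γ₁ p₁ q₁ γ₂ p₂ q₂ G)

include P

theorem K_pos : 0 < K := zero_lt_one.trans_le P.one_le

theorem G_nonneg (x : Circ) : 0 ≤ G x := (P.q x).nonneg

theorem intervalIntegrable (a b : ℝ) :
    IntervalIntegrable (fun s : ℝ => G (s : Circ)) volume a b :=
  intervalIntegrable_lift (P.memLp.integrable (by norm_num)) a b

theorem arcAvg_nonneg (x y : Circ) : 0 ≤ arcAvg G x y :=
  intervalIntegral.integral_nonneg zero_le_one fun _ _ => P.G_nonneg _

theorem lip_p_sub (a b : ℝ) : LipPair D |∫ t in a..b, G (t : Circ)| (p₁ b - p₁ a) (p₂ b - p₂ a) := by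
  rw [P.hp₁.eq, P.hp₂.eq]
  exact LipPair.intervalIntegral P.D_nonneg (P.hp₁.intervalIntegrable a b)
    (P.hp₂.intervalIntegrable a b) (P.intervalIntegrable a b) fun t _ => P.q t

theorem lip_chord_coe (a b : ℝ) : LipPair D (|b - a| * K) (γ₁ b - γ₁ a) (γ₂ b - γ₂ a) := by
  have h := LipPair.intervalIntegral (D := D) (w := fun _ => K) P.D_nonneg
    (P.hγ₁.intervalIntegrable a b) (P.hγ₂.intervalIntegrable a b) intervalIntegrable_const
    fun t _ => P.p t
  rwa [← P.hγ₁.eq, ← P.hγ₂.eq, intervalIntegral.integral_const, smul_eq_mul, abs_mul,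
    abs_of_pos P.K_pos] at h

/-- The tangent may be taken at any point `c` of the arc. Both endpoints are used, one for each
normal in the kernel. -/
theorem lip_taylor_coe (a b c : ℝ) (hc : c ∈ uIcc a b) :
    LipPair D (|b - a| * |∫ t in a..b, G (t : Circ)|) (γ₁ b - γ₁ a - (b - a) • p₁ c)
      (γ₂ b - γ₂ a - (b - a) • p₂ c) := by
  have e : ∀ {γ p q : Circ → Plane}, HasL2Deriv γ p → HasL2Deriv p q →
      γ b - γ a - (b - a) • p c = ∫ t in a..b, (p t - p c) := fun h h' => by
    rw [intervalIntegral.integral_sub (h.intervalIntegrable a b) intervalIntegrable_const,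
      intervalIntegral.integral_const, ← h.eq]
  have i : ∀ {γ p q : Circ → Plane}, HasL2Deriv γ p → HasL2Deriv p q →
      IntervalIntegrable (fun t : ℝ => p t - p c) volume a b := fun h h' =>
    (h.intervalIntegrable a b).sub intervalIntegrable_const
  rw [e P.hγ₁ P.hp₁, e P.hγ₂ P.hp₂]
  have h := LipPair.intervalIntegral (D := D) (w := fun _ => |∫ t in a..b, G (t : Circ)|)
    P.D_nonneg (i P.hγ₁ P.hp₁) (i P.hγ₂ P.hp₂) intervalIntegrable_const fun t ht =>
      (P.lip_p_sub c t).mono P.D_nonneg (intervalIntegral.abs_integral_mono_interval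
        (by
          rw [uIoc_eq_union] at ht
          have ht' : t ∈ uIcc a b := by
            rw [mem_uIcc]
            rcases ht with h | h
            · exact Or.inl ⟨h.1.le, h.2⟩
            · exact Or.inr ⟨h.1.le, h.2⟩
          rw [uIoc, uIoc]
          refine Ioc_subset_Ioc (le_inf hc.1 ht'.1) (sup_le hc.2 ht'.2))
        (ae_of_all _ fun s => P.G_nonneg _) (P.intervalIntegrable a b))
  rwa [intervalIntegral.integral_const, smul_eq_mul, abs_mul, abs_abs] at h

/-- The bounds for the constituents of the kernel. -/
theorem lip_basic (x y : Circ) :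
    LipPair D (|arc (y - x)| * K) (γ₁ y - γ₁ x) (γ₂ y - γ₂ x) ∧
    LipPair D (|arc (y - x)| * arcAvg G x y) (p₁ y - p₁ x) (p₂ y - p₂ x) ∧
    LipPair D (|arc (y - x)| * (|arc (y - x)| * arcAvg G x y))
      (γ₁ y - γ₁ x - arc (y - x) • p₁ x) (γ₂ y - γ₂ x - arc (y - x) • p₂ x) ∧
    LipPair D (|arc (y - x)| * (|arc (y - x)| * arcAvg G x y))
      (γ₁ y - γ₁ x - arc (y - x) • p₁ y) (γ₂ y - γ₂ x - arc (y - x) • p₂ y) ∧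
    |arc (y - x)| * arcAvg G x y ≤ l2 G := by
  induction x using QuotientAddGroup.induction_on with | H s =>
  set h := arc (y - (s : Circ)) with hh
  have hy : y = ((s + h : ℝ) : Circ) := by
    rw [AddCircle.coe_add, hh, coe_arc]
    abel
  have e := abs_arc_mul_arcAvg P.G_nonneg s h y hh.symm
  have k1 := P.lip_chord_coe s (s + h)
  have k2 := P.lip_p_sub s (s + h)
  have k3 := P.lip_taylor_coe s (s + h) s left_mem_uIcc
  have k4 := P.lip_taylor_coe s (s + h) (s + h) right_mem_uIcc
  -- The arc has length at most one half and lies in the period centred at `s`.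
  have k5 : |∫ t in s..(s + h), G (t : Circ)| ≤ l2 G := by
    have hab := abs_arc_le (y - (s : Circ))
    rw [← hh, abs_le] at hab
    have i1 := intervalIntegral.abs_integral_mono_interval (f := fun t : ℝ => G (t : Circ))
      (μ := volume) (a := s) (b := s + h) (c := s - 1 / 2) (d := s - 1 / 2 + 1) (by
        rw [uIoc, uIoc]
        refine Ioc_subset_Ioc (le_inf ?_ ?_) (sup_le ?_ ?_)
        · exact inf_le_left.trans (by linarith)
        · exact inf_le_left.trans (by linarith)
        · exact le_trans (by linarith) le_sup_right
        · exact le_trans (by linarith) le_sup_right)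
      (ae_of_all _ fun t => P.G_nonneg _) (P.intervalIntegrable _ _)
    rw [← integral_circ G (s - 1 / 2)] at i1
    refine i1.trans ((abs_of_nonneg (integral_nonneg P.G_nonneg)).trans_le ?_)
    refine le_trans (le_of_eq ?_) (integral_norm_le_l2 P.memLp)
    exact integral_congr_ae (ae_of_all _ fun x => (Real.norm_of_nonneg (P.G_nonneg x)).symm)
  rw [← hy, e] at k2
  rw [← hy, e, add_sub_cancel_left] at k3 k4
  rw [← hy, add_sub_cancel_left] at k1
  rw [e] at k5
  exact ⟨k1, k2, k3, k4, k5⟩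

theorem lip_invChord (δ : ℝ) {x y : Circ} (hxy : x ≠ y) :
    LipPair D (K ^ 3 / |arc (y - x)|) (invChord δ (γ₁ y - γ₁ x)) (invChord δ (γ₂ y - γ₂ x)) := by
  have hK := P.K_pos
  have h0 : 0 < |arc (y - x)| := by
    rw [abs_pos, Ne, arc_eq_zero_iff, sub_eq_zero]
    exact fun h => hxy h.symm
  have low : ∀ {d : Plane}, ‖y - x‖ ≤ K * ‖d‖ → |arc (y - x)| / K ≤ √(‖d‖ ^ 2 + δ ^ 2) := by
    intro d hd
    rw [norm_eq_abs_arc] at hd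
    rw [div_le_iff₀ hK, mul_comm]
    refine hd.trans (mul_le_mul_of_nonneg_left (Real.le_sqrt_of_sq_le ?_) hK.le)
    linarith [sq_nonneg δ]
  have h := LipPair.inv (D := D) (w := |arc (y - x)| * K) (div_pos h0 hK) (low (P.chord₁ x y))
    (low (P.chord₂ x y)) ((abs_sqrt_sub_sqrt_le _ _ _).trans ((abs_norm_sub_norm_le _ _).trans
      (P.lip_basic x y).1.sub)) (by
        rw [div_le_iff₀ hK, mul_assoc]
        exact le_mul_of_one_le_right h0.le (one_le_mul_of_one_le_of_one_le P.one_le P.one_le))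
  have e : |arc (y - x)| * K * (|arc (y - x)| / K)⁻¹ ^ 2 = K ^ 3 / |arc (y - x)| := by
    field_simp
  rwa [e] at h

/-- Write `h` for the arc length and `m` for the mean of `G`. Orthogonality replaces the chord by
its Taylor remainder, so `N(x)·Δ` and `N(y)·Δ` have size `h² m`; likewise `N(y)·p(x) = N(y)·(p(x) -
p(y))` has size `h m`. The kernel is then of order `(h² m)² / h³ = h m²`, and the terms of its
derivative are of order `G(x) m`, `m²` and `m²`. The bounds are independent of `δ`; the constant
`3200` is `64 + 64 + 3072`. -/
theorem lip_kern (δ : ℝ) (x y : Circ) :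
    LipPair D (64 * K ^ 11 * (|arc (y - x)| * arcAvg G x y ^ 2)) (kern δ γ₁ p₁ x y)
      (kern δ γ₂ p₂ x y) ∧
    LipPair D (3200 * K ^ 19 * (G x * arcAvg G x y + arcAvg G x y ^ 2)) (kernDeriv δ γ₁ p₁ q₁ x y)
      (kernDeriv δ γ₂ p₂ q₂ x y) := by
  have hD := P.D_nonneg
  have hK := P.K_pos
  have hm := P.arcAvg_nonneg x y
  have hG := P.G_nonneg x
  by_cases hxy : x = y
  · subst hxy
    simp only [kern, kernDeriv, sub_self, inner_zero_right, zero_mul, mul_zero, neg_zero,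
      smul_zero, add_zero]
    exact ⟨LipPair.refl hD (by rw [norm_zero]; positivity),
      LipPair.refl hD (by rw [norm_zero]; positivity)⟩
  have h0 : 0 < |arc (y - x)| := by
    rw [abs_pos, Ne, arc_eq_zero_iff, sub_eq_zero]
    exact fun h => hxy h.symm
  obtain ⟨c, d, tx, ty, -⟩ := P.lip_basic x y
  have ρ := P.lip_invChord δ hxy
  set h := |arc (y - x)| with hh
  set m := arcAvg G x y
  have ρ2 := LipPair.mul hD ρ ρ
  have ρ3 := LipPair.mul hD ρ2 ρ
  have ρ5 := LipPair.mul hD ρ3 ρ2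
  have a1 := (P.p x).rotL.inner hD tx
  have a2 := (P.p y).rotL.inner hD ty
  have b1 := (P.q x).rotL.inner hD c
  have b2 := (P.p y).rotL.inner hD d.neg
  have b3 := c.inner hD (P.p x)
  have ex : ∀ (p d : Plane) (t : ℝ), inner ℝ (rotL p) (d - t • p) = inner ℝ (rotL p) d := by
    intro p d t
    rw [inner_sub_right, inner_smul_right, inner_rotL_self, mul_zero, sub_zero]
  have ed : ∀ (p p' : Plane), inner ℝ (rotL p) (-(p - p')) = inner ℝ (rotL p) p' := by
    intro p p'
    rw [neg_sub, inner_sub_right, inner_rotL_self, sub_zero]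
  rw [ex, ex] at a1 a2
  rw [ed, ed] at b2
  constructor
  · have := LipPair.mul hD (LipPair.mul hD a1 a2) ρ3
    have e : ∀ (δ : ℝ) (γ p : Circ → Plane), kern δ γ p x y =
        inner ℝ (rotL (p x)) (γ y - γ x) * inner ℝ (rotL (p y)) (γ y - γ x) *
        (invChord δ (γ y - γ x) * invChord δ (γ y - γ x) * invChord δ (γ y - γ x)) := by
      intro δ γ p
      rw [kern]; ring
    rw [e, e]
    refine this.mono hD (le_of_eq ?_)
    field_simp
    ring
  · have t1 := LipPair.mul hD (LipPair.mul hD b1 a2) ρ3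
    have t2 := (LipPair.mul hD (LipPair.mul hD a1 b2) ρ3).neg
    have t3 := (LipPair.mul hD (LipPair.mul hD a1 a2) (LipPair.mul hD ρ5 b3)).const_smul 3
    have e : ∀ (δ : ℝ) (γ p q : Circ → Plane), kernDeriv δ γ p q x y =
        inner ℝ (rotL (q x)) (γ y - γ x) * inner ℝ (rotL (p y)) (γ y - γ x) *
          (invChord δ (γ y - γ x) * invChord δ (γ y - γ x) * invChord δ (γ y - γ x)) +
        -(inner ℝ (rotL (p x)) (γ y - γ x) * inner ℝ (rotL (p y)) (p x) *
          (invChord δ (γ y - γ x) * invChord δ (γ y - γ x) * invChord δ (γ y - γ x))) +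
        (3 : ℝ) • (inner ℝ (rotL (p x)) (γ y - γ x) * inner ℝ (rotL (p y)) (γ y - γ x) *
          ((invChord δ (γ y - γ x) * invChord δ (γ y - γ x) * invChord δ (γ y - γ x) *
          (invChord δ (γ y - γ x) * invChord δ (γ y - γ x))) *
          inner ℝ (γ y - γ x) (p x))) := by
      intro δ γ p q
      rw [kernDeriv]; ring_nf
    rw [e, e]
    refine ((t1.add t2).add t3).mono hD ?_
    have hp : K ^ 11 ≤ K ^ 19 := pow_le_pow_right₀ P.one_le (by norm_num)
    have e1 : 2 * (2 * (2 * (G x * (h * K)) * (2 * (K * (h * (h * m))))) *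
        (2 * (2 * (K ^ 3 / h * (K ^ 3 / h)) * (K ^ 3 / h)))) = 64 * K ^ 11 * (G x * m) := by
      field_simp; ring
    have e2 : 2 * (2 * (2 * (K * (h * (h * m))) * (2 * (K * (h * m)))) *
        (2 * (2 * (K ^ 3 / h * (K ^ 3 / h)) * (K ^ 3 / h)))) = 64 * K ^ 11 * m ^ 2 := by
      field_simp; ring
    have e3 : |(3 : ℝ)| * (2 * (2 * (2 * (K * (h * (h * m))) * (2 * (K * (h * (h * m))))) *
        (2 * (2 * (2 * (2 * (K ^ 3 / h * (K ^ 3 / h)) * (K ^ 3 / h)) *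
          (2 * (K ^ 3 / h * (K ^ 3 / h)))) * (2 * (h * K * K)))))) = 3072 * K ^ 19 * m ^ 2 := by
      rw [abs_of_pos (by norm_num : (0 : ℝ) < 3)]
      field_simp; ring
    rw [e1, e2, e3]
    have u1 : K ^ 11 * (G x * m) ≤ K ^ 19 * (G x * m) :=
      mul_le_mul_of_nonneg_right hp (mul_nonneg hG hm)
    have u2 : K ^ 11 * m ^ 2 ≤ K ^ 19 * m ^ 2 := mul_le_mul_of_nonneg_right hp (sq_nonneg m)
    have u3 : 0 ≤ K ^ 19 * (G x * m) := by positivity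
    have u4 : 0 ≤ K ^ 19 * m ^ 2 := by positivity
    linarith

end CurvePair

/-! ### Integral operators with singular kernels -/

theorem lintegral_enorm_sq {Y : Type*} [NormedAddCommGroup Y] (f : Circ → Y) :
    ∫⁻ x, ‖f x‖ₑ ^ 2 = eLpNorm f 2 volume ^ 2 := by
  have h := eLpNorm_nnreal_pow_eq_lintegral (μ := (volume : Measure Circ)) (f := f) (p := 2)
    (by norm_num)
  have e : ((2 : NNReal) : ℝ) = 2 := rfl
  rw [e, ENNReal.rpow_two] at h
  simp only [ENNReal.rpow_two] at h
  exact h.symm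

/-- The constant `7` arises from `40 ≤ 7²`. Absolute integrability in `y` holds only for almost
every `x`, since finiteness is derived from an integral over `x`. -/
theorem singular_integral {G : Circ → ℝ} (hG : Measurable G) (hG0 : ∀ x, 0 ≤ G x)
    (hG2 : MemLp G 2 volume) {C : ℝ} (hC : 0 ≤ C) {f : Circ → Circ → ℝ}
    (hf : Measurable (Function.uncurry f))
    (hb : ∀ x y, ‖f x y‖ₑ ≤ ENNReal.ofReal C * (singWeight (fun z => ENNReal.ofReal (G z)) x y *
      ENNReal.ofReal (G y))) :
    (∀ᵐ x, Integrable (f x)) ∧ MemLp (fun x => ∫ y, f x y) 2 volume ∧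
      l2 (fun x => ∫ y, f x y) ≤ 7 * C * l2 G ^ 3 := by
  set g : Circ → ℝ≥0∞ := fun z => ENNReal.ofReal (G z) with hg
  have hgm : Measurable g := hG.ennreal_ofReal
  have hN : ∫⁻ z, g z ^ 2 = ENNReal.ofReal (l2 G) ^ 2 := by
    rw [l2, ENNReal.ofReal_toReal hG2.2.ne, ← lintegral_enorm_sq]
    exact lintegral_congr fun z => by rw [hg, Real.enorm_of_nonneg (hG0 z)]
  have hfx : ∀ x, Measurable (f x) := fun x => hf.of_uncurry_left
  have hI : ∀ x, ∫⁻ y, ‖f x y‖ₑ ≤ ENNReal.ofReal C * ∫⁻ y, singWeight g x y * g y := fun x => by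
    rw [← lintegral_const_mul' _ _ ENNReal.ofReal_ne_top]
    exact lintegral_mono (hb x)
  have hsq : ∫⁻ x, (∫⁻ y, ‖f x y‖ₑ) ^ 2 ≤ ENNReal.ofReal ((7 * C * l2 G ^ 3) ^ 2) := by
    calc ∫⁻ x, (∫⁻ y, ‖f x y‖ₑ) ^ 2
        ≤ ∫⁻ x, ENNReal.ofReal C ^ 2 * (∫⁻ y, singWeight g x y * g y) ^ 2 := by
          refine lintegral_mono fun x => ?_
          rw [← mul_pow]
          exact pow_le_pow_left' (hI x) 2
      _ = ENNReal.ofReal C ^ 2 * ∫⁻ x, (∫⁻ y, singWeight g x y * g y) ^ 2 :=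
          lintegral_const_mul' _ _ (by simp)
      _ ≤ ENNReal.ofReal C ^ 2 * (40 * (ENNReal.ofReal (l2 G) ^ 2) ^ 3) := by
          rw [← hN]
          exact mul_le_mul_right (lintegral_sq_lintegral_singWeight_le hgm) _
      _ = ENNReal.ofReal (C ^ 2 * (40 * (l2 G ^ 2) ^ 3)) := by
          have := l2_nonneg G
          rw [ENNReal.ofReal_mul (by positivity), ENNReal.ofReal_mul (by norm_num),
            ENNReal.ofReal_pow hC, ENNReal.ofReal_pow (by positivity), ENNReal.ofReal_pow this]
          norm_num
      _ ≤ ENNReal.ofReal ((7 * C * l2 G ^ 3) ^ 2) := by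
          refine ENNReal.ofReal_le_ofReal ?_
          have : 0 ≤ (C * l2 G ^ 3) ^ 2 := sq_nonneg _
          nlinarith
  have hm : Measurable fun x => ∫⁻ y, ‖f x y‖ₑ := hf.enorm.lintegral_prod_right'
  have hmeas : AEStronglyMeasurable (fun x => ∫ y, f x y) (volume : Measure Circ) :=
    (hf.stronglyMeasurable.integral_prod_right (f := f)).aestronglyMeasurable
  have hl : eLpNorm (fun x => ∫ y, f x y) 2 volume ^ 2 ≤
      ENNReal.ofReal (7 * C * l2 G ^ 3) ^ 2 := by
    rw [← lintegral_enorm_sq, ← ENNReal.ofReal_pow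
      (by have := l2_nonneg G; positivity)]
    exact (lintegral_mono fun x =>
      pow_le_pow_left' (enorm_integral_le_lintegral_enorm _) 2).trans hsq
  have hl' : eLpNorm (fun x => ∫ y, f x y) 2 volume ≤ ENNReal.ofReal (7 * C * l2 G ^ 3) :=
    (ENNReal.pow_le_pow_left_iff (by norm_num)).1 hl
  refine ⟨?_, ⟨hmeas, hl'.trans_lt ENNReal.ofReal_lt_top⟩, ?_⟩
  · have h1 := ae_lt_top (hm.pow_const 2) (hsq.trans_lt ENNReal.ofReal_lt_top).ne
    filter_upwards [h1] with x hx
    refine ⟨(hfx x).aestronglyMeasurable, ?_⟩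
    exact (ENNReal.pow_lt_top_iff.1 hx).resolve_right (by norm_num)
  · have := ENNReal.toReal_mono ENNReal.ofReal_ne_top hl'
    rwa [ENNReal.toReal_ofReal (by have := l2_nonneg G; positivity)] at this

theorem measurable_arcAvg {G : Circ → ℝ} (hG : Measurable G) :
    Measurable (Function.uncurry (arcAvg G)) := by
  have h : Measurable fun p : (Circ × Circ) × ℝ =>
      G (p.1.1 + ((p.2 * arc (p.1.2 - p.1.1) : ℝ) : Circ)) := by
    refine hG.comp (Measurable.add (by fun_prop) (measurable_coe_circ.comp ?_))
    exact measurable_snd.mul (measurable_arc.comp (by fun_prop))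
  have h2 := (h.stronglyMeasurable.integral_prod_right' (ν := volume.restrict (Ioc 0 1))).measurable
  have e : Function.uncurry (arcAvg G) = fun p => ∫ θ in Ioc (0 : ℝ) 1,
      G (p.1 + ((θ * arc (p.2 - p.1) : ℝ) : Circ)) := by
    funext p
    exact intervalIntegral.integral_of_le zero_le_one
  rw [e]
  exact h2

/-- The density `N · ∂ₓ²γ / |∂ₓγ|³` to which the kernel is applied. -/
def dens (p q : Circ → Plane) (y : Circ) : ℝ := inner ℝ (rotL (p y)) (q y) * (‖p y‖⁻¹) ^ 3

/-- The singular integral in the lower order term. -/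
def singInt (γ p q : Circ → Plane) (x : Circ) : ℝ := ∫ y, kern 0 γ p x y * dens p q y

/-- The derivative of `singInt`. -/
def singIntDeriv (γ p q : Circ → Plane) (x : Circ) : ℝ := ∫ y, kernDeriv 0 γ p q x y * dens p q y

theorem measurable_kern {γ p : Circ → Plane} (δ : ℝ) (hγ : Measurable γ) (hp : Measurable p) :
    Measurable (Function.uncurry (kern δ γ p)) := by
  have h1 : Measurable fun z : Circ × Circ => γ z.2 - γ z.1 := by fun_prop
  have h2 : Measurable fun z : Circ × Circ => rotL (p z.1) := by fun_prop
  have h3 : Measurable fun z : Circ × Circ => rotL (p z.2) := by fun_prop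
  have h4 : Measurable fun z : Circ × Circ => invChord δ (γ z.2 - γ z.1) := by
    unfold invChord; fun_prop
  exact ((h2.inner h1).mul (h3.inner h1)).mul (h4.pow_const 3)

theorem measurable_kernDeriv {γ p q : Circ → Plane} (δ : ℝ) (hγ : Measurable γ) (hp : Measurable p)
    (hq : Measurable q) : Measurable (Function.uncurry (kernDeriv δ γ p q)) := by
  have h1 : Measurable fun z : Circ × Circ => γ z.2 - γ z.1 := by fun_prop
  have h2 : Measurable fun z : Circ × Circ => rotL (p z.1) := by fun_prop
  have h3 : Measurable fun z : Circ × Circ => rotL (p z.2) := by fun_prop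
  have h5 : Measurable fun z : Circ × Circ => rotL (q z.1) := by fun_prop
  have h6 : Measurable fun z : Circ × Circ => p z.1 := by fun_prop
  have h4 : Measurable fun z : Circ × Circ => invChord δ (γ z.2 - γ z.1) := by
    unfold invChord; fun_prop
  exact ((((h5.inner h1).mul (h3.inner h1)).mul (h4.pow_const 3)).add
    (((h2.inner h1).mul (h3.inner h6)).mul (h4.pow_const 3)).neg).add
    ((((h2.inner h1).mul (h3.inner h1)).mul ((h4.pow_const 5).mul (h1.inner h6))).const_smul (3 : ℝ))

theorem measurable_dens {p q : Circ → Plane} (hp : Measurable p) (hq : Measurable q) :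
    Measurable (dens p q) := by
  have h3 : Measurable fun z : Circ => rotL (p z) := by fun_prop
  exact (h3.inner hq).mul ((hp.norm.inv).pow_const 3)

theorem tendsto_invChord {d : Plane} (hd : d ≠ 0) :
    Tendsto (fun δ : ℝ => invChord δ d) (𝓝[>] 0) (𝓝 (invChord 0 d)) := by
  have h : ContinuousAt (fun δ : ℝ => invChord δ d) 0 := by
    unfold invChord
    refine ContinuousAt.inv₀ (by fun_prop) ?_
    have : 0 < ‖d‖ := norm_pos_iff.2 hd
    exact (Real.sqrt_pos.2 (by positivity)).ne'
  exact h.tendsto.mono_left nhdsWithin_le_nhds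

theorem tendsto_kern (γ p : Circ → Plane) (x y : Circ) :
    Tendsto (fun δ => kern δ γ p x y) (𝓝[>] 0) (𝓝 (kern 0 γ p x y)) := by
  by_cases hd : γ y - γ x = 0
  · simp only [kern, hd, inner_zero_right, zero_mul, tendsto_const_nhds]
  · exact tendsto_const_nhds.mul ((tendsto_invChord hd).pow 3)

theorem tendsto_kernDeriv (γ p q : Circ → Plane) (x y : Circ) :
    Tendsto (fun δ => kernDeriv δ γ p q x y) (𝓝[>] 0) (𝓝 (kernDeriv 0 γ p q x y)) := by
  by_cases hd : γ y - γ x = 0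
  · simp only [kernDeriv, hd, inner_zero_right, zero_mul, neg_zero, smul_zero, add_zero,
      tendsto_const_nhds]
  · have h := tendsto_invChord hd
    exact ((tendsto_const_nhds.mul (h.pow 3)).add (tendsto_const_nhds.mul (h.pow 3)).neg).add
      ((tendsto_const_nhds.mul ((h.pow 5).mul_const _)).const_smul 3)

namespace CurvePair

variable {K D : ℝ} {γ₁ p₁ q₁ γ₂ p₂ q₂ : Circ → Plane} {G : Circ → ℝ}
  (P : CurvePair K D γ₁ p₁ q₁ γ₂ p₂ q₂ G)

include P

theorem symm : CurvePair K D γ₂ p₂ q₂ γ₁ p₁ q₁ G where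
  one_le := P.one_le
  D_nonneg := P.D_nonneg
  hγ₁ := P.hγ₂
  hp₁ := P.hp₂
  hγ₂ := P.hγ₁
  hp₂ := P.hp₁
  hq₁ := P.hq₂
  hq₂ := P.hq₁
  hG := P.hG
  memLp := P.memLp
  p x := ⟨(P.p x).right, (P.p x).left, by rw [norm_sub_rev]; exact (P.p x).sub⟩
  q x := ⟨(P.q x).right, (P.q x).left, by rw [norm_sub_rev]; exact (P.q x).sub⟩
  chord₁ := P.chord₂
  chord₂ := P.chord₁
  speed₁ := P.speed₂
  speed₂ := P.speed₁

theorem lip_invSpeed (x : Circ) : LipPair D (K ^ 3) (‖p₁ x‖⁻¹) (‖p₂ x‖⁻¹) := by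
  have hK := P.K_pos
  have low : ∀ {d : Plane}, 1 ≤ K * ‖d‖ → K⁻¹ ≤ ‖d‖ := by
    intro d hd
    rw [inv_le_iff_one_le_mul₀ hK, mul_comm]
    exact hd
  have h := LipPair.inv (D := D) (w := K) (inv_pos.2 hK) (low (P.speed₁ x)) (low (P.speed₂ x))
    ((abs_norm_sub_norm_le _ _).trans (P.p x).sub) ((inv_le_one_of_one_le₀ P.one_le).trans P.one_le)
  rwa [inv_inv, ← pow_succ'] at h

theorem lip_dens (y : Circ) : LipPair D (16 * K ^ 10 * G y) (dens p₁ q₁ y) (dens p₂ q₂ y) := by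
  have hD := P.D_nonneg
  have ρ := P.lip_invSpeed y
  have h := LipPair.mul hD ((P.p y).rotL.inner hD (P.q y)) (LipPair.mul hD (LipPair.mul hD ρ ρ) ρ)
  have e : ∀ p q : Circ → Plane, dens p q y =
      inner ℝ (rotL (p y)) (q y) * (‖p y‖⁻¹ * ‖p y‖⁻¹ * ‖p y‖⁻¹) := by
    intro p q
    rw [dens]; ring
  rw [e, e]
  exact h.mono hD (le_of_eq (by ring))

/-- The real weight of the derivative of the kernel. -/
theorem ofReal_weight_le (x y : Circ) :
    ENNReal.ofReal (G x * arcAvg G x y + arcAvg G x y ^ 2) ≤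
      singWeight (fun z => ENNReal.ofReal (G z)) x y := by
  have hm := P.arcAvg_nonneg x y
  have hG := P.G_nonneg x
  have h := ofReal_arcAvg_le P.G_nonneg x y
  rw [ENNReal.ofReal_add (by positivity) (by positivity), ENNReal.ofReal_mul hG,
    ENNReal.ofReal_pow hm]
  exact add_le_add (mul_le_mul_right h _) (pow_le_pow_left' h 2)

theorem enorm_le_of_weight {C r : ℝ} (hC : 0 ≤ C) (x y : Circ)
    (h : ‖r‖ ≤ C * ((G x * arcAvg G x y + arcAvg G x y ^ 2) * G y)) :
    ‖r‖ₑ ≤ ENNReal.ofReal C * (singWeight (fun z => ENNReal.ofReal (G z)) x y *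
      ENNReal.ofReal (G y)) := by
  have hm := P.arcAvg_nonneg x y
  have hG := P.G_nonneg x
  rw [← ofReal_norm]
  refine (ENNReal.ofReal_le_ofReal h).trans ?_
  rw [ENNReal.ofReal_mul hC, ENNReal.ofReal_mul (by positivity)]
  exact mul_le_mul_right (mul_le_mul_left (P.ofReal_weight_le x y) _) _

/-- The constant in the bounds for the singular integral. -/
theorem lip_kern_dens (x y : Circ) :
    LipPair D (102400 * K ^ 29 * ((G x * arcAvg G x y + arcAvg G x y ^ 2) * G y))
      (kern 0 γ₁ p₁ x y * dens p₁ q₁ y) (kern 0 γ₂ p₂ x y * dens p₂ q₂ y) ∧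
    LipPair D (102400 * K ^ 29 * ((G x * arcAvg G x y + arcAvg G x y ^ 2) * G y))
      (kernDeriv 0 γ₁ p₁ q₁ x y * dens p₁ q₁ y) (kernDeriv 0 γ₂ p₂ q₂ x y * dens p₂ q₂ y) := by
  have hD := P.D_nonneg
  have hK := P.K_pos
  have hm := P.arcAvg_nonneg x y
  have hG := P.G_nonneg x
  have hGy := P.G_nonneg y
  obtain ⟨h1, h2⟩ := P.lip_kern 0 x y
  have h3 := P.lip_dens y
  constructor
  · refine ((h1.mono (w' := 3200 * K ^ 19 * (G x * arcAvg G x y + arcAvg G x y ^ 2)) hD ?_).mul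
      hD h3).mono hD (le_of_eq ?_)
    · have a1 : |arc (y - x)| * arcAvg G x y ^ 2 ≤ G x * arcAvg G x y + arcAvg G x y ^ 2 := by
        have := mul_le_mul_of_nonneg_right (abs_arc_le (y - x)) (sq_nonneg (arcAvg G x y))
        nlinarith [mul_nonneg hG hm, sq_nonneg (arcAvg G x y)]
      have a2 : 64 * K ^ 11 ≤ 3200 * K ^ 19 := by
        have hp : K ^ 11 ≤ K ^ 19 := pow_le_pow_right₀ P.one_le (by norm_num)
        have : 0 ≤ K ^ 11 := by positivity
        linarith
      exact mul_le_mul a2 a1 (by positivity) (by positivity)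
    · ring
  · exact (h2.mul hD h3).mono hD (le_of_eq (by ring))

/-- For each fixed `y` the weight is the integrable majorant in `x` for the limit `δ → 0`. -/
theorem integrable_weight_left (y : Circ) :
    Integrable (fun x => G x * arcAvg G x y + arcAvg G x y ^ 2) := by
  have hm : Measurable fun x => arcAvg G x y := (measurable_arcAvg P.hG).of_uncurry_right
  refine ⟨((P.hG.mul hm).add (hm.pow_const 2)).aestronglyMeasurable, ?_⟩
  have h := lintegral_singWeight_left_lt_top (g := fun z => ENNReal.ofReal (G z))
    P.hG.ennreal_ofReal (by
      have := P.memLp.2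
      have e : ∫⁻ z, ENNReal.ofReal (G z) ^ 2 = eLpNorm G 2 volume ^ 2 := by
        rw [← lintegral_enorm_sq]
        exact lintegral_congr fun z => by rw [Real.enorm_of_nonneg (P.G_nonneg z)]
      rw [e]
      exact (ENNReal.pow_lt_top this).ne) y
  refine lt_of_le_of_lt (lintegral_mono fun x => ?_) h
  have hm := P.arcAvg_nonneg x y
  have hG := P.G_nonneg x
  rw [Real.enorm_of_nonneg (by positivity)]
  exact P.ofReal_weight_le x y

theorem integrable_arcAvg_mul (x : Circ) : Integrable (fun y => arcAvg G x y * G y) := by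
  have hm : Measurable fun y => arcAvg G x y := (measurable_arcAvg P.hG).of_uncurry_left
  refine MemLp.integrable_mul (p := 2) (q := 2) ⟨hm.aestronglyMeasurable, ?_⟩ P.memLp
  have h := lintegral_arcMean_sq_right (g := fun z => ENNReal.ofReal (G z)) P.hG.ennreal_ofReal x
  have e : ∫⁻ z, ENNReal.ofReal (G z) ^ 2 = eLpNorm G 2 volume ^ 2 := by
    rw [← lintegral_enorm_sq]
    exact lintegral_congr fun z => by rw [Real.enorm_of_nonneg (P.G_nonneg z)]
  rw [e] at h
  have h2 : eLpNorm (fun y => arcAvg G x y) 2 volume ^ 2 < ⊤ := by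
    rw [← lintegral_enorm_sq]
    refine lt_of_le_of_lt (lintegral_mono fun y => pow_le_pow_left' ?_ 2)
      (h.trans_lt (ENNReal.mul_lt_top (by norm_num) (ENNReal.pow_lt_top P.memLp.2)))
    rw [Real.enorm_of_nonneg (P.arcAvg_nonneg x y)]
    exact ofReal_arcAvg_le P.G_nonneg x y
  exact (ENNReal.pow_lt_top_iff.1 h2).resolve_right (by norm_num)

theorem measurable_p : Measurable p₁ := P.hp₁.continuous.measurable

theorem measurable_γ : Measurable γ₁ := P.hγ₁.continuous.measurable

/-- Integrability is needed at every `x`. One power of the mean is removed by `|arc| * arcAvg ≤ l2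
G`, and the other is square integrable by Hardy. -/
theorem integrable_kern_mul_dens (x : Circ) :
    Integrable (fun y => kern 0 γ₁ p₁ x y * dens p₁ q₁ y) := by
  have hK := P.K_pos
  refine Integrable.mono' ((P.integrable_arcAvg_mul x).const_mul
    (64 * K ^ 11 * l2 G * (16 * K ^ 10))) ?_ (ae_of_all _ fun y => ?_)
  · exact ((measurable_kern 0 P.measurable_γ P.measurable_p).of_uncurry_left.mul
      (measurable_dens P.measurable_p P.hq₁)).aestronglyMeasurable
  · have hm := P.arcAvg_nonneg x y
    have h1 := (P.lip_kern 0 x y).1.left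
    have h2 := (P.lip_dens y).left
    have h3 := (P.lip_basic x y).2.2.2.2
    rw [norm_mul]
    calc _ ≤ 64 * K ^ 11 * (|arc (y - x)| * arcAvg G x y ^ 2) * (16 * K ^ 10 * G y) :=
          mul_le_mul h1 h2 (norm_nonneg _) (by positivity)
      _ = 64 * K ^ 11 * (|arc (y - x)| * arcAvg G x y) * (16 * K ^ 10) *
          (arcAvg G x y * G y) := by ring
      _ ≤ _ := by
          refine mul_le_mul_of_nonneg_right ?_ (mul_nonneg hm (P.G_nonneg y))
          gcongr

/-- The fundamental theorem holds for the regularised kernels and passes to `δ → 0` by dominated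
convergence, because the bounds of `lip_kern` do not involve `δ`. -/
theorem kern_sub (y : Circ) (a b : ℝ) : kern 0 γ₁ p₁ b y - kern 0 γ₁ p₁ a y =
    ∫ s in a..b, kernDeriv 0 γ₁ p₁ q₁ (s : Circ) y := by
  have h1 : Tendsto (fun δ => kern δ γ₁ p₁ b y - kern δ γ₁ p₁ a y) (𝓝[>] 0)
      (𝓝 (kern 0 γ₁ p₁ b y - kern 0 γ₁ p₁ a y)) :=
    (tendsto_kern _ _ _ _).sub (tendsto_kern _ _ _ _)
  have h2 : Tendsto (fun δ => ∫ s in a..b, kernDeriv δ γ₁ p₁ q₁ (s : Circ) y) (𝓝[>] 0)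
      (𝓝 (∫ s in a..b, kernDeriv 0 γ₁ p₁ q₁ (s : Circ) y)) := by
    refine intervalIntegral.tendsto_integral_filter_of_dominated_convergence
      (fun s => 3200 * K ^ 19 * (G s * arcAvg G s y + arcAvg G s y ^ 2))
      (Eventually.of_forall fun δ => ?_)
      (Eventually.of_forall fun δ => ae_of_all _ fun s _ => (P.lip_kern δ s y).2.left)
      ((intervalIntegrable_lift (P.integrable_weight_left y) a b).const_mul _)
      (ae_of_all _ fun s _ => tendsto_kernDeriv _ _ _ _ _)
    exact ((measurable_kernDeriv δ P.measurable_γ P.measurable_p P.hq₁).of_uncurry_right.comp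
      measurable_coe_circ).aestronglyMeasurable
  refine tendsto_nhds_unique h1 (h2.congr' ?_)
  filter_upwards [self_mem_nhdsWithin] with δ hδ
  exact ((hasL2Deriv_kern hδ P.hγ₁ P.hp₁ y).eq a b).symm

theorem singular_deriv : (∀ᵐ x, Integrable fun y => kernDeriv 0 γ₁ p₁ q₁ x y * dens p₁ q₁ y) ∧
    MemLp (singIntDeriv γ₁ p₁ q₁) 2 volume ∧
    l2 (singIntDeriv γ₁ p₁ q₁) ≤ 7 * (102400 * K ^ 29) * l2 G ^ 3 := by
  have hK := P.K_pos
  exact singular_integral (f := fun x y => kernDeriv 0 γ₁ p₁ q₁ x y * dens p₁ q₁ y) P.hG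
    P.G_nonneg P.memLp (by positivity)
    ((measurable_kernDeriv 0 P.measurable_γ P.measurable_p P.hq₁).mul
      ((measurable_dens P.measurable_p P.hq₁).comp measurable_snd))
    fun x y => P.enorm_le_of_weight (by positivity) x y (P.lip_kern_dens x y).2.left

/-- The increments of the kernel are integrated against the density, and Fubini exchanges the two
integrals; absolute integrability is `singular_integral` applied to the norm of the integrand. -/
theorem hasL2Deriv_singInt : HasL2Deriv (singInt γ₁ p₁ q₁) (singIntDeriv γ₁ p₁ q₁) := by
  have hK := P.K_pos
  have hmeas : Measurable (Function.uncurry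
      fun x y => kernDeriv 0 γ₁ p₁ q₁ x y * dens p₁ q₁ y) :=
    (measurable_kernDeriv 0 P.measurable_γ P.measurable_p P.hq₁).mul
      ((measurable_dens P.measurable_p P.hq₁).comp measurable_snd)
  have hnorm := (singular_integral (f := fun x y => ‖kernDeriv 0 γ₁ p₁ q₁ x y * dens p₁ q₁ y‖)
    P.hG P.G_nonneg P.memLp (C := 102400 * K ^ 29) (by positivity) hmeas.norm
    fun x y => P.enorm_le_of_weight (by positivity) x y
      ((norm_norm _).trans_le (P.lip_kern_dens x y).2.left)).2.1.integrable (by norm_num)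
  obtain ⟨hint, hmem, -⟩ := P.singular_deriv
  refine ⟨hmem, fun a b => ?_⟩
  rw [singInt, singInt, ← integral_sub (P.integrable_kern_mul_dens _)
    (P.integrable_kern_mul_dens _)]
  simp only [singIntDeriv]
  have hswap : Integrable (Function.uncurry fun (s : ℝ) (y : Circ) =>
      kernDeriv 0 γ₁ p₁ q₁ (s : Circ) y * dens p₁ q₁ y)
      ((volume.restrict (uIoc a b)).prod (volume : Measure Circ)) := by
    refine (integrable_prod_iff ?_).2 ⟨ae_restrict_of_ae (ae_real_of_ae_circ hint), ?_⟩
    · exact (hmeas.comp (measurable_coe_circ.prodMap measurable_id)).aestronglyMeasurable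
    · exact intervalIntegrable_iff.1 (intervalIntegrable_lift hnorm a b)
  rw [intervalIntegral_integral_swap hswap]
  refine integral_congr_ae (ae_of_all _ fun y => ?_)
  simp only
  rw [intervalIntegral.integral_mul_const, ← P.kern_sub]
  ring

end CurvePair

/-! ### Lipschitz estimates in `H¹` -/

/-- Two functions in `H¹` of size `C` at distance `D C`. -/
structure H1Pair {Y : Type*} [NormedAddCommGroup Y] [NormedSpace ℝ Y] (D C : ℝ)
    (U U' V V' : Circ → Y) : Prop where
  left : HasL2Deriv U U'
  right : HasL2Deriv V V'
  val : ∀ x, LipPair D C (U x) (V x)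
  l2_left : l2 U' ≤ C
  l2_right : l2 V' ≤ C
  l2_sub : l2 (fun x => U' x - V' x) ≤ D * C

namespace H1Pair

variable {Y Z W : Type*} [NormedAddCommGroup Y] [NormedSpace ℝ Y] [CompleteSpace Y]
  [NormedAddCommGroup Z] [NormedSpace ℝ Z] [CompleteSpace Z]
  [NormedAddCommGroup W] [NormedSpace ℝ W] [CompleteSpace W]
  {D C C' : ℝ} {U U' V V' : Circ → Y} {S S' T T' : Circ → Z}

theorem nonneg (h : H1Pair D C U U' V V') : 0 ≤ C := (l2_nonneg _).trans h.l2_left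

theorem mono (hD : 0 ≤ D) (h : H1Pair D C U U' V V') (hC : C ≤ C') : H1Pair D C' U U' V V' :=
  ⟨h.left, h.right, fun x => (h.val x).mono hD hC, h.l2_left.trans hC, h.l2_right.trans hC,
    h.l2_sub.trans (mul_le_mul_of_nonneg_left hC hD)⟩

theorem clm (A : Y →L[ℝ] Z) (hA : ∀ y, ‖A y‖ ≤ ‖y‖) (h : H1Pair D C U U' V V') :
    H1Pair D C (fun x => A (U x)) (fun x => A (U' x)) (fun x => A (V x)) (fun x => A (V' x)) where
  left := h.left.clm A
  right := h.right.clm A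
  val x := (h.val x).clm A hA
  l2_left := (l2_le_of_ae zero_le_one h.left.memLp
    (ae_of_all _ fun x => by rw [one_mul]; exact hA _)).trans (by rw [one_mul]; exact h.l2_left)
  l2_right := (l2_le_of_ae zero_le_one h.right.memLp
    (ae_of_all _ fun x => by rw [one_mul]; exact hA _)).trans (by rw [one_mul]; exact h.l2_right)
  l2_sub := (l2_le_of_ae zero_le_one (h.left.memLp.sub h.right.memLp)
    (ae_of_all _ fun x => by rw [one_mul, ← map_sub]; exact hA _)).trans
      (by rw [one_mul]; exact h.l2_sub)

theorem l2_bilin_left {B : Y →L[ℝ] Z →L[ℝ] W} (hB : ∀ y z, ‖B y z‖ ≤ ‖y‖ * ‖z‖) {a b : ℝ}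
    {f : Circ → Y} {g : Circ → Z} (ha : 0 ≤ a) (hf : ∀ x, ‖f x‖ ≤ a) (hg : MemLp g 2 volume)
    (hgb : l2 g ≤ b) : l2 (fun x => B (f x) (g x)) ≤ a * b :=
  (l2_le_of_ae ha hg (ae_of_all _ fun x => (hB _ _).trans
    (mul_le_mul_of_nonneg_right (hf x) (norm_nonneg _)))).trans (mul_le_mul_of_nonneg_left hgb ha)

theorem l2_bilin_right {B : Y →L[ℝ] Z →L[ℝ] W} (hB : ∀ y z, ‖B y z‖ ≤ ‖y‖ * ‖z‖) {a b : ℝ}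
    {f : Circ → Y} {g : Circ → Z} (hb : 0 ≤ b) (hg : ∀ x, ‖g x‖ ≤ b) (hf : MemLp f 2 volume)
    (hfa : l2 f ≤ a) : l2 (fun x => B (f x) (g x)) ≤ a * b :=
  (l2_le_of_ae hb hf (ae_of_all _ fun x => (hB _ _).trans (by
    rw [mul_comm]; exact mul_le_mul_of_nonneg_right (hg x) (norm_nonneg _)))).trans
      (by rw [mul_comm]; exact mul_le_mul_of_nonneg_right hfa hb)

theorem memLp_bilin_left {B : Y →L[ℝ] Z →L[ℝ] W} (hB : ∀ y z, ‖B y z‖ ≤ ‖y‖ * ‖z‖) {a : ℝ}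
    {f : Circ → Y} {g : Circ → Z} (hf : ∀ x, ‖f x‖ ≤ a) (hfm : Continuous f)
    (hg : MemLp g 2 volume) : MemLp (fun x => B (f x) (g x)) 2 volume :=
  MemLp.of_le_mul (c := a) hg (B.aestronglyMeasurable_comp₂ hfm.aestronglyMeasurable hg.1)
    (ae_of_all _ fun x => (hB _ _).trans (mul_le_mul_of_nonneg_right (hf x) (norm_nonneg _)))

theorem memLp_bilin_right {B : Y →L[ℝ] Z →L[ℝ] W} (hB : ∀ y z, ‖B y z‖ ≤ ‖y‖ * ‖z‖) {b : ℝ}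
    {f : Circ → Y} {g : Circ → Z} (hg : ∀ x, ‖g x‖ ≤ b) (hgm : Continuous g)
    (hf : MemLp f 2 volume) : MemLp (fun x => B (f x) (g x)) 2 volume :=
  MemLp.of_le_mul (c := b) hf (B.aestronglyMeasurable_comp₂ hf.1 hgm.aestronglyMeasurable)
    (ae_of_all _ fun x => (hB _ _).trans (by
      rw [mul_comm]; exact mul_le_mul_of_nonneg_right (hg x) (norm_nonneg _)))

/-- The difference of the two derivatives telescopes into four products, each with one factor
bounded uniformly and the other in `L²`. -/
theorem bilin (B : Y →L[ℝ] Z →L[ℝ] W) (hB : ∀ y z, ‖B y z‖ ≤ ‖y‖ * ‖z‖) (hD : 0 ≤ D)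
    (h : H1Pair D C U U' V V') (k : H1Pair D C' S S' T T') :
    H1Pair D (4 * (C * C')) (fun x => B (U x) (S x)) (fun x => B (U' x) (S x) + B (U x) (S' x))
      (fun x => B (V x) (T x)) (fun x => B (V' x) (T x) + B (V x) (T' x)) := by
  have hC := h.nonneg
  have hC' := k.nonneg
  have h0 : 0 ≤ C * C' := mul_nonneg hC hC'
  refine ⟨h.left.bilin B k.left, h.right.bilin B k.right, fun x =>
    ((h.val x).bilin B hB hD (k.val x)).mono hD (by linarith), ?_, ?_, ?_⟩
  · have := l2_add_le
      (memLp_bilin_right hB (fun x => (k.val x).left) k.left.continuous h.left.memLp)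
      (memLp_bilin_left hB (fun x => (h.val x).left) h.left.continuous k.left.memLp)
    have h1 := l2_bilin_right hB hC' (fun x => (k.val x).left) h.left.memLp h.l2_left
    have h2 := l2_bilin_left hB hC (fun x => (h.val x).left) k.left.memLp k.l2_left
    linarith
  · have := l2_add_le
      (memLp_bilin_right hB (fun x => (k.val x).right) k.right.continuous h.right.memLp)
      (memLp_bilin_left hB (fun x => (h.val x).right) h.right.continuous k.right.memLp)
    have h1 := l2_bilin_right hB hC' (fun x => (k.val x).right) h.right.memLp h.l2_right
    have h2 := l2_bilin_left hB hC (fun x => (h.val x).right) k.right.memLp k.l2_right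
    linarith
  · have e : (fun x => B (U' x) (S x) + B (U x) (S' x) - (B (V' x) (T x) + B (V x) (T' x))) =
        fun x => (B (U' x - V' x) (S x) + B (V' x) (S x - T x)) +
          (B (U x - V x) (S' x) + B (V x) (S' x - T' x)) := by
      funext x
      simp only [map_sub, sub_apply]
      abel
    have m1 := memLp_bilin_right hB (fun x => (k.val x).left) k.left.continuous
      (h.left.memLp.sub h.right.memLp)
    have m2 := memLp_bilin_right hB (fun x => (k.val x).sub)
      (k.left.continuous.sub k.right.continuous) h.right.memLp
    have m3 := memLp_bilin_left hB (fun x => (h.val x).sub)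
      (h.left.continuous.sub h.right.continuous) k.left.memLp
    have m4 := memLp_bilin_left hB (fun x => (h.val x).right) h.right.continuous
      (k.left.memLp.sub k.right.memLp)
    have l1 := l2_bilin_right hB hC' (fun x => (k.val x).left)
      (h.left.memLp.sub h.right.memLp) h.l2_sub
    have l2' := l2_bilin_right hB (mul_nonneg hD hC') (fun x => (k.val x).sub) h.right.memLp
      h.l2_right
    have l3 := l2_bilin_left hB (mul_nonneg hD hC) (fun x => (h.val x).sub) k.left.memLp k.l2_left
    have l4 := l2_bilin_left hB hC (fun x => (h.val x).right)
      (k.left.memLp.sub k.right.memLp) k.l2_sub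
    have a := (l2_add_le (m1.add m2) (m3.add m4)).trans
      (add_le_add (l2_add_le m1 m2) (l2_add_le m3 m4))
    rw [e]
    refine a.trans ((add_le_add (add_le_add l1 l2') (add_le_add l3 l4)).trans (le_of_eq ?_))
    ring

theorem smul (hD : 0 ≤ D) {U U' V V' : Circ → ℝ} (h : H1Pair D C U U' V V')
    (k : H1Pair D C' S S' T T') :
    H1Pair D (4 * (C * C')) (fun x => U x • S x) (fun x => U' x • S x + U x • S' x)
      (fun x => V x • T x) (fun x => V' x • T x + V x • T' x) :=
  bilin (ContinuousLinearMap.lsmul ℝ ℝ) (fun y z => (norm_smul y z).le) hD h k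

theorem inner (hD : 0 ≤ D) {U U' V V' S S' T T' : Circ → Plane} (h : H1Pair D C U U' V V')
    (k : H1Pair D C' S S' T T') :
    H1Pair D (4 * (C * C')) (fun x => inner ℝ (U x) (S x))
      (fun x => inner ℝ (U' x) (S x) + inner ℝ (U x) (S' x))
      (fun x => inner ℝ (V x) (T x)) (fun x => inner ℝ (V' x) (T x) + inner ℝ (V x) (T' x)) :=
  bilin (innerSL ℝ) (fun y z => norm_inner_le_norm y z) hD h k

theorem hasL2Deriv_inv {U U' : Circ → ℝ} {ℓ : ℝ} (hℓ : 0 < ℓ) (h : HasL2Deriv U U')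
    (hU : ∀ x, ℓ ≤ U x) : HasL2Deriv (fun x => (U x)⁻¹) (fun x => -((U x)⁻¹ ^ 2) * U' x) := by
  obtain ⟨b, hb⟩ := isCompact_univ.exists_bound_of_continuousOn h.continuous.continuousOn
  refine h.comp_real (φ := fun s => s⁻¹) (φ' := fun s => -(s⁻¹ ^ 2)) (a := ℓ) (b := b)
    (fun s hs => ?_) ?_ fun x => ⟨hU x, (le_abs_self _).trans (hb x (mem_univ x))⟩
  · have := hasDerivAt_inv (hℓ.trans_le hs.1).ne'
    rwa [inv_pow]
  · exact ((continuousOn_inv₀.mono fun s hs => (hℓ.trans_le hs.1).ne').pow 2).neg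

theorem inv {U U' V V' : Circ → ℝ} {ℓ : ℝ} (hD : 0 ≤ D) (hℓ : 0 < ℓ) (h : H1Pair D C U U' V V')
    (hU : ∀ x, ℓ ≤ U x) (hV : ∀ x, ℓ ≤ V x) :
    H1Pair D (C * ℓ⁻¹ ^ 2 + 3 * (C * ℓ⁻¹ ^ 2) ^ 2 * C) (fun x => (U x)⁻¹)
      (fun x => -((U x)⁻¹ ^ 2) * U' x) (fun x => (V x)⁻¹) (fun x => -((V x)⁻¹ ^ 2) * V' x) := by
  have hC := h.nonneg
  have hval : ∀ x, LipPair D (C * ℓ⁻¹ ^ 2) (U x)⁻¹ (V x)⁻¹ := fun x =>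
    LipPair.inv hℓ (hU x) (hV x) (h.val x).sub ((hU x).trans ((le_abs_self _).trans (h.val x).left))
  set w := C * ℓ⁻¹ ^ 2 with hw
  have hw0 : 0 ≤ w := (hval 0).nonneg
  have hsq : ∀ x, LipPair D (2 * (w * w)) (-((U x)⁻¹ ^ 2)) (-((V x)⁻¹ ^ 2)) := fun x => by
    rw [sq, sq]
    exact ((hval x).mul hD (hval x)).neg
  have hB : ∀ y z : ℝ, ‖ContinuousLinearMap.mul ℝ ℝ y z‖ ≤ ‖y‖ * ‖z‖ := fun y z => (norm_mul y z).le
  have iU := hasL2Deriv_inv hℓ h.left hU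
  have iV := hasL2Deriv_inv hℓ h.right hV
  have h2w : 0 ≤ 2 * (w * w) := by positivity
  have l1 := l2_bilin_left hB h2w (fun x => (hsq x).left) h.left.memLp h.l2_left
  have l1' := l2_bilin_left hB h2w (fun x => (hsq x).right) h.right.memLp h.l2_right
  have hwC : 0 ≤ w ^ 2 * C := by positivity
  refine ⟨iU, iV, fun x => (hval x).mono hD (by nlinarith), ?_, ?_, ?_⟩
  · exact l1.trans (by nlinarith)
  · exact l1'.trans (by nlinarith)
  · have hs1 : ∀ x, ‖(V x)⁻¹ ^ 2‖ ≤ w ^ 2 := fun x => by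
      rw [norm_pow]
      exact pow_le_pow_left₀ (norm_nonneg _) (hval x).right 2
    have cU : Continuous fun x => (U x)⁻¹ := iU.continuous
    have cV : Continuous fun x => (V x)⁻¹ := iV.continuous
    have m1 := memLp_bilin_left hB (fun x => (hsq x).sub) ((cU.pow 2).neg.sub (cV.pow 2).neg)
      h.left.memLp
    have m2 := memLp_bilin_left hB hs1 (cV.pow 2) (h.right.memLp.sub h.left.memLp)
    have k1 := l2_bilin_left hB (mul_nonneg hD h2w) (fun x => (hsq x).sub) h.left.memLp h.l2_left
    have k2 := l2_bilin_left hB (sq_nonneg w) hs1 (h.right.memLp.sub h.left.memLp)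
      ((l2_sub_comm V' U').trans_le h.l2_sub)
    have e : (fun x => -((U x)⁻¹ ^ 2) * U' x - -((V x)⁻¹ ^ 2) * V' x) = fun x =>
        ContinuousLinearMap.mul ℝ ℝ (-((U x)⁻¹ ^ 2) - -((V x)⁻¹ ^ 2)) (U' x) +
          ContinuousLinearMap.mul ℝ ℝ ((V x)⁻¹ ^ 2) (V' x - U' x) := by
      funext x
      simp only [ContinuousLinearMap.mul_apply']
      ring
    rw [e]
    refine (l2_add_le m1 m2).trans ((add_le_add k1 k2).trans ?_)
    have : 0 ≤ D * w := mul_nonneg hD hw0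
    nlinarith

end H1Pair

namespace CurvePair

variable {K D : ℝ} {γ₁ p₁ q₁ γ₂ p₂ q₂ : Circ → Plane} {G : Circ → ℝ}
  (P : CurvePair K D γ₁ p₁ q₁ γ₂ p₂ q₂ G)

include P

theorem h1Pair_p : H1Pair D (K + l2 G) p₁ q₁ p₂ q₂ := by
  have hK := P.K_pos
  have hG := l2_nonneg G
  have key : ∀ {f : Circ → Plane} {C : ℝ}, 0 ≤ C → (∀ x, ‖f x‖ ≤ C * G x) → l2 f ≤ C * l2 G :=
    fun hC h => l2_le_of_ae hC P.memLp (ae_of_all _ fun x => by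
      rw [Real.norm_of_nonneg (P.G_nonneg x)]; exact h x)
  refine ⟨P.hp₁, P.hp₂, fun x => (P.p x).mono P.D_nonneg (by linarith), ?_, ?_, ?_⟩
  · have := key zero_le_one fun x => by rw [one_mul]; exact (P.q x).left
    linarith
  · have := key zero_le_one fun x => by rw [one_mul]; exact (P.q x).right
    linarith
  · have := key P.D_nonneg fun x => (P.q x).sub
    exact this.trans (mul_le_mul_of_nonneg_left (by linarith) P.D_nonneg)

/-- The difference of two integrals is a singular integral whose kernel obeys the same bound
multiplied by `D`. -/
theorem l2_integral_sub {f₁ f₂ : Circ → Circ → ℝ} {C : ℝ} (hC : 0 ≤ C)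
    (hm₁ : Measurable (Function.uncurry f₁)) (hm₂ : Measurable (Function.uncurry f₂))
    (h : ∀ x y, LipPair D (C * ((G x * arcAvg G x y + arcAvg G x y ^ 2) * G y)) (f₁ x y) (f₂ x y)) :
    l2 (fun x => ∫ y, f₁ x y) ≤ 7 * C * l2 G ^ 3 ∧
      l2 (fun x => (∫ y, f₁ x y) - ∫ y, f₂ x y) ≤ D * (7 * C * l2 G ^ 3) := by
  have h1 := singular_integral P.hG P.G_nonneg P.memLp hC hm₁
    fun x y => P.enorm_le_of_weight hC x y (h x y).left
  have h2 := singular_integral P.hG P.G_nonneg P.memLp hC hm₂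
    fun x y => P.enorm_le_of_weight hC x y (h x y).right
  have h3 := singular_integral (f := fun x y => f₁ x y - f₂ x y) P.hG P.G_nonneg P.memLp
    (mul_nonneg P.D_nonneg hC) (hm₁.sub hm₂)
    fun x y => P.enorm_le_of_weight (mul_nonneg P.D_nonneg hC) x y
      ((h x y).sub.trans (le_of_eq (by ring)))
  refine ⟨h1.2.2, ?_⟩
  have e : l2 (fun x => (∫ y, f₁ x y) - ∫ y, f₂ x y) = l2 (fun x => ∫ y, (f₁ x y - f₂ x y)) := by
    refine l2_congr ?_
    filter_upwards [h1.1, h2.1] with x i1 i2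
    exact (integral_sub i1 i2).symm
  rw [e]
  exact h3.2.2.trans (le_of_eq (by ring))

/-- The kernel and its derivative satisfy bounds with one common weight, so both `L²` norms are
treated alike; the uniform bounds then follow from the Sobolev embedding, which accounts for the
factor `2`. -/
theorem h1Pair_singInt : H1Pair D (2 * (7 * (102400 * K ^ 29) * l2 G ^ 3))
    (singInt γ₁ p₁ q₁) (singIntDeriv γ₁ p₁ q₁) (singInt γ₂ p₂ q₂) (singIntDeriv γ₂ p₂ q₂) := by
  have hK := P.K_pos
  have hC : 0 ≤ 102400 * K ^ 29 := by positivity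
  have Q := P.symm
  have s1 : Measurable (Function.uncurry fun x y => kern 0 γ₁ p₁ x y * dens p₁ q₁ y) :=
    (measurable_kern 0 P.measurable_γ P.measurable_p).mul
      ((measurable_dens P.measurable_p P.hq₁).comp measurable_snd)
  have s2 : Measurable (Function.uncurry fun x y => kern 0 γ₂ p₂ x y * dens p₂ q₂ y) :=
    (measurable_kern 0 Q.measurable_γ Q.measurable_p).mul
      ((measurable_dens Q.measurable_p Q.hq₁).comp measurable_snd)
  have d1 : Measurable (Function.uncurry fun x y => kernDeriv 0 γ₁ p₁ q₁ x y * dens p₁ q₁ y) :=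
    (measurable_kernDeriv 0 P.measurable_γ P.measurable_p P.hq₁).mul
      ((measurable_dens P.measurable_p P.hq₁).comp measurable_snd)
  have d2 : Measurable (Function.uncurry fun x y => kernDeriv 0 γ₂ p₂ q₂ x y * dens p₂ q₂ y) :=
    (measurable_kernDeriv 0 Q.measurable_γ Q.measurable_p Q.hq₁).mul
      ((measurable_dens Q.measurable_p Q.hq₁).comp measurable_snd)
  obtain ⟨a1, a2⟩ := P.l2_integral_sub hC s1 s2 fun x y => (P.lip_kern_dens x y).1
  obtain ⟨b1, b2⟩ := P.l2_integral_sub hC d1 d2 fun x y => (P.lip_kern_dens x y).2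
  obtain ⟨a1', -⟩ := Q.l2_integral_sub hC s2 s1 fun x y => (Q.lip_kern_dens x y).1
  obtain ⟨b1', -⟩ := Q.l2_integral_sub hC d2 d1 fun x y => (Q.lip_kern_dens x y).2
  have i1 := P.hasL2Deriv_singInt
  have i2 := Q.hasL2Deriv_singInt
  have hM : 0 ≤ 7 * (102400 * K ^ 29) * l2 G ^ 3 := by have := l2_nonneg G; positivity
  set M := 7 * (102400 * K ^ 29) * l2 G ^ 3
  have hDM : D * M ≤ D * (2 * M) := mul_le_mul_of_nonneg_left (by linarith) P.D_nonneg
  refine ⟨i1, i2, fun x => ⟨?_, ?_, ?_⟩, b1.trans (by linarith), b1'.trans (by linarith),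
    b2.trans hDM⟩
  · exact (i1.norm_le x).trans ((add_le_add a1 b1).trans (by linarith))
  · exact (i2.norm_le x).trans ((add_le_add a1' b1').trans (by linarith))
  · exact ((i1.sub i2).norm_le x).trans ((add_le_add a2 b2).trans (le_of_eq (by ring)))

end CurvePair

/-! ### The operators on `H²` -/

namespace H

theorem ofDeriv_congr {U U' V' : Circ → Plane} (h : HasL2Deriv U U') (k : HasL2Deriv U V') :
    ofDeriv h = ofDeriv k :=
  ext_toL2_ae ((coeFn_ofDeriv h).trans (coeFn_ofDeriv k).symm)

open Classical in
/-- The element of `H¹` given by a function, and zero if the function is not in `H¹`. -/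
def ofFun (U : Circ → Plane) : H 1 := if h : ∃ U', HasL2Deriv U U' then ofDeriv h.choose_spec else 0

theorem ofFun_eq {U U' : Circ → Plane} (h : HasL2Deriv U U') : ofFun U = ofDeriv h := by
  have h' : ∃ U', HasL2Deriv U U' := ⟨U', h⟩
  rw [ofFun, dif_pos h']
  exact ofDeriv_congr _ _

theorem mulL_congr {a a' b' : Circ → ℝ} (h : HasL2Deriv a a') (k : HasL2Deriv a b') :
    mulL h = mulL k := by
  ext1 u
  refine ext_toL2_ae ?_
  filter_upwards [toL2_mulL h u, toL2_mulL k u] with x h1 h2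
  rw [h1, h2]

open Classical in
/-- Multiplication by a function in `H¹`, and zero if the function is not in `H¹`. -/
def mulOf (a : Circ → ℝ) : H 1 →L[ℝ] H 1 := if h : ∃ a', HasL2Deriv a a' then mulL h.choose_spec else 0

theorem mulOf_eq {a a' : Circ → ℝ} (h : HasL2Deriv a a') : mulOf a = mulL h := by
  have h' : ∃ a', HasL2Deriv a a' := ⟨a', h⟩
  rw [mulOf, dif_pos h']
  exact mulL_congr _ _

/-- The curve `γ`. -/
def curve (γ : H 2) : Circ → Plane := γ.rep 0

/-- The velocity `∂ₓγ`. -/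
def vel (γ : H 2) : Circ → Plane := γ.rep 1

/-- The acceleration `∂ₓ²γ`. -/
def acc (γ : H 2) : Circ → Plane := γ.der 2

theorem curve_ae (γ : H 2) : γ.toL2 =ᵐ[volume] γ.curve := γ.coeFn_rep 0

theorem vel_ae (γ : H 2) : γ.der 1 =ᵐ[volume] γ.vel := γ.coeFn_rep 1

theorem hasL2Deriv_curve (γ : H 2) : HasL2Deriv γ.curve γ.vel :=
  (γ.hasL2Deriv_rep 0).congr_ae γ.vel_ae

theorem hasL2Deriv_vel (γ : H 2) : HasL2Deriv γ.vel γ.acc := γ.hasL2Deriv_rep 1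

theorem measurable_acc (γ : H 2) : Measurable γ.acc := (Lp.stronglyMeasurable _).measurable

theorem norm_vel_le (γ : H 2) (x : Circ) : ‖γ.vel x‖ ≤ 2 * ‖γ‖ := γ.norm_rep_le 1 x

theorem norm_vel_sub_le (γ η : H 2) (x : Circ) : ‖γ.vel x - η.vel x‖ ≤ 2 * ‖γ - η‖ := by
  have := (γ - η).norm_rep_le 1 x
  rwa [rep_sub] at this

theorem norm_curve_sub_le (γ : H 2) (x y : Circ) :
    ‖γ.curve y - γ.curve x‖ ≤ 2 * ‖γ‖ * ‖y - x‖ := by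
  induction x using QuotientAddGroup.induction_on with | H s =>
  have hy : y = ((s + arc (y - (s : Circ)) : ℝ) : Circ) := by
    rw [AddCircle.coe_add, coe_arc]
    abel
  have h1 := γ.hasL2Deriv_curve.eq s (s + arc (y - (s : Circ)))
  rw [← hy] at h1
  have h2 := intervalIntegral.norm_integral_le_of_norm_le_const (a := s)
    (b := s + arc (y - (s : Circ))) (f := fun t : ℝ => γ.vel t) (C := 2 * ‖γ‖)
    fun t _ => γ.norm_vel_le t
  rw [← h1, add_sub_cancel_left, ← norm_eq_abs_arc] at h2
  exact h2

theorem curve_sub (γ η : H 2) : (γ - η).curve = fun x => γ.curve x - η.curve x := rep_sub γ η 0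

/-- Quantitative membership in `V`. -/
structure Regular (K : ℝ) (γ : H 2) : Prop where
  norm_le : 2 * ‖γ‖ ≤ K
  chord : ∀ x y, ‖y - x‖ ≤ K * ‖γ.curve y - γ.curve x‖
  speed : ∀ x, 1 ≤ K * ‖γ.vel x‖

/-- The velocity is continuous, so the curve is differentiable everywhere and the chord bound passes
to the limit of difference quotients. -/
theorem speed_of_chord {γ : H 2} {c : ℝ}
    (h : ∀ x y, c * ‖y - x‖ ≤ ‖γ.curve y - γ.curve x‖) (x : Circ) : c ≤ ‖γ.vel x‖ := by
  induction x using QuotientAddGroup.induction_on with | H s =>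
  have hc : Continuous fun t : ℝ => γ.vel t := γ.hasL2Deriv_vel.continuous.comp continuous_coe_circ
  have hd : HasDerivAt (fun t : ℝ => γ.curve t) (γ.vel s) s := by
    have h1 := (intervalIntegral.integral_hasDerivAt_right (hc.intervalIntegrable s s)
      (hc.stronglyMeasurableAtFilter _ _) hc.continuousAt).add_const (γ.curve s)
    refine h1.congr_of_eventuallyEq (Eventually.of_forall fun t => ?_)
    simp only
    rw [← γ.hasL2Deriv_curve.eq, sub_add_cancel]
  have ht := (hasDerivAt_iff_tendsto_slope_zero.1 hd).norm
  refine ge_of_tendsto ht ?_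
  have hn : ∀ᶠ t : ℝ in 𝓝[≠] 0, |t| < 1 / 2 :=
    nhdsWithin_le_nhds ((continuous_abs.tendsto' 0 0 abs_zero).eventually_lt_const (by norm_num))
  filter_upwards [hn, self_mem_nhdsWithin] with t ht ht0
  have h2 := h s ((s + t : ℝ) : Circ)
  have h3 : ‖((s + t : ℝ) : Circ) - (s : Circ)‖ = |t| := by
    rw [← AddCircle.coe_sub, add_sub_cancel_left]
    refine (AddCircle.norm_coe_eq_abs_iff (p := (1 : ℝ)) one_ne_zero).2 ?_
    rw [abs_one]
    exact ht.le
  have h4 : 0 < |t| := abs_pos.2 ht0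
  rw [h3] at h2
  rw [norm_smul, norm_inv, Real.norm_eq_abs, inv_mul_eq_div, le_div_iff₀ h4]
  exact h2

/-- A perturbation in `H²` changes chords by at most `2 ‖γ₀ - γ‖` times the arc length. Within
radius `c / 4` at least half of the chord-arc constant `c` is therefore retained. -/
theorem exists_regular {γ₀ : H 2} (h₀ : γ₀ ∈ V) :
    ∃ ρ : ℝ, 0 < ρ ∧ ∃ K : ℝ, 2 ≤ K ∧ ∀ γ ∈ Metric.ball γ₀ ρ, Regular K γ ∧ γ ∈ V := by
  obtain ⟨g, hg, hpos⟩ := h₀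
  have hgc : γ₀.curve = g :=
    (γ₀.hasL2Deriv_curve.continuous.ae_eq_iff_eq volume g.continuous).1
      (γ₀.curve_ae.symm.trans hg)
  set c := chordArc g with hc
  have hbdd : ∀ g : C(Circ, Plane), BddBelow (range fun p : {p : Circ × Circ // p.1 ≠ p.2} =>
      ‖g p.1.1 - g p.1.2‖ / dist p.1.1 p.1.2) := fun g => ⟨0, by
    rintro _ ⟨p, rfl⟩
    positivity⟩
  have h1 : ∀ x y, c * ‖y - x‖ ≤ ‖γ₀.curve y - γ₀.curve x‖ := by
    intro x y
    by_cases hxy : y = x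
    · subst hxy; simp
    have h2 := ciInf_le (hbdd g) ⟨(y, x), hxy⟩
    have h3 : 0 < dist y x := dist_pos.2 hxy
    rw [hgc, ← dist_eq_norm y x, ← le_div_iff₀ h3]
    exact h2
  have h2 : ∀ γ ∈ Metric.ball γ₀ (c / 4), ∀ x y, c / 2 * ‖y - x‖ ≤ ‖γ.curve y - γ.curve x‖ := by
    intro γ hγ x y
    have h3 := (γ₀ - γ).norm_curve_sub_le x y
    rw [curve_sub] at h3
    have h4 : ‖γ₀ - γ‖ ≤ c / 4 := by
      rw [← dist_eq_norm, dist_comm]; exact (Metric.mem_ball.1 hγ).le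
    have h5 : 2 * ‖γ₀ - γ‖ * ‖y - x‖ ≤ c / 2 * ‖y - x‖ :=
      mul_le_mul_of_nonneg_right (by linarith) (norm_nonneg _)
    have h6 := h1 x y
    have h7 : ‖γ₀.curve y - γ₀.curve x‖ ≤ ‖γ.curve y - γ.curve x‖ +
        ‖γ₀.curve y - γ.curve y - (γ₀.curve x - γ.curve x)‖ := by
      refine le_trans (le_of_eq ?_) (norm_add_le _ _)
      congr 1
      abel
    linarith
  refine ⟨c / 4, by linarith, max 2 (max (2 / c) (2 * (‖γ₀‖ + c / 4))), le_max_left _ _,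
    fun γ hγ => ⟨⟨?_, fun x y => ?_, fun x => ?_⟩, ?_⟩⟩
  · refine le_trans ?_ ((le_max_right _ _).trans (le_max_right _ _))
    have h4 : ‖γ - γ₀‖ ≤ c / 4 := by rw [← dist_eq_norm]; exact (Metric.mem_ball.1 hγ).le
    have := norm_le_norm_add_norm_sub' γ γ₀
    linarith
  · have h3 := h2 γ hγ x y
    have h4 : ‖y - x‖ ≤ 2 / c * ‖γ.curve y - γ.curve x‖ := by
      rw [div_mul_eq_mul_div, le_div_iff₀ hpos]
      linarith
    exact h4.trans (mul_le_mul_of_nonneg_right ((le_max_left _ _).trans (le_max_right _ _))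
      (norm_nonneg _))
  · have h3 := speed_of_chord (h2 γ hγ) x
    have h4 : 1 ≤ 2 / c * ‖γ.vel x‖ := by
      rw [div_mul_eq_mul_div, le_div_iff₀ hpos]
      linarith
    exact h4.trans (mul_le_mul_of_nonneg_right ((le_max_left _ _).trans (le_max_right _ _))
      (norm_nonneg _))
  · refine ⟨⟨γ.curve, γ.hasL2Deriv_curve.continuous⟩, γ.curve_ae, ?_⟩
    have hne : Nonempty {p : Circ × Circ // p.1 ≠ p.2} := by
      refine ⟨⟨(((1 / 4 : ℝ) : Circ), 0), fun h => ?_⟩⟩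
      have h5 := (arc_eq_zero_iff (z := ((1 / 4 : ℝ) : Circ))).2 h
      rw [arc_coe ⟨by norm_num, by norm_num⟩] at h5
      norm_num at h5
    refine (half_pos hpos).trans_le (le_ciInf fun p => ?_)
    rw [le_div_iff₀ (dist_pos.2 p.2), dist_eq_norm]
    exact h2 γ hγ _ _

/-- The majorant `G` contains the difference of second derivatives divided by `‖γ₁ - γ₂‖`. That term
has `L²` norm at most one, and it makes `‖γ₁ - γ₂‖ * G` dominate the difference pointwise. For equal
curves the inverse of zero is zero and nothing is lost. -/
theorem Regular.curvePair {K : ℝ} (hK : 2 ≤ K) {γ₁ γ₂ : H 2} (h₁ : Regular K γ₁)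
    (h₂ : Regular K γ₂) :
    ∃ G, CurvePair K ‖γ₁ - γ₂‖ γ₁.curve γ₁.vel γ₁.acc γ₂.curve γ₂.vel γ₂.acc G ∧
      l2 G ≤ K + 1 := by
  have hD := norm_nonneg (γ₁ - γ₂)
  have m1 : MemLp γ₁.acc 2 volume := Lp.memLp _
  have m2 : MemLp γ₂.acc 2 volume := Lp.memLp _
  have m3 : MemLp (fun x => ‖γ₁ - γ₂‖⁻¹ * ‖γ₁.acc x - γ₂.acc x‖) 2 volume :=
    (m1.sub m2).norm.const_mul _
  refine ⟨fun x => ‖γ₁.acc x‖ + ‖γ₂.acc x‖ + ‖γ₁ - γ₂‖⁻¹ * ‖γ₁.acc x - γ₂.acc x‖, ⟨by linarith,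
    hD, γ₁.hasL2Deriv_curve, γ₁.hasL2Deriv_vel, γ₂.hasL2Deriv_curve, γ₂.hasL2Deriv_vel,
    γ₁.measurable_acc, γ₂.measurable_acc, ?_, (m1.norm.add m2.norm).add m3, fun x => ⟨?_, ?_, ?_⟩,
    fun x => ⟨?_, ?_, ?_⟩, h₁.chord, h₂.chord, h₁.speed, h₂.speed⟩, ?_⟩
  · exact (γ₁.measurable_acc.norm.add γ₂.measurable_acc.norm).add
      ((γ₁.measurable_acc.sub γ₂.measurable_acc).norm.const_mul _)
  · exact (γ₁.norm_vel_le x).trans h₁.norm_le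
  · exact (γ₂.norm_vel_le x).trans h₂.norm_le
  · refine (γ₁.norm_vel_sub_le γ₂ x).trans ?_
    rw [mul_comm]
    exact mul_le_mul_of_nonneg_left hK hD
  · have := norm_nonneg (γ₂.acc x)
    have : 0 ≤ ‖γ₁ - γ₂‖⁻¹ * ‖γ₁.acc x - γ₂.acc x‖ := by positivity
    linarith
  · have := norm_nonneg (γ₁.acc x)
    have : 0 ≤ ‖γ₁ - γ₂‖⁻¹ * ‖γ₁.acc x - γ₂.acc x‖ := by positivity
    linarith
  · rcases eq_or_ne γ₁ γ₂ with rfl | hne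
    · simp
    · have h0 : ‖γ₁ - γ₂‖ ≠ 0 := norm_ne_zero_iff.2 (sub_ne_zero.2 hne)
      rw [mul_add, mul_inv_cancel_left₀ h0]
      have : 0 ≤ ‖γ₁ - γ₂‖ * (‖γ₁.acc x‖ + ‖γ₂.acc x‖) := by positivity
      linarith
  · have n1 : l2 γ₁.acc ≤ ‖γ₁‖ := (l2_coe _).trans_le (γ₁.norm_der_le 2)
    have n2 : l2 γ₂.acc ≤ ‖γ₂‖ := (l2_coe _).trans_le (γ₂.norm_der_le 2)
    have n3 : l2 (fun x => γ₁.acc x - γ₂.acc x) ≤ ‖γ₁ - γ₂‖ := by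
      have e : (γ₁ - γ₂).der 2 =ᵐ[volume] fun x => γ₁.acc x - γ₂.acc x := Lp.coeFn_sub _ _
      rw [← l2_congr e, l2_coe]
      exact norm_der_le _ 2
    have n4 : l2 (fun x => ‖γ₁ - γ₂‖⁻¹ * ‖γ₁.acc x - γ₂.acc x‖) ≤ 1 := by
      refine (l2_le_of_ae (inv_nonneg.2 hD) (m1.sub m2) (ae_of_all _ fun x => ?_)).trans ?_
      · rw [norm_mul, norm_norm, Real.norm_of_nonneg (inv_nonneg.2 hD)]
        rfl
      · rw [inv_mul_eq_div]
        exact div_le_one_of_le₀ n3 hD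
    have t1 := l2_add_le (m1.norm.add m2.norm) m3
    have t2 := l2_add_le m1.norm m2.norm
    rw [l2_norm, l2_norm] at t2
    have := h₁.norm_le
    have := h₂.norm_le
    exact t1.trans ((add_le_add t2 n4).trans (by linarith))

/-- The coefficient `(π |∂ₓγ|²)⁻¹`. -/
def coeff (γ : H 2) (x : Circ) : ℝ := Real.pi⁻¹ • (inner ℝ (γ.vel x) (γ.vel x))⁻¹

theorem coeff_eq (γ : H 2) (x : Circ) : γ.coeff x = (Real.pi * ‖γ.vel x‖ ^ 2)⁻¹ := by
  rw [coeff, real_inner_self_eq_norm_sq, mul_inv, smul_eq_mul]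

/-- The lower order term as a function. -/
def lowerFun (γ : H 2) (x : Circ) : Plane :=
  (2 : ℝ)⁻¹ • (γ.coeff x • (singInt γ.curve γ.vel γ.acc x • rotL (γ.vel x)))

theorem norm_smul_le_of_le_one {Y : Type*} [NormedAddCommGroup Y] [NormedSpace ℝ Y] {r : ℝ}
    (h0 : 0 ≤ r) (h1 : r ≤ 1) (y : Y) : ‖(r • ContinuousLinearMap.id ℝ Y) y‖ ≤ ‖y‖ := by
  change ‖r • y‖ ≤ ‖y‖
  rw [norm_smul, Real.norm_of_nonneg h0]
  exact mul_le_of_le_one_left (norm_nonneg _) h1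

theorem inv_pi_le_one : Real.pi⁻¹ ≤ 1 := inv_le_one_of_one_le₀ (by linarith [Real.pi_gt_three])

/-- The constants follow the construction: `c₁` bounds the velocity, `c₂` its square, `c₃` the
coefficient, `c₄` the singular integral and `c₅` the lower order term. The lower bound `K⁻¹ ^ 2` on
the squared speed permits the reciprocal. -/
theorem exists_h1Pair {K : ℝ} (hK : 2 ≤ K) : ∃ C : ℝ, 0 ≤ C ∧ ∀ γ₁ γ₂ : H 2, Regular K γ₁ →
    Regular K γ₂ → (∃ a₁ a₂, H1Pair ‖γ₁ - γ₂‖ C γ₁.coeff a₁ γ₂.coeff a₂) ∧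
      ∃ u₁ u₂, H1Pair ‖γ₁ - γ₂‖ C γ₁.lowerFun u₁ γ₂.lowerFun u₂ := by
  have hK0 : 0 < K := by linarith
  set c₁ := 2 * K + 1 with hc₁
  set c₂ := 4 * (c₁ * c₁) with hc₂
  set c₃ := c₂ * (K⁻¹ ^ 2)⁻¹ ^ 2 + 3 * (c₂ * (K⁻¹ ^ 2)⁻¹ ^ 2) ^ 2 * c₂ with hc₃
  set c₄ := 2 * (7 * (102400 * K ^ 29) * (K + 1) ^ 3) with hc₄
  set c₅ := 4 * (c₃ * (4 * (c₄ * c₁))) with hc₅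
  have p₁ : 0 ≤ c₁ := by positivity
  have p₂ : 0 ≤ c₂ := by positivity
  have p₃ : 0 ≤ c₃ := by positivity
  have p₄ : 0 ≤ c₄ := by positivity
  have p₅ : 0 ≤ c₅ := by positivity
  refine ⟨c₃ + c₅, by positivity, fun γ₁ γ₂ h₁ h₂ => ?_⟩
  obtain ⟨G, P, hG⟩ := h₁.curvePair hK h₂
  have hD := P.D_nonneg
  have b₁ := P.h1Pair_p.mono (C' := c₁) hD (by linarith)
  have b₂ := b₁.inner hD b₁
  have low : ∀ {γ : H 2}, Regular K γ → ∀ x, K⁻¹ ^ 2 ≤ inner ℝ (γ.vel x) (γ.vel x) := by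
    intro γ h x
    rw [real_inner_self_eq_norm_sq]
    refine pow_le_pow_left₀ (by positivity) ?_ 2
    rw [inv_le_iff_one_le_mul₀ hK0, mul_comm]
    exact h.speed x
  have b₃ := (b₂.inv hD (by positivity) (low h₁) (low h₂)).clm
    (Real.pi⁻¹ • ContinuousLinearMap.id ℝ ℝ)
    (norm_smul_le_of_le_one (by positivity) inv_pi_le_one)
  have b₄ := P.h1Pair_singInt.mono (C' := c₄) hD (by
    have := l2_nonneg G
    rw [hc₄]
    gcongr)
  have b₅ := (b₃.smul hD (b₄.smul hD (b₁.clm rotL fun y => (norm_rotL y).le))).clm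
    ((2 : ℝ)⁻¹ • ContinuousLinearMap.id ℝ Plane) (norm_smul_le_of_le_one (by norm_num) (by norm_num))
  exact ⟨⟨_, _, b₃.mono hD (by linarith)⟩, ⟨_, _, b₅.mono hD (by linarith)⟩⟩

/-- The lower order term as an element of `H¹`. -/
def lower (γ : H 2) : H 1 := ofFun γ.lowerFun

/-- The principal part as an operator from `H³` to `H¹`. -/
def principal (γ : H 2) : H 3 →L[ℝ] H 1 := (mulOf γ.coeff).comp ((shift 1).comp (shift 2))

theorem exists_lipschitz {K : ℝ} (hK : 2 ≤ K) : ∃ C : ℝ, 0 ≤ C ∧ ∀ γ₁ γ₂ : H 2, Regular K γ₁ →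
    Regular K γ₂ → ‖principal γ₁ - principal γ₂‖ ≤ C * ‖γ₁ - γ₂‖ ∧
      ‖lower γ₁ - lower γ₂‖ ≤ C * ‖γ₁ - γ₂‖ := by
  obtain ⟨C, hC, h⟩ := exists_h1Pair hK
  set N := ‖(shift 1).comp (shift 2)‖ with hN
  have hN0 : 0 ≤ N := by rw [hN]; positivity
  refine ⟨4 * C * N + 2 * C, by positivity, fun γ₁ γ₂ h₁ h₂ => ?_⟩
  obtain ⟨⟨a₁, a₂, ha⟩, u₁, u₂, hu⟩ := h γ₁ γ₂ h₁ h₂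
  have hD := norm_nonneg (γ₁ - γ₂)
  have hCD : 0 ≤ C * ‖γ₁ - γ₂‖ := mul_nonneg hC hD
  constructor
  · rw [principal, principal, ← ContinuousLinearMap.sub_comp, mulOf_eq ha.left,
      mulOf_eq ha.right, mulL_sub]
    refine (ContinuousLinearMap.opNorm_comp_le _ _).trans ?_
    have h1 := norm_mulL_le (ha.left.sub ha.right) fun x => (ha.val x).sub
    have h2 := ha.l2_sub
    have h3 : ‖mulL (ha.left.sub ha.right)‖ ≤ 4 * C * ‖γ₁ - γ₂‖ := by linarith
    refine (mul_le_mul_of_nonneg_right h3 hN0).trans ?_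
    nlinarith
  · rw [lower, lower, ofFun_eq hu.left, ofFun_eq hu.right, ofDeriv_sub]
    refine (norm_ofDeriv_le _).trans ?_
    have h1 := l2_le_of_bound (by positivity) (ae_of_all _ fun x => (hu.val x).sub)
    have h2 := hu.l2_sub
    have h3 : 0 ≤ 4 * C * N * ‖γ₁ - γ₂‖ := by positivity
    linarith

theorem toL2_principal {K : ℝ} (hK : 2 ≤ K) {γ : H 2} (h : Regular K γ) (ξ : H 3) :
    ∀ᵐ x, (principal γ ξ).toL2 x = opA γ ξ x := by
  obtain ⟨C, hC, hp⟩ := exists_h1Pair hK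
  obtain ⟨⟨a₁, a₂, ha⟩, -⟩ := hp γ γ h h
  filter_upwards [toL2_mulL ha.left ((shift 1) (shift 2 ξ)), γ.vel_ae] with x h1 h2
  have e : principal γ ξ = mulL ha.left ((shift 1) (shift 2 ξ)) := by
    rw [principal, mulOf_eq ha.left]
    rfl
  rw [e, h1, coeff_eq, opA, h2]
  rfl

/-- At `δ = 0` the regularised kernel is the original one without normalisation. The speeds from
`ν(y)` and `κ(y)` make up the cube in `dens`; those from `ν(x)` in the kernel and in `F ν` make up
the square in `coeff`. -/
theorem toL2_lower {K : ℝ} (hK : 2 ≤ K) {γ : H 2} (h : Regular K γ) :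
    ∀ᵐ x, (lower γ).toL2 x = lowerOrder γ x := by
  obtain ⟨C, hC, hp⟩ := exists_h1Pair hK
  obtain ⟨-, u₁, u₂, hu⟩ := hp γ γ h h
  have hnormal : ∀ x, γ.der 1 x = γ.vel x → normal γ x = ‖γ.vel x‖⁻¹ • rotL (γ.vel x) := by
    intro x hx
    rw [normal, tangent, hx, ← rotL_apply, map_smul]
  rw [lower, ofFun_eq hu.left]
  filter_upwards [coeFn_ofDeriv hu.left, γ.vel_ae, γ.curve_ae] with x h1 h2 h3
  have hn := hnormal x h2
  have hint : ∫ y, kernelK γ x y * curvature γ y =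
      -(‖γ.vel x‖⁻¹ * singInt γ.curve γ.vel γ.acc x) := by
    rw [singInt, ← integral_const_mul, ← integral_neg]
    refine integral_congr_ae ?_
    filter_upwards [γ.vel_ae, γ.curve_ae] with y h4 h5
    have hny := hnormal y h4
    have hacc : γ.der 2 y = γ.acc y := rfl
    rw [kernelK, curvature, chord, hn, hny, h3, h5, h4, hacc, kern, dens, invChord,
      real_inner_smul_left, real_inner_smul_left, real_inner_smul_left]
    have e : √(‖γ.curve y - γ.curve x‖ ^ 2 + 0 ^ 2) = ‖γ.curve y - γ.curve x‖ := by
      rw [zero_pow two_ne_zero, add_zero, Real.sqrt_sq (norm_nonneg _)]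
    rw [e]
    simp only [div_eq_mul_inv, inv_pow]
    ring
  rw [h1, lowerOrder, forcing, hint, hn, lowerFun, coeff_eq, smul_smul, smul_smul, smul_smul]
  congr 1
  rw [mul_inv, one_div, mul_inv, ← inv_pow]
  ring

/-- The quasilinear problem near `γ₀`. -/
theorem exists_quasilinearData {γ₀ : H 2} (h₀ : γ₀ ∈ V) :
    ∃ D : QuasilinearData (H 1) (H 2) (H 3), D.γ₀ = γ₀ ∧ D.ι₂ = trunc 1 ∧ D.ι₃ = trunc 2 ∧
      D.A = principal ∧ D.f = lower ∧ ∃ K : ℝ, 2 ≤ K ∧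
        ∀ γ ∈ Metric.ball γ₀ D.ρ, Regular K γ ∧ γ ∈ V := by
  obtain ⟨ρ, hρ, K, hK, hball⟩ := exists_regular h₀
  obtain ⟨C, hC, hp⟩ := exists_h1Pair hK
  obtain ⟨L, hL, hlip⟩ := exists_lipschitz hK
  have hreg := (hball γ₀ (Metric.mem_ball_self hρ)).1
  obtain ⟨⟨a₁, a₂, ha⟩, -⟩ := hp γ₀ γ₀ hreg hreg
  have hK0 : 0 < K := by linarith
  have hπ := Real.pi_pos
  have hπ3 := Real.pi_gt_three
  have hw := ((γ₀.hasL2Deriv_vel.inner γ₀.hasL2Deriv_vel).clm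
    (Real.pi • ContinuousLinearMap.id ℝ ℝ))
  have hv0 : ∀ x, K⁻¹ ≤ ‖γ₀.vel x‖ := fun x => by
    rw [inv_le_iff_one_le_mul₀ hK0, mul_comm]
    exact hreg.speed x
  have hvK : ∀ x, ‖γ₀.vel x‖ ≤ K := fun x => (γ₀.norm_vel_le x).trans hreg.norm_le
  have hvpos : ∀ x, 0 < ‖γ₀.vel x‖ := fun x => (inv_pos.2 hK0).trans_le (hv0 x)
  have h1K : 1 ≤ Real.pi * K ^ 2 := by nlinarith
  have hwx : ∀ x, (Real.pi • ContinuousLinearMap.id ℝ ℝ) (inner ℝ (γ₀.vel x) (γ₀.vel x)) =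
      Real.pi * ‖γ₀.vel x‖ ^ 2 := fun x => by
    rw [real_inner_self_eq_norm_sq]; rfl
  -- The reciprocal weight is `π |∂ₓγ₀|²`; the speed lies between `K⁻¹` and `K`, and `(π K²)⁻¹`
  -- bounds both weights from below.
  let W : WeightPair γ₀.coeff
      (fun x => (Real.pi • ContinuousLinearMap.id ℝ ℝ) (inner ℝ (γ₀.vel x) (γ₀.vel x))) :=
    { a' := a₁
      w' := _
      ha := ha.left
      hw := hw
      mul_eq := fun x => by
        rw [hwx, coeff_eq]
        exact inv_mul_cancel₀ (mul_pos hπ (pow_pos (hvpos x) 2)).ne'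
      m := (Real.pi * K ^ 2)⁻¹
      m_pos := by positivity
      m_le_one := inv_le_one_of_one_le₀ h1K
      m_le_a := fun x => by
        rw [coeff_eq]
        have := hvK x
        have := hvpos x
        gcongr
      m_le_w := fun x => by
        rw [hwx]
        calc (Real.pi * K ^ 2)⁻¹ = Real.pi⁻¹ * (K⁻¹) ^ 2 := by rw [mul_inv, inv_pow]
          _ ≤ Real.pi * ‖γ₀.vel x‖ ^ 2 := by
            refine mul_le_mul (inv_pi_le_one.trans (by linarith))
              (pow_le_pow_left₀ (by positivity) (hv0 x) 2) (by positivity) hπ.le }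
  refine ⟨{ W.parabolicData with
    γ₀ := γ₀
    A := principal
    f := lower
    ρ := ρ
    ρ_pos := hρ
    L := L
    L_nonneg := hL
    A_lip := fun x hx y hy => (hlip x y (hball x hx).1 (hball y hy).1).1
    f_lip := fun x hx y hy => (hlip x y (hball x hx).1 (hball y hy).1).2
    B_eq := fun ξ => ?_ }, rfl, rfl, rfl, rfl, rfl, K, hK, hball⟩
  change W.op ξ = trunc 1 (trunc 2 ξ) - principal γ₀ ξ
  rw [principal, mulOf_eq ha.left]
  rfl

end H

/-! ### Weak time derivatives -/

section WeakTime

variable {X : Type*} [NormedAddCommGroup X] [NormedSpace ℝ X] [CompleteSpace X] {T : ℝ}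

/-- The product of `φ` and `z + prim v` is absolutely continuous and vanishes at both ends of the
interval. -/
theorem integral_deriv_smul_prim (hT : 0 < T) (v : TimeL2 T X) (z : X) {φ : ℝ → ℝ}
    (hφ : ContDiff ℝ ∞ φ) (hs : tsupport φ ⊆ Ioo 0 T) :
    ∫ t in Ioo 0 T, deriv φ t • (z + prim v t) = -∫ t in Ioo 0 T, φ t • v t := by
  set w : ℝ → X := (Ioo 0 T).indicator v with hw
  have hwi : Integrable w volume := (integrable_indicator_iff measurableSet_Ioo).2 v.integrable
  have hwii : ∀ x y, IntervalIntegrable w volume x y := fun x y => hwi.intervalIntegrable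
  have hprim : ∀ s ∈ Icc 0 T, prim v s = ∫ r in 0..s, w r := by
    intro s hs
    rw [← setIntegral_timeMeasure w hs]
    refine integral_congr_ae (ae_restrict_of_ae ?_)
    filter_upwards [ae_restrict_mem measurableSet_Ioo] with r hr
    rw [hw, indicator_of_mem hr]
  set ζ : ℝ → X := fun s => z + ∫ r in 0..s, w r with hζ
  have hζac : AbsolutelyContinuousOnInterval ζ 0 T := by
    refine absolutelyContinuousOnInterval_of_dist_le (K := 1)
      (absolutelyContinuousOnInterval_integral (c := 0) (a := 0) (b := T) hwii) fun x _ y _ => ?_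
    simp [hζ]
  have hζc : Continuous ζ := continuous_const.add (intervalIntegral.continuous_primitive hwii 0)
  have hφd : ∀ t, HasDerivAt φ (deriv φ t) t := fun t =>
    (hφ.differentiable (by simp) t).hasDerivAt
  have hφ'c : Continuous (deriv φ) := hφ.continuous_deriv (by simp)
  have hφac : AbsolutelyContinuousOnInterval φ 0 T := by
    refine absolutelyContinuousOnInterval_of_dist_le (K := 1)
      (absolutelyContinuousOnInterval_integral (f := deriv φ) (c := 0) (a := 0) (b := T)
        fun x y => hφ'c.intervalIntegrable x y) fun x _ y _ => ?_
    rw [intervalIntegral.integral_deriv_eq_sub (fun t _ => (hφd t).differentiableAt)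
      (hφ'c.intervalIntegrable _ _), intervalIntegral.integral_deriv_eq_sub
      (fun t _ => (hφd t).differentiableAt) (hφ'c.intervalIntegrable _ _), one_mul,
      dist_sub_right]
  have h0 : φ 0 = 0 := image_eq_zero_of_notMem_tsupport fun h => lt_irrefl _ (hs h).1
  have h1 : φ T = 0 := image_eq_zero_of_notMem_tsupport fun h => lt_irrefl _ (hs h).2
  have i1 : ∀ x y, IntervalIntegrable (fun t => deriv φ t • ζ t) volume x y := fun x y =>
    (hφ'c.smul hζc).intervalIntegrable x y
  have i2 : ∀ x y, IntervalIntegrable (fun t => φ t • w t) volume x y := fun x y =>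
    (hwii x y).continuousOn_smul hφ.continuous.continuousOn
  have key := integral_eq_sub_of_absolutelyContinuous (f := fun t => φ t • ζ t)
    (f' := fun t => deriv φ t • ζ t + φ t • w t) (hφac.smul hζac)
    (fun x y => (i1 x y).add (i2 x y)) (by
      filter_upwards [(hwii 0 T).ae_hasDerivAt_integral] with t ht htm
      have h2 := (hφd t).smul ((ht htm 0 (by simp)).const_add z)
      rw [add_comm]
      exact h2)
  rw [h0, h1, zero_smul, zero_smul, sub_zero, intervalIntegral.integral_add (i1 _ _) (i2 _ _)] at key
  have conv : ∀ f : ℝ → X, ∫ t in 0..T, f t = ∫ t in Ioo 0 T, f t := fun f => by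
    rw [intervalIntegral.integral_of_le hT.le, integral_Ioc_eq_integral_Ioo]
  rw [conv, conv] at key
  have e1 : ∫ t in Ioo 0 T, deriv φ t • (z + prim v t) = ∫ t in Ioo 0 T, deriv φ t • ζ t :=
    setIntegral_congr_fun measurableSet_Ioo fun t ht => by
      simp only [hζ, hprim t (Ioo_subset_Icc_self ht)]
  have e2 : ∫ t in Ioo 0 T, φ t • v t = ∫ t in Ioo 0 T, φ t • w t :=
    setIntegral_congr_fun measurableSet_Ioo fun t ht => by
      simp only [hw, indicator_of_mem ht]
  rw [e1, e2]
  exact eq_neg_of_add_eq_zero_left key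

/-- A smooth function with compact support and mean zero is the derivative of one. -/
theorem exists_smooth_primitive {χ : ℝ → ℝ} (hχ : ContDiff ℝ ∞ χ) (hc : HasCompactSupport χ)
    (hs : tsupport χ ⊆ Ioo 0 T) (h0 : ∫ t, χ t = 0) :
    ∃ φ : ℝ → ℝ, ContDiff ℝ ∞ φ ∧ HasCompactSupport φ ∧ tsupport φ ⊆ Ioo 0 T ∧ deriv φ = χ := by
  rcases (tsupport χ).eq_empty_or_nonempty with he | hne
  · rw [tsupport_eq_empty_iff] at he
    subst he
    exact ⟨0, contDiff_const, HasCompactSupport.zero, by simp [tsupport], by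
      funext t; simp⟩
  obtain ⟨a, ha⟩ := hc.isCompact.exists_isLeast hne
  obtain ⟨b, hb⟩ := hc.isCompact.exists_isGreatest hne
  have hsub : tsupport χ ⊆ Icc a b := fun t ht => ⟨ha.2 ht, hb.2 ht⟩
  have hab : a ≤ b := ha.2 hb.1
  have hint : ∀ x y, IntervalIntegrable χ volume x y := fun x y =>
    hχ.continuous.intervalIntegrable x y
  have hzero : ∀ t ∉ Icc a b, χ t = 0 := fun t ht =>
    image_eq_zero_of_notMem_tsupport fun h => ht (hsub h)
  have hd : ∀ t, HasDerivAt (fun t => ∫ s in a..t, χ s) (χ t) t := fun t =>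
    intervalIntegral.integral_hasDerivAt_right (hint _ _)
      (hχ.continuous.stronglyMeasurableAtFilter _ _) hχ.continuous.continuousAt
  have hder : deriv (fun t => ∫ s in a..t, χ s) = χ := funext fun t => (hd t).deriv
  have hout : ∀ t ∉ Icc a b, ∫ s in a..t, χ s = 0 := by
    intro t ht
    rcases lt_or_ge t a with h | h
    · rw [intervalIntegral.integral_symm, intervalIntegral.integral_of_le h.le,
        integral_Ioc_eq_integral_Ioo, setIntegral_eq_zero_of_forall_eq_zero, neg_zero]
      exact fun s hs => hzero s fun h' => absurd h'.1 (not_le.2 hs.2)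
    · have hbt : b < t := by
        by_contra hcon
        exact ht ⟨h, not_lt.1 hcon⟩
      rw [intervalIntegral.integral_eq_integral_of_support_subset, h0]
      intro s hs
      have h1 : s ∈ tsupport χ := subset_tsupport _ hs
      have h2 := hsub h1
      refine ⟨lt_of_le_of_ne h2.1 ?_, h2.2.trans hbt.le⟩
      rintro rfl
      -- The function vanishes to the left of `a`, hence at `a` by continuity; the support therefore
      -- lies in the half-open interval over which the integral is taken.
      have : χ a = 0 := by
        have hcl : a ∈ closure (Iio a) := by rw [closure_Iio]; exact self_mem_Iic
        have hz : EqOn χ 0 (Iio a) := fun r hr => hzero r fun h' => absurd h'.1 (not_le.2 hr)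
        exact (hz.closure hχ.continuous continuous_const) hcl
      exact hs this
  have hts : tsupport (fun t => ∫ s in a..t, χ s) ⊆ Icc a b :=
    closure_minimal (fun t ht => by
      by_contra hcon
      exact ht (hout t hcon)) isClosed_Icc
  refine ⟨fun t => ∫ s in a..t, χ s, ?_, HasCompactSupport.of_support_subset_isCompact isCompact_Icc
    (subset_closure.trans hts), hts.trans fun t ht => ⟨(hs ha.1).1.trans_le ht.1,
      ht.2.trans_lt (hs hb.1).2⟩, hder⟩
  rw [contDiff_infty_iff_deriv, hder]
  exact ⟨fun t => (hd t).differentiableAt, hχ⟩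

/-- The lemma of du Bois-Reymond. -/
theorem ae_const_of_integral_deriv_smul (hT : 0 < T) {w : ℝ → X}
    (hw : IntegrableOn w (Ioo 0 T))
    (h : ∀ φ : ℝ → ℝ, ContDiff ℝ ∞ φ → HasCompactSupport φ → tsupport φ ⊆ Ioo 0 T →
      ∫ t in Ioo 0 T, deriv φ t • w t = 0) :
    ∃ m : X, ∀ᵐ t ∂timeMeasure T, w t = m := by
  -- A fixed bump of mass one inside `(0, T)`; its pairing with `w` is the constant sought.
  let b : ContDiffBump (T / 2) := ⟨T / 8, T / 4, by positivity, by linarith⟩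
  set ψ : ℝ → ℝ := b.normed volume with hψ
  have hψs : ContDiff ℝ ∞ ψ := b.contDiff_normed
  have hψc : HasCompactSupport ψ := b.hasCompactSupport_normed
  have hψ1 : ∫ t, ψ t = 1 := b.integral_normed
  have hψt : tsupport ψ ⊆ Ioo 0 T := by
    rw [hψ, b.tsupport_normed_eq, Real.closedBall_eq_Icc]
    intro t ht
    have h1 : T / 2 - T / 4 ≤ t := ht.1
    have h2 : t ≤ T / 2 + T / 4 := ht.2
    exact ⟨by linarith, by linarith⟩
  have hsm : ∀ {χ : ℝ → ℝ}, Continuous χ → HasCompactSupport χ →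
      IntegrableOn (fun t => χ t • w t) (Ioo 0 T) := fun hχ hc => by
    obtain ⟨C, hC⟩ := hc.exists_bound_of_continuous hχ
    exact Integrable.bdd_smul hw C hχ.aestronglyMeasurable (Eventually.of_forall hC)
  set m := ∫ t in Ioo 0 T, ψ t • w t with hm
  refine ⟨m, ?_⟩
  have hloc : LocallyIntegrableOn (fun t => w t - m) (Ioo 0 T) :=
    (hw.sub (integrableOn_const (by simp))).locallyIntegrableOn
  have := isOpen_Ioo.ae_eq_zero_of_integral_contDiff_smul_eq_zero hloc fun χ hχ hc hs => by
    set k := ∫ t, χ t with hk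
    -- Removing the mass of `χ` with the bump leaves mean zero, so the result is the derivative of
    -- an admissible test function.
    have hg : ContDiff ℝ ∞ (fun t => χ t - k * ψ t) := hχ.sub (contDiff_const.mul hψs)
    have hgs : tsupport (fun t => χ t - k * ψ t) ⊆ tsupport χ ∪ tsupport ψ := by
      refine closure_minimal (fun t ht => ?_) ((isClosed_tsupport _).union (isClosed_tsupport _))
      by_contra hcon
      rw [mem_union, not_or] at hcon
      refine ht ?_
      simp only [image_eq_zero_of_notMem_tsupport hcon.1, image_eq_zero_of_notMem_tsupport hcon.2]
      simp
    have hgc : HasCompactSupport (fun t => χ t - k * ψ t) :=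
      (hc.isCompact.union hψc.isCompact).of_isClosed_subset (isClosed_tsupport _) hgs
    have hg0 : ∫ t, (χ t - k * ψ t) = 0 := by
      rw [integral_sub (hχ.continuous.integrable_of_hasCompactSupport hc)
        ((hψs.continuous.integrable_of_hasCompactSupport hψc).const_mul k), integral_const_mul, hψ1,
        mul_one, ← hk, sub_self]
    obtain ⟨φ, h1, h2, h3, h4⟩ := exists_smooth_primitive hg hgc (hgs.trans (union_subset hs hψt)) hg0
    have h5 := h φ h1 h2 h3
    rw [h4] at h5
    have e : ∫ t in Ioo 0 T, (χ t - k * ψ t) • w t = (∫ t in Ioo 0 T, χ t • w t) - k • m := by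
      have i3 : IntegrableOn (fun t => k • ψ t • w t) (Ioo 0 T) :=
        (hsm hψs.continuous hψc).smul k
      rw [hm, ← integral_smul, ← integral_sub (hsm hχ.continuous hc) i3]
      refine integral_congr_ae (ae_of_all _ fun t => ?_)
      simp only [sub_smul, mul_smul]
    have e2 : ∫ t in Ioo 0 T, χ t • m = k • m := by
      rw [integral_smul_const, hk, setIntegral_eq_integral_of_forall_compl_eq_zero]
      exact fun t ht => image_eq_zero_of_notMem_tsupport fun h' => ht (hs h')
    rw [← setIntegral_eq_integral_of_forall_compl_eq_zero (s := Ioo 0 T) (fun t ht => by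
      rw [image_eq_zero_of_notMem_tsupport fun h' => ht (hs h'), zero_smul])]
    simp only [smul_sub]
    rw [integral_sub (hsm hχ.continuous hc)
      ((hχ.continuous.integrable_of_hasCompactSupport hc).integrableOn.smul_const m), e2, ← e]
    exact h5
  rw [ae_restrict_iff' measurableSet_Ioo]
  filter_upwards [this] with t ht htm
  exact sub_eq_zero.1 (ht htm)

/-- By du Bois-Reymond the curve and the primitive differ by a constant almost everywhere, and
continuity extends this to every time in `[0, T]`. -/
theorem eq_add_prim (hT : 0 < T) {c : ℝ → X} (hc : ContinuousOn c (Icc 0 T)) (v : TimeL2 T X)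
    (h : ∀ φ : ℝ → ℝ, ContDiff ℝ ∞ φ → HasCompactSupport φ → tsupport φ ⊆ Ioo 0 T →
      ∫ t in Ioo 0 T, deriv φ t • c t = -∫ t in Ioo 0 T, φ t • v t) :
    ∀ t ∈ Icc 0 T, c t = c 0 + prim v t := by
  have hp : Continuous (prim v) := continuous_prim v
  have ic : IntegrableOn c (Ioo 0 T) := hc.integrableOn_Icc.mono_set Ioo_subset_Icc_self
  have ip : IntegrableOn (prim v) (Ioo 0 T) :=
    hp.continuousOn.integrableOn_Icc.mono_set Ioo_subset_Icc_self
  have hsm : ∀ {χ : ℝ → ℝ} {w : ℝ → X}, IntegrableOn w (Ioo 0 T) → Continuous χ →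
      HasCompactSupport χ → IntegrableOn (fun t => χ t • w t) (Ioo 0 T) := fun hw hχ hc => by
    obtain ⟨C, hC⟩ := hc.exists_bound_of_continuous hχ
    exact Integrable.bdd_smul hw C hχ.aestronglyMeasurable (Eventually.of_forall hC)
  obtain ⟨m, hm⟩ := ae_const_of_integral_deriv_smul hT (w := fun t => c t - prim v t)
    (ic.sub ip) fun φ h1 h2 h3 => by
      have hd : Continuous (deriv φ) := h1.continuous_deriv (by simp)
      simp only [smul_sub]
      rw [integral_sub (hsm ic hd h2.deriv) (hsm ip hd h2.deriv), h φ h1 h2 h3]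
      have := integral_deriv_smul_prim hT v 0 h1 h3
      simp only [zero_add] at this
      rw [this, sub_self]
  have hm' : (fun t => c t - prim v t) =ᵐ[volume.restrict (Icc 0 T)] fun _ => m := by
    rw [← restrict_Ioo_eq_restrict_Icc]
    exact hm
  have heq := Measure.eqOn_Icc_of_ae_eq volume hT.ne hm' (hc.sub hp.continuousOn) continuousOn_const
  intro t ht
  have e1 : c t - prim v t = m := heq ht
  have e2 : c 0 - prim v 0 = m := heq ⟨le_rfl, hT.le⟩
  rw [prim_zero_time v hT.le, sub_zero] at e2
  rw [e2, ← e1]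
  abel

end WeakTime

/-! ### Solutions in `𝔼(0, T)` -/

namespace E

variable {T : ℝ}

/-- The solution seen in `L²(0, T; H¹)`. -/
def low (u : E T) : LTime T 1 := (u : Ambient T).snd.fst

theorem low_ae (u : E T) : ∀ᵐ t ∂timeMeasure T, u.low t = H.trunc 1 (H.trunc 2 (u.val t)) := by
  filter_upwards [u.2.1] with t ht
  exact H.ext_toL2 ht.symm

theorem low_eq (u : E T) : u.low = ((H.trunc 1).comp (H.trunc 2)).compLp u.val := by
  refine Lp.ext ?_
  filter_upwards [u.low_ae, ((H.trunc 1).comp (H.trunc 2)).coeFn_compLp u.val] with t h1 h2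
  rw [h1, h2]
  rfl

theorem norm_le (u : E T) :
    ‖u‖ ≤ (1 + ‖(H.trunc 1).comp (H.trunc 2)‖) * ‖u.val‖ + ‖u.dt‖ := by
  have h1 : ‖u.low‖ ≤ ‖(H.trunc 1).comp (H.trunc 2)‖ * ‖u.val‖ := by
    rw [low_eq]
    exact ContinuousLinearMap.norm_compLp_le _ _
  have h2 : ‖u‖ ^ 2 = ‖u.val‖ ^ 2 + (‖u.low‖ ^ 2 + ‖u.dt‖ ^ 2) := by
    have a := WithLp.prod_norm_sq_eq_of_L2 (u : Ambient T)
    have b := WithLp.prod_norm_sq_eq_of_L2 (u : Ambient T).snd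
    rw [b] at a
    exact a
  have h3 : ‖u‖ ≤ ‖u.val‖ + ‖u.low‖ + ‖u.dt‖ := by
    refine abs_le_of_sq_le_sq' ?_ (by positivity) |>.2
    rw [h2]
    have := norm_nonneg u.val
    have := norm_nonneg u.low
    have := norm_nonneg u.dt
    nlinarith [mul_nonneg (norm_nonneg u.val) (norm_nonneg u.low),
      mul_nonneg (norm_nonneg u.val) (norm_nonneg u.dt),
      mul_nonneg (norm_nonneg u.low) (norm_nonneg u.dt)]
  linarith

theorem exists_val_dt {w : LTime T 3} {l v : LTime T 1}
    (h₁ : ∀ᵐ t ∂timeMeasure T, (w t).toL2 = (l t).toL2) (h₂ : HasWeakTimeDeriv l v) :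
    ∃ u : E T, u.val = w ∧ u.dt = v :=
  ⟨⟨WithLp.toLp 2 (w, WithLp.toLp 2 (l, v)), h₁, h₂⟩, rfl, rfl⟩

theorem val_sub (u w : E T) : (u - w).val = u.val - w.val := rfl

theorem dt_sub (u w : E T) : (u - w).dt = u.dt - w.dt := rfl

end E

/-- The weak time derivative becomes an integral identity for the continuous representative, and the
pointwise equation becomes one in `H¹` wherever the curve lies in the ball. Uniqueness can thus be
applied to solutions not known in advance to stay there. -/
theorem IsSolution.isSol {T : ℝ} (hT : 0 < T) {D : QuasilinearData (H 1) (H 2) (H 3)}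
    (h₂ : D.ι₂ = H.trunc 1) (h₃ : D.ι₃ = H.trunc 2) (hA : D.A = H.principal) (hf : D.f = H.lower)
    {K : ℝ} (hK : 2 ≤ K) (hball : ∀ γ ∈ Metric.ball D.γ₀ D.ρ, H.Regular K γ ∧ γ ∈ V)
    {γ₁ : H 2} {u : E T} (h : IsSolution T γ₁ u) :
    ∃ c, D.IsSol u.dt u.val c ∧ c 0 = γ₁ := by
  obtain ⟨c, hc, -, hval, h0, heq⟩ := h
  have hval' : ∀ᵐ t ∂timeMeasure T, H.trunc 2 (u.val t) = c t := by
    filter_upwards [hval] with t ht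
    exact H.ext_toL2 ht
  refine ⟨c, ⟨hc, ?_, ?_, ?_⟩, h0⟩
  · rw [h₂]
    refine eq_add_prim hT (c := fun t => H.trunc 1 (c t))
      ((H.trunc 1).continuous.comp_continuousOn hc) u.dt fun φ h1 h2 h3 => ?_
    have hw := u.2.2 φ h1 h2 h3
    refine Eq.trans (integral_congr_ae ?_) hw
    filter_upwards [hval', u.low_ae] with t h4 h5
    rw [← h4, ← h5]
    rfl
  · rw [h₃]
    exact hval'
  · rw [hA, hf]
    filter_upwards [heq] with t ht hct
    obtain ⟨hreg, -⟩ := hball _ hct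
    refine H.ext_toL2_ae ?_
    filter_upwards [ht, H.toL2_principal hK hreg (u.val t), H.toL2_lower hK hreg,
      Lp.coeFn_add (H.principal (c t) (u.val t)).toL2 (H.lower (c t)).toL2] with x h1 h2 h3 h4
    have e : (H.principal (c t) (u.val t) + H.lower (c t)).toL2 =
      (H.principal (c t) (u.val t)).toL2 + (H.lower (c t)).toL2 := rfl
    rw [e, h4, Pi.add_apply, h2, h3]
    exact h1

/-- Here the curve must lie in the ball at all times: this makes the abstract equation hold almost
everywhere in time and keeps the curve in `V`. -/
theorem QuasilinearData.IsSol.isSolution {T : ℝ} (hT : 0 < T)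
    {D : QuasilinearData (H 1) (H 2) (H 3)}
    (h₂ : D.ι₂ = H.trunc 1) (h₃ : D.ι₃ = H.trunc 2) (hA : D.A = H.principal) (hf : D.f = H.lower)
    {K : ℝ} (hK : 2 ≤ K) (hball : ∀ γ ∈ Metric.ball D.γ₀ D.ρ, H.Regular K γ ∧ γ ∈ V)
    {v : LTime T 1} {w : LTime T 3} {c : ℝ → H 2} (h : D.IsSol v w c)
    (hc : ∀ t ∈ Icc 0 T, c t ∈ Metric.ball D.γ₀ D.ρ) : ∃ u : E T, IsSolution T (c 0) u := by
  obtain ⟨hcont, hprim, hval, heq⟩ := h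
  rw [h₃] at hval
  rw [h₂] at hprim
  rw [hA, hf] at heq
  set J := (H.trunc 1).comp (H.trunc 2) with hJ
  have hlow : ∀ᵐ t ∂timeMeasure T, J.compLp w t = H.trunc 1 (c 0) + prim v t := by
    filter_upwards [J.coeFn_compLp w, hval, ae_restrict_mem measurableSet_Ioo] with t h1 h2 h3
    rw [h1, ← hprim t (Ioo_subset_Icc_self h3), ← h2]
    rfl
  have hlow2 : ∀ᵐ t ∂timeMeasure T, (w t).toL2 = (J.compLp w t).toL2 := by
    filter_upwards [J.coeFn_compLp w] with t h1
    exact (congrArg (fun z : H 1 => z.toL2) h1).symm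
  have hweak : HasWeakTimeDeriv (J.compLp w) v := by
    intro φ h1 h2 h3
    have hae : (fun t => deriv φ t • J.compLp w t) =ᵐ[volume.restrict (Ioo 0 T)]
        fun t => deriv φ t • (H.trunc 1 (c 0) + prim v t) := by
      filter_upwards [hlow] with t ht
      rw [ht]
    rw [integral_congr_ae hae]
    exact integral_deriv_smul_prim hT v (H.trunc 1 (c 0)) h1 h3
  obtain ⟨u, hu, hv⟩ := E.exists_val_dt hlow2 hweak
  refine ⟨u, c, hcont, fun t ht => (hball _ (hc t ht)).2, ?_, rfl, ?_⟩
  · rw [hu]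
    filter_upwards [hval] with t ht
    rw [← ht]
    rfl
  · rw [hu, hv]
    filter_upwards [heq, ae_restrict_mem measurableSet_Ioo] with t ht htm
    have hct := hc t (Ioo_subset_Icc_self htm)
    obtain ⟨hreg, -⟩ := hball _ hct
    filter_upwards [H.toL2_principal hK hreg (w t), H.toL2_lower hK hreg,
      Lp.coeFn_add (H.principal (c t) (w t)).toL2 (H.lower (c t)).toL2] with x h2 h3 h4
    have e : (v t).toL2 = (H.principal (c t) (w t)).toL2 + (H.lower (c t)).toL2 := by
      rw [ht hct]
      rfl
    have e2 : (v t).toL2 x = opA (c t) (w t) x + lowerOrder (c t) x := by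
      rw [e, h4, Pi.add_apply, h2, h3]
    exact e2

end

end Langmuir

/-! ### The well-posedness theorem. -/

theorem theorem5p1 (γ₀ : Langmuir.H 2) (hγ₀ : γ₀ ∈ Langmuir.V) :
    ∃ T : ℝ, 0 < T ∧ ∃ ε : ℝ, 0 < ε ∧
      Metric.ball γ₀ ε ⊆ Langmuir.V ∧
      (∀ γ₁ ∈ Metric.ball γ₀ ε, ∃! u : Langmuir.E T, Langmuir.IsSolution T γ₁ u) ∧
      ∃ C : ℝ, 0 < C ∧ ∀ γ₁ ∈ Metric.ball γ₀ ε, ∀ γ₂ ∈ Metric.ball γ₀ ε,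
        ∀ u₁ u₂ : Langmuir.E T,
          Langmuir.IsSolution T γ₁ u₁ → Langmuir.IsSolution T γ₂ u₂ →
            ‖u₁ - u₂‖ ≤ C * ‖γ₁ - γ₂‖ := by
  obtain ⟨D, hD, h₂, h₃, hA, hf, K, hK, hball⟩ := Langmuir.H.exists_quasilinearData hγ₀
  obtain ⟨T, hT, ε, hε, hερ, hex, C, hC, hlip⟩ := D.wellPosed
  rw [hD] at hex hlip
  rw [← hD] at hball
  set N := ‖(Langmuir.H.trunc 1).comp (Langmuir.H.trunc 2)‖ with hN
  have hN0 : 0 ≤ N := ContinuousLinearMap.opNorm_nonneg _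
  -- The term `(1 + N) * C` covers the `H³` and `H¹` components of the norm and `C` the time
  -- derivative; the added `1` makes the constant positive.
  have key : ∀ γ₁ ∈ Metric.ball γ₀ ε, ∀ γ₂ ∈ Metric.ball γ₀ ε, ∀ u₁ u₂ : Langmuir.E T,
      Langmuir.IsSolution T γ₁ u₁ → Langmuir.IsSolution T γ₂ u₂ →
        ‖u₁ - u₂‖ ≤ ((1 + N) * C + C + 1) * ‖γ₁ - γ₂‖ := by
    intro γ₁ h1 γ₂ h2 u₁ u₂ s₁ s₂
    obtain ⟨c₁, k₁, rfl⟩ := s₁.isSol hT h₂ h₃ hA hf hK hball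
    obtain ⟨c₂, k₂, rfl⟩ := s₂.isSol hT h₂ h₃ hA hf hK hball
    obtain ⟨l1, l2⟩ := hlip _ _ _ _ _ _ k₁ k₂ h1 h2
    have h := (u₁ - u₂).norm_le
    rw [Langmuir.E.val_sub, Langmuir.E.dt_sub, ← hN] at h
    have h3 := mul_le_mul_of_nonneg_left l2 (by positivity : 0 ≤ 1 + N)
    have h4 := norm_nonneg (c₁ 0 - c₂ 0)
    linarith
  refine ⟨T, hT, ε, hε, fun γ hγ => (hball γ ?_).2, fun γ₁ h1 => ?_, _, by positivity, key⟩
  · rw [hD]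
    exact Metric.ball_subset_ball hερ hγ
  · obtain ⟨v, u, c, hs, h0, hc⟩ := hex γ₁ h1
    rw [← hD] at hc
    obtain ⟨w, hw⟩ := hs.isSolution hT h₂ h₃ hA hf hK hball hc
    rw [h0] at hw
    refine ⟨w, hw, fun w' hw' => ?_⟩
    -- Uniqueness is the Lipschitz estimate with equal initial values.
    have h := key γ₁ h1 γ₁ h1 w' w hw' hw
    rw [sub_self, norm_zero, mul_zero] at h
    exact sub_eq_zero.1 (norm_le_zero_iff.1 h)
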